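/- Let $M$ be a closed (compact, without boundary) smooth manifold of dimension $n$, let $\mathcal F$ be a smooth foliation of $M$ of dimension $p$ with leafwise tangent bundle $T\mathcal F\subset TM$, and let $g$ be a bundle-like Riemannian metric on $M$ (i.e. in every foliated chart the coefficients of the metric induced by $g$ on the normal bundle $T\mathcal F^{\perp}$ depend on the transverse coordinates only). Assume that $T\mathcal F$ is oriented, with leafwise volume form $\chi_{\mathcal F}$. Let $\Omega^{0,k}(M,\mathcal F)$ be the space of smooth leafwise $k$-forms, that is, of smooth sections of $\Lambda^kT^*\mathcal F$, identified by means of $g$ with the $k$-forms on $M$ that vanish if one argument lies in $T\mathcal F^\perp$. Let $d_{\mathcal F}:\Omega^{0,k}(M,\mathcal F)\to\Omega^{0,k+1}(M,\mathcal F)$ be the leafwise exterior derivative (the $T\mathcal F$-component of $d$), and let $*_{\mathcal F}:\Omega^{0,k}(M,\mathcal F)\to\Omega^{0,p-k}(M,\mathcal F)$, $0\le k\le p$, be the leafwise Hodge star operator, determined fibrewise by $\alpha\wedge *_{\mathcal F}\beta=\langle\alpha,\beta\rangle\,\chi_{\mathcal F}$. For a leafwise $1$-form $\omega\in\Omega^{0,1}(M,\mathcal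 F)$ with $d_{\mathcal F}\omega=0$ put $d^{\omega}_{\mathcal F}=d_{\mathcal F}+\omega\wedge$, let $\delta^{\omega}_{\mathcal F}$ be its formal adjoint with respect to the inner product $(\alpha,\beta)=\int_M\langle\alpha,\beta\rangle\,\mathrm{vol}_g$ on smooth leafwise forms, and let $\Delta_{\mathcal F,\omega}=d^{\omega}_{\mathcal F}\delta^{\omega}_{\mathcal F}+\delta^{\omega}_{\mathcal F}d^{\omega}_{\mathcal F}$ (with $\delta^\omega_{\mathcal F}=0$ on functions). Then these operators are well defined: $d^{\omega}_{\mathcal F}$ and $*_{\mathcal F}$ map smooth leafwise forms to smooth leafwise forms, the relation determining $*_{\mathcal F}\beta$ has exactly one solution at every point, and for every $\beta\in\Omega^{0,k+1}(M,\mathcal F)$ there is exactly one $\delta^\omega_{\mathcal F}\beta\in\Omega^{0,k}(M,\mathcal F)$ with $(d^\omega_{\mathcal F}\alpha,\beta)=(\alpha,\delta^\omega_{\mathcal F}\beta)$ for all $\alpha\in\Omega^{0,k}(M,\mathcal F)$. Moreover $$*_{\mathcal F}\,\Delta_{\mathcal F,\omega}\,\beta=\Delta_{\mathcal F,-\omega}\,*_{\mathcal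 F}\,\beta\qquad\text{for all }\beta\in\Omega^{0,k}(M,\mathcal F),\ 0\le k\le p,$$ and consequently $*_{\mathcal F}$ maps $\Delta_{\mathcal F,\omega}$-harmonic forms to $\Delta_{\mathcal F,-\omega}$-harmonic forms. -/

import Mathlib

open Bundle Manifold MeasureTheory
open scoped ContDiff

noncomputable section

namespace Leafwise

/-- The model `ℝⁿ`. -/
abbrev Model (n : ℕ) : Type := EuclideanSpace ℝ (Fin n)

/-- The subspace `ℝᵖ × {0}` of `ℝⁿ`. -/
def leafModel (n p : ℕ) : Submodule ℝ (Model n) where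
  carrier := {v | ∀ i : Fin n, p ≤ (i : ℕ) → v i = 0}
  add_mem' := by
    intro a b ha hb i hi
    simp [ha i hi, hb i hi]
  zero_mem' := by
    intro i _
    simp
  smul_mem' := by
    intro c a ha i hi
    simp [ha i hi]

section Foliation

variable {n : ℕ} {M : Type*} [TopologicalSpace M] [ChartedSpace (Model n) M]

/-- `φ` is a smooth chart of `M` in which the distribution `D` is everywhere spanned by the first
`p` coordinate vector fields. -/
def IsFlatChart (p : ℕ) (D : ∀ x : M, Submodule ℝ (TangentSpace (𝓡 n) x))
    (φ : OpenPartialHomeomorph M (Model n)) : Prop :=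
  φ ∈ IsManifold.maximalAtlas (𝓡 n) ∞ M ∧
    ∀ y ∈ φ.source, ∀ v : TangentSpace (𝓡 n) y,
      v ∈ D y ↔ (mfderiv (𝓡 n) (𝓡 n) φ y v : Model n) ∈ leafModel n p

variable (n M) in
/-- A smooth `p`-dimensional foliation of `M`, given by its leafwise tangent bundle `T𝓕`: around
every point there is a foliated chart, that is, a smooth chart whose slices
`{x_{p+1} = c_{p+1}, …, x_n = c_n}` are tangent to `T𝓕`. The leaves are obtained by gluing these
slices. -/
structure Foliation (p : ℕ) where
  /-- the tangent space at `x` of the leaf through `x` -/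
  tangent : ∀ x : M, Submodule ℝ (TangentSpace (𝓡 n) x)
  finrank_tangent : ∀ x, Module.finrank ℝ (tangent x) = p
  exists_flatChart : ∀ x, ∃ φ : OpenPartialHomeomorph M (Model n),
    x ∈ φ.source ∧ IsFlatChart p tangent φ

end Foliation

variable {n p k l m : ℕ} {M : Type*} [TopologicalSpace M] [ChartedSpace (Model n) M]

instance finiteDimensional_tangentSpace (x : M) : FiniteDimensional ℝ (TangentSpace (𝓡 n) x) :=
  inferInstanceAs (FiniteDimensional ℝ (Model n))

instance fact_finrank_tangent (F : Foliation n M p) (x : M) : Fact (Module.finrank ℝ (F.tangent x) = p) :=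
  ⟨F.finrank_tangent x⟩

/-- Fields of alternating `k`-forms on the leafwise tangent spaces, i.e. arbitrary (not necessarily
smooth) sections of `Λᵏ T*𝓕`. -/
abbrev LeafForm (F : Foliation n M p) (k : ℕ) : Type _ :=
  ∀ x : M, (F.tangent x) [⋀^Fin k]→ₗ[ℝ] ℝ

/-- The (shuffle) wedge product of alternating forms. -/
def wedgeAlt {V : Type*} [AddCommGroup V] [Module ℝ V] (h : k + l = m)
    (a : V [⋀^Fin k]→ₗ[ℝ] ℝ) (b : V [⋀^Fin l]→ₗ[ℝ] ℝ) : V [⋀^Fin m]→ₗ[ℝ] ℝ :=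
  ((LinearMap.mul' ℝ ℝ).compAlternatingMap (a.domCoprod b)).domDomCongr
    (finSumFinEquiv.trans (finCongr h))

/-- The inner product on `Λᵏ V*` induced by the one of `V`: for an orthonormal basis `e` of `V`
the forms `e^{i₁} ∧ ⋯ ∧ e^{i_k}` with `i₁ < ⋯ < i_k` are orthonormal. The sum runs over all
`k`-tuples of indices, so each increasing one is counted `k!` times. -/
def innerAlt {V : Type*} [NormedAddCommGroup V] [InnerProductSpace ℝ V] [FiniteDimensional ℝ V]
    (a b : V [⋀^Fin k]→ₗ[ℝ] ℝ) : ℝ :=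
  (k.factorial : ℝ)⁻¹ * ∑ I : Fin k → Fin (Module.finrank ℝ V),
    a (fun j => stdOrthonormalBasis ℝ V (I j)) * b (fun j => stdOrthonormalBasis ℝ V (I j))

/-- `c` is the Hodge dual of `b`: `a ∧ c = ⟨a, b⟩ vol` for every `a`. -/
def IsStarAlt {V : Type*} [NormedAddCommGroup V] [InnerProductSpace ℝ V]
    [FiniteDimensional ℝ V] [Fact (Module.finrank ℝ V = p)] (o : Orientation ℝ V (Fin p))
    (h : k + l = p) (b : V [⋀^Fin k]→ₗ[ℝ] ℝ) (c : V [⋀^Fin l]→ₗ[ℝ] ℝ) : Prop :=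
  ∀ a : V [⋀^Fin k]→ₗ[ℝ] ℝ, wedgeAlt h a c = innerAlt a b • o.volumeForm

open Classical in
/-- The Hodge star operator `Λᵏ V* → Λˡ V*`, `k + l = p = dim V`. -/
def starAlt {V : Type*} [NormedAddCommGroup V] [InnerProductSpace ℝ V]
    [FiniteDimensional ℝ V] [Fact (Module.finrank ℝ V = p)] (o : Orientation ℝ V (Fin p))
    (h : k + l = p) (b : V [⋀^Fin k]→ₗ[ℝ] ℝ) : V [⋀^Fin l]→ₗ[ℝ] ℝ :=
  if hb : ∃ c, IsStarAlt o h b c then hb.choose else 0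

theorem continuous_alt (a : Model n [⋀^Fin k]→ₗ[ℝ] ℝ) : Continuous a := by
  have h : ∀ v : Fin k → Model n, a v = ∑ r : Fin k → Fin n,
      (∏ i, v i (r i)) * a (fun i => EuclideanSpace.basisFun (Fin n) ℝ (r i)) := by
    intro v
    have hv : v = fun i => ∑ j, v i j • EuclideanSpace.basisFun (Fin n) ℝ j := by
      funext i
      simpa using ((EuclideanSpace.basisFun (Fin n) ℝ).sum_repr (v i)).symm
    conv_lhs => rw [hv]
    have h1 := a.toMultilinearMap.map_sum
      (g := fun (i : Fin k) (j : Fin n) => v i j • EuclideanSpace.basisFun (Fin n) ℝ j)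
    refine h1.trans (Finset.sum_congr rfl fun r _ => ?_)
    exact a.toMultilinearMap.map_smul_univ _ _
  rw [show (a : (Fin k → Model n) → ℝ) = _ from funext h]
  fun_prop

/-- An alternating form on `ℝⁿ` as a continuous alternating form. -/
def toContinuousAlt (a : Model n [⋀^Fin k]→ₗ[ℝ] ℝ) : Model n [⋀^Fin k]→L[ℝ] ℝ :=
  { a with cont := continuous_alt a }

/-- The derivative at `u` of the inverse of the chart `φ`. -/
def chartInvDeriv (φ : OpenPartialHomeomorph M (Model n)) (u : Model n) :
    Model n →L[ℝ] TangentSpace (𝓡 n) (φ.symm u) :=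
  mfderiv (𝓡 n) (𝓡 n) φ.symm u

/-- The derivative at `x` of the chart `φ`. -/
def chartDeriv (φ : OpenPartialHomeomorph M (Model n)) (x : M) :
    TangentSpace (𝓡 n) x →L[ℝ] Model n :=
  mfderiv (𝓡 n) (𝓡 n) φ x

section Riemannian

variable [RiemannianBundle (fun x : M => TangentSpace (𝓡 n) x)]

/-- The volume density `√(det g_{ij})` of the Riemannian metric in the chart `φ`. -/
def volDensity (φ : OpenPartialHomeomorph M (Model n)) (u : Model n) : ℝ :=
  √(Matrix.det (Matrix.of fun i j : Fin n =>
    (inner ℝ (chartInvDeriv φ u (EuclideanSpace.basisFun (Fin n) ℝ i))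
      (chartInvDeriv φ u (EuclideanSpace.basisFun (Fin n) ℝ j)) : ℝ)))

/-- The Riemannian volume of the domain of the chart `φ`, extended by zero to `M`. -/
def chartVolume [MeasurableSpace M] (φ : OpenPartialHomeomorph M (Model n)) : Measure M :=
  (((volume : Measure (Model n)).restrict φ.target).withDensity
    fun u => ENNReal.ofReal (volDensity φ u)).map φ.symm

variable (n M) in
/-- The Riemannian volume measure: the smallest measure on `M` which dominates the chart volume
`√(det g_{ij}) dx` of every chart of the atlas. Since these agree on the overlaps of the charts,
it restricts to each of them on the domain of the corresponding chart. -/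
def riemannianVolume [MeasurableSpace M] : Measure M :=
  ⨆ φ ∈ atlas (Model n) M, chartVolume φ

variable {F : Foliation n M p}

/-- The leafwise form `α`, extended by zero on the normal bundle `T𝓕^⊥`, in the chart `φ`. -/
def chartForm (α : LeafForm F k) (φ : OpenPartialHomeomorph M (Model n)) (u : Model n) :
    Model n [⋀^Fin k]→L[ℝ] ℝ :=
  toContinuousAlt ((α (φ.symm u)).compLinearMap
    ((F.tangent (φ.symm u)).orthogonalProjectionOnto.toLinearMap ∘ₗ (chartInvDeriv φ u).toLinearMap))

/-- `α ∈ Ω^{0,k}(M, 𝓕)`: the form `α` is smooth in the charts of the atlas. -/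
def IsSmooth (α : LeafForm F k) : Prop :=
  ∀ φ ∈ atlas (Model n) M, ContDiffOn ℝ ∞ (chartForm α φ) φ.target

/-- The leafwise differential `d_𝓕 = d_{0,1}`: the restriction to `T𝓕` of the exterior derivative
of the form on `M` which extends `α` by zero on `T𝓕^⊥`. -/
def leafD (α : LeafForm F k) : LeafForm F (k + 1) := fun x =>
  (extDeriv (chartForm α (chartAt (Model n) x))
    (chartAt (Model n) x x)).toAlternatingMap.compLinearMap
      ((chartDeriv (chartAt (Model n) x) x).toLinearMap ∘ₗ (F.tangent x).subtype)

/-- The wedge product of leafwise forms. -/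
def wedge (h : k + l = m) (α : LeafForm F k) (β : LeafForm F l) : LeafForm F m :=
  fun x => wedgeAlt h (α x) (β x)

/-- The twisted differential `d_𝓕 + η ∧`. -/
def twistedD (η : LeafForm F 1) (α : LeafForm F k) : LeafForm F (k + 1) :=
  leafD α + wedge (Nat.add_comm 1 k) η α

/-- The inner product `(α, β) = ∫_M ⟨α, β⟩_𝓕 vol`. -/
def l2Inner [MeasurableSpace M] (α β : LeafForm F k) : ℝ :=
  ∫ x, innerAlt (α x) (β x) ∂(riemannianVolume n M)

/-- The smooth leafwise form `γ` is the value at `β` of the formal adjoint of `d_𝓕 + η ∧`. -/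
def IsAdjointValue [MeasurableSpace M] (η : LeafForm F 1) (β : LeafForm F (k + 1))
    (γ : LeafForm F k) : Prop :=
  IsSmooth γ ∧ ∀ α : LeafForm F k, IsSmooth α → l2Inner (twistedD η α) β = l2Inner α γ

open Classical in
/-- The formal adjoint of `d_𝓕 + η ∧`. -/
def twistedDelta [MeasurableSpace M] (η : LeafForm F 1) (β : LeafForm F (k + 1)) : LeafForm F k :=
  if h : ∃ γ, IsAdjointValue η β γ then h.choose else 0

/-- The twisted leafwise Laplacian `Δ_{𝓕,η}`, the Laplacian of the differential `d_𝓕 + η ∧`. -/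
def twistedLaplacian [MeasurableSpace M] (η : LeafForm F 1) :
    ∀ {k : ℕ}, LeafForm F k → LeafForm F k
  | 0, α => twistedDelta η (twistedD η α)
  | _ + 1, α => twistedD η (twistedDelta η α) + twistedDelta η (twistedD η α)

/-- The smooth leafwise form `α` is `Δ_{𝓕,η}`-harmonic. -/
def IsHarmonic [MeasurableSpace M] (η : LeafForm F 1) (α : LeafForm F k) : Prop :=
  IsSmooth α ∧ twistedLaplacian η α = 0

/-- An orientation of the bundle `T𝓕`: the orientations of the fibres are represented by a nowhere
vanishing smooth leafwise `p`-form. -/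
def IsLeafOrientation (o : ∀ x : M, Orientation ℝ (F.tangent x) (Fin p)) : Prop :=
  ∃ θ : LeafForm F p, IsSmooth θ ∧ ∀ x, ∃ h : θ x ≠ 0, o x = rayOfNeZero ℝ (θ x) h

/-- The leafwise Hodge star operator. -/
def hodgeStar (o : ∀ x : M, Orientation ℝ (F.tangent x) (Fin p)) (h : k + l = p)
    (β : LeafForm F k) : LeafForm F l :=
  fun x => starAlt (o x) h (β x)

/-- The coefficients of the metric of the normal bundle `T𝓕^⊥` in the chart `φ`: the inner product
of the normal components of the constant coordinate fields `v` and `w`. -/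
def normalMetric (F : Foliation n M p) (φ : OpenPartialHomeomorph M (Model n)) (v w u : Model n) :
    ℝ :=
  inner ℝ ((F.tangent (φ.symm u))ᗮ.starProjection (chartInvDeriv φ u v))
    ((F.tangent (φ.symm u))ᗮ.starProjection (chartInvDeriv φ u w))

/-- The Riemannian metric is bundle-like: in foliated charts the coefficients of its normal part
are constant along the leaves, i.e. depend on the transverse coordinates only. -/
def IsBundleLike (F : Foliation n M p) : Prop :=
  ∀ φ : OpenPartialHomeomorph M (Model n), IsFlatChart p F.tangent φ →
    ∀ v w : Model n, ∀ u ∈ φ.target, ∀ e ∈ leafModel n p,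
      fderiv ℝ (normalMetric F φ v w) u e = 0

end Riemannian

end Leafwise

end

open Bundle Manifold MeasureTheory
open scoped ContDiff

set_option linter.unusedSectionVars false

noncomputable section

namespace Leafwise

/-! ### Wedge products as sums over permutations and the pointwise Leibniz rule -/

section Algebra

variable {n p k l m : ℕ} {V : Type*} [AddCommGroup V] [Module ℝ V]

/-! Write d^η for `twistedD η` and δ^η for its adjoint. Everything rests on one integration by
parts. For leafwise forms α, σ of degrees k, l with k + 1 + l = p, the leafwise top form d^η α ∧ σ +
(-1)^k α ∧ d^{-η} σ equals d_𝓕(α ∧ σ): the terms with η cancel because the twist changes sign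
(`wedge_twistedD_add`). Dividing by the leafwise volume form gives the function `stokesIntegrand`,
and the claim is that its integral over M vanishes (`integral_stokesIntegrand`).

This is not the usual Stokes theorem, since only leafwise derivatives occur while the integral runs
over M. In a foliated chart the volume density is the leafwise volume of the coordinate fields times
a transverse density, whose square is the Gram determinant of the normal metric (`transDensity_sq`).
A bundle-like metric makes this factor constant along the leaves (`fderiv_transDensity`), so it
passes under the leafwise derivatives, and the integrand becomes a sum of partial derivatives of
compactly supported functions. A partition of unity globalises this.

Since α ∧ σ = ⟨α, *⁻¹σ⟩ χ, the vanishing integral has two readings. With σ = *β it produces the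
adjoint, * δ^η = (-1)^{k+1} d^{-η} * on (k+1)-forms (`hodgeStar_twistedDelta`); with σ as test form
it gives δ^{-η} * = (-1)^{k+1} * d^η on k-forms (`twistedDelta_hodgeStar`). Uniqueness of the
adjoint is positivity of the L² product on smooth forms. Using *⁻¹ throughout avoids the sign of **.
Combining the two readings, the signs cancel: * d^η δ^η = δ^{-η} d^{-η} * and * δ^η d^η = d^{-η}
δ^{-η} *. The star exchanges the two halves of the Laplacian, and the intertwining relation is their
sum.

The rest makes the invariant objects computable: the star is given by an explicit formula in any
orthonormal basis (`starAlt_eq_starS`), leafwise forms are tested on Gram–Schmidt frames of foliated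
charts (`isSmooth_of_frame`), and the volume measure, a supremum over atlas charts, is identified in
every chart of the maximal atlas (`riemannianVolume_apply`). -/

/-- The inclusion of the first `k` of `m = k + l` indices. -/
def idxL (h : k + l = m) (i : Fin k) : Fin m := Fin.cast h (Fin.castAdd l i)

/-- The inclusion of the last `l` of `m = k + l` indices. -/
def idxR (h : k + l = m) (j : Fin l) : Fin m := Fin.cast h (Fin.natAdd k j)

@[simp] theorem idxL_val (h : k + l = m) (i : Fin k) : (idxL h i : ℕ) = i := rfl

@[simp] theorem idxR_val (h : k + l = m) (j : Fin l) : (idxR h j : ℕ) = k + j := rfl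

/-- The wedge product as a sum over all permutations. -/
theorem factorial_mul_wedgeAlt_apply (h : k + l = m) (a : V [⋀^Fin k]→ₗ[ℝ] ℝ)
    (b : V [⋀^Fin l]→ₗ[ℝ] ℝ) (v : Fin m → V) :
    ((k.factorial : ℝ) * l.factorial) * wedgeAlt h a b v =
      ∑ s : Equiv.Perm (Fin m), ((Equiv.Perm.sign s : ℤ) : ℝ) *
        (a (fun i => v (s (idxL h i))) * b (fun j => v (s (idxR h j)))) := by
  set e : Fin k ⊕ Fin l ≃ Fin m := finSumFinEquiv.trans (finCongr h) with he
  -- Alternating the plain tensor product over all of S_m meets every shuffle class k! l! times.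
  have key := congrArg (fun f : V [⋀^Fin k ⊕ Fin l]→ₗ[ℝ] (TensorProduct ℝ ℝ ℝ) =>
    LinearMap.mul' ℝ ℝ (f (v ∘ e))) (MultilinearMap.domCoprod_alternization_eq a b)
  simp only [MultilinearMap.alternatization_apply, map_sum, Fintype.card_fin] at key
  have h1 : wedgeAlt h a b v = LinearMap.mul' ℝ ℝ (a.domCoprod b (v ∘ e)) := rfl
  rw [h1]
  have h2 : ((k.factorial : ℝ) * l.factorial) * LinearMap.mul' ℝ ℝ (a.domCoprod b (v ∘ e)) =
      LinearMap.mul' ℝ ℝ (((k.factorial * l.factorial) • a.domCoprod b) (v ∘ e)) := by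
    rw [AlternatingMap.smul_apply, map_nsmul, nsmul_eq_mul]
    push_cast
    ring
  rw [h2, ← key]
  refine Fintype.sum_equiv e.permCongr _ _ fun s => ?_
  rw [Equiv.Perm.sign_permCongr, Units.smul_def, map_zsmul, zsmul_eq_mul]
  congr 1
  simp only [MultilinearMap.domDomCongr_apply, MultilinearMap.domCoprod_apply,
    LinearMap.mul'_apply, Equiv.permCongr_apply]
  have hL : ∀ i, e.symm (idxL h i) = Sum.inl i := fun i => e.symm_apply_apply (Sum.inl i)
  have hR : ∀ i, e.symm (idxR h i) = Sum.inr i := fun i => e.symm_apply_apply (Sum.inr i)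
  simp only [hL, hR]
  rfl

theorem wedgeAlt_apply (h : k + l = m) (a : V [⋀^Fin k]→ₗ[ℝ] ℝ)
    (b : V [⋀^Fin l]→ₗ[ℝ] ℝ) (v : Fin m → V) :
    wedgeAlt h a b v = ((k.factorial : ℝ) * l.factorial)⁻¹ *
      ∑ s : Equiv.Perm (Fin m), ((Equiv.Perm.sign s : ℤ) : ℝ) *
        (a (fun i => v (s (idxL h i))) * b (fun j => v (s (idxR h j)))) := by
  rw [← factorial_mul_wedgeAlt_apply, inv_mul_cancel_left₀ (by positivity)]

/-- Averaging over permutations of the first block. -/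
theorem sum_perm_alternatizeUncurryFin_left (h : (k + 1) + l = m)
    (A : V →ₗ[ℝ] V [⋀^Fin k]→ₗ[ℝ] ℝ) (c : V [⋀^Fin l]→ₗ[ℝ] ℝ) (v : Fin m → V) :
    ((k.factorial : ℝ) * l.factorial) *
        wedgeAlt h (AlternatingMap.alternatizeUncurryFin A) c v =
      ∑ s : Equiv.Perm (Fin m), ((Equiv.Perm.sign s : ℤ) : ℝ) *
        (A (v (s (idxL h 0))) (fun i => v (s (idxL h i.succ))) *
          c (fun j => v (s (idxR h j)))) := by
  set e : Fin (k + 1) ⊕ Fin l ≃ Fin m := finSumFinEquiv.trans (finCongr h) with he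
  have hk : ((k : ℝ) + 1) ≠ 0 := by positivity
  apply mul_left_cancel₀ hk
  have h1 := factorial_mul_wedgeAlt_apply h (AlternatingMap.alternatizeUncurryFin A) c v
  rw [Nat.factorial_succ] at h1
  push_cast at h1
  rw [← mul_assoc, ← mul_assoc, h1]
  simp only [AlternatingMap.alternatizeUncurryFin_apply, Finset.sum_mul, Finset.mul_sum]
  rw [Finset.sum_comm]
  -- All k + 1 terms of the alternatization contribute equally: replacing s by s r, where r cycles
  -- the positions 0, …, i of the first block, brings the i-th argument to the front and costs
  -- (-1)^i, which cancels the sign of the term. This factor k + 1 reduces (k+1)! to k!.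
  have h2 : ∀ i : Fin (k + 1),
      (∑ s : Equiv.Perm (Fin m), ((Equiv.Perm.sign s : ℤ) : ℝ) *
        ((-1) ^ (i : ℕ) • A (v (s (idxL h i)))
          (Fin.removeNth i fun i => v (s (idxL h i))) * c (fun j => v (s (idxR h j))))) =
      ∑ s : Equiv.Perm (Fin m), ((Equiv.Perm.sign s : ℤ) : ℝ) *
        (A (v (s (idxL h 0))) (fun i => v (s (idxL h i.succ))) *
          c (fun j => v (s (idxR h j)))) := by
    intro i
    set r : Equiv.Perm (Fin m) :=
      e.permCongr (Equiv.Perm.sumCongr i.cycleRange (1 : Equiv.Perm (Fin l))) with hr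
    have hsr : Equiv.Perm.sign r = (-1) ^ (i : ℕ) := by
      rw [hr, Equiv.Perm.sign_permCongr, Equiv.Perm.sign_sumCongr, Fin.sign_cycleRange]
      simp
    have hrL : ∀ j, r (idxL h j) = idxL h (i.cycleRange j) := by
      intro j
      have : idxL h j = e (Sum.inl j) := rfl
      rw [this, hr, Equiv.permCongr_apply, Equiv.symm_apply_apply]
      rfl
    have hrR : ∀ j, r (idxR h j) = idxR h j := by
      intro j
      have : idxR h j = e (Sum.inr j) := rfl
      rw [this, hr, Equiv.permCongr_apply, Equiv.symm_apply_apply]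
      rfl
    symm
    refine Fintype.sum_equiv (Equiv.mulRight r) _ _ fun s => ?_
    have hsign : ((Equiv.Perm.sign (s * r) : ℤ) : ℝ) =
        ((Equiv.Perm.sign s : ℤ) : ℝ) * (-1) ^ (i : ℕ) := by
      rw [Equiv.Perm.sign_mul, hsr]
      push_cast
      rfl
    have hsq : ((-1 : ℝ) ^ (i : ℕ)) * (-1) ^ (i : ℕ) = 1 := by
      rw [← pow_add, Even.neg_one_pow ⟨_, rfl⟩]
    simp only [Equiv.coe_mulRight, hsign, Equiv.Perm.coe_mul, Function.comp_apply, hrL, hrR,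
      Fin.cycleRange_self]
    have hrem : (i.removeNth fun i_1 => v (s (idxL h (i.cycleRange i_1)))) =
        fun i => v (s (idxL h i.succ)) := by
      funext j
      simp [Fin.removeNth, Fin.cycleRange_succAbove]
    rw [hrem]
    linear_combination (-(((Equiv.Perm.sign s : ℤ) : ℝ) * (A (v (s (idxL h 0))) (fun i => v (s (idxL h i.succ))) *
          c (fun j => v (s (idxR h j)))))) * hsq
  rw [Finset.sum_congr rfl fun i _ => h2 i]
  simp [Finset.mul_sum]

/-- Averaging over permutations of the second block. -/
theorem sum_perm_alternatizeUncurryFin_right (h : k + (l + 1) = m)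
    (a : V [⋀^Fin k]→ₗ[ℝ] ℝ) (C : V →ₗ[ℝ] V [⋀^Fin l]→ₗ[ℝ] ℝ) (v : Fin m → V) :
    ((k.factorial : ℝ) * l.factorial) *
        wedgeAlt h a (AlternatingMap.alternatizeUncurryFin C) v =
      ∑ s : Equiv.Perm (Fin m), ((Equiv.Perm.sign s : ℤ) : ℝ) *
        (a (fun i => v (s (idxL h i))) *
          C (v (s (idxR h 0))) (fun j => v (s (idxR h j.succ)))) := by
  set e : Fin k ⊕ Fin (l + 1) ≃ Fin m := finSumFinEquiv.trans (finCongr h) with he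
  have hk : ((l : ℝ) + 1) ≠ 0 := by positivity
  apply mul_left_cancel₀ hk
  have h1 := factorial_mul_wedgeAlt_apply h a (AlternatingMap.alternatizeUncurryFin C) v
  rw [Nat.factorial_succ] at h1
  push_cast at h1
  rw [show ((l : ℝ) + 1) * ((k.factorial : ℝ) * l.factorial *
    wedgeAlt h a (AlternatingMap.alternatizeUncurryFin C) v) = k.factorial *
      (((l : ℝ) + 1) * l.factorial) * wedgeAlt h a (AlternatingMap.alternatizeUncurryFin C) v by
        ring, h1]
  simp only [AlternatingMap.alternatizeUncurryFin_apply, Finset.mul_sum]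
  rw [Finset.sum_comm]
  have h2 : ∀ i : Fin (l + 1),
      (∑ s : Equiv.Perm (Fin m), ((Equiv.Perm.sign s : ℤ) : ℝ) *
        (a (fun j => v (s (idxL h j))) * (-1) ^ (i : ℕ) • C (v (s (idxR h i)))
          (Fin.removeNth i fun i => v (s (idxR h i))))) =
      ∑ s : Equiv.Perm (Fin m), ((Equiv.Perm.sign s : ℤ) : ℝ) *
        (a (fun i => v (s (idxL h i))) *
          C (v (s (idxR h 0))) (fun j => v (s (idxR h j.succ)))) := by
    intro i
    set r : Equiv.Perm (Fin m) :=
      e.permCongr (Equiv.Perm.sumCongr (1 : Equiv.Perm (Fin k)) i.cycleRange) with hr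
    have hsr : Equiv.Perm.sign r = (-1) ^ (i : ℕ) := by
      rw [hr, Equiv.Perm.sign_permCongr, Equiv.Perm.sign_sumCongr, Fin.sign_cycleRange]
      simp
    have hrR : ∀ j, r (idxR h j) = idxR h (i.cycleRange j) := by
      intro j
      have : idxR h j = e (Sum.inr j) := rfl
      rw [this, hr, Equiv.permCongr_apply, Equiv.symm_apply_apply]
      rfl
    have hrL : ∀ j, r (idxL h j) = idxL h j := by
      intro j
      have : idxL h j = e (Sum.inl j) := rfl
      rw [this, hr, Equiv.permCongr_apply, Equiv.symm_apply_apply]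
      rfl
    symm
    refine Fintype.sum_equiv (Equiv.mulRight r) _ _ fun s => ?_
    have hsign : ((Equiv.Perm.sign (s * r) : ℤ) : ℝ) =
        ((Equiv.Perm.sign s : ℤ) : ℝ) * (-1) ^ (i : ℕ) := by
      rw [Equiv.Perm.sign_mul, hsr]
      push_cast
      rfl
    have hsq : ((-1 : ℝ) ^ (i : ℕ)) * (-1) ^ (i : ℕ) = 1 := by
      rw [← pow_add, Even.neg_one_pow ⟨_, rfl⟩]
    simp only [Equiv.coe_mulRight, hsign, Equiv.Perm.coe_mul, Function.comp_apply, hrL, hrR,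
      Fin.cycleRange_self]
    have hrem : (i.removeNth fun i_1 => v (s (idxR h (i.cycleRange i_1)))) =
        fun i => v (s (idxR h i.succ)) := by
      funext j
      simp [Fin.removeNth, Fin.cycleRange_succAbove]
    rw [hrem]
    linear_combination (-(((Equiv.Perm.sign s : ℤ) : ℝ) * (a (fun i => v (s (idxL h i))) *
          C (v (s (idxR h 0))) (fun j => v (s (idxR h j.succ)))))) * hsq
  rw [Finset.sum_congr rfl fun i _ => h2 i]
  simp [Finset.mul_sum]

/-- The algebraic form of the Leibniz rule for the wedge product. -/
theorem wedgeAlt_alternatizeUncurryFin_add (h₁ : (k + 1) + l = m) (h₂ : k + (l + 1) = m)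
    (a : V [⋀^Fin k]→ₗ[ℝ] ℝ) (c : V [⋀^Fin l]→ₗ[ℝ] ℝ)
    (A : V →ₗ[ℝ] V [⋀^Fin k]→ₗ[ℝ] ℝ) (C : V →ₗ[ℝ] V [⋀^Fin l]→ₗ[ℝ] ℝ) (v : Fin m → V) :
    wedgeAlt h₁ (AlternatingMap.alternatizeUncurryFin A) c v +
        (-1) ^ k * wedgeAlt h₂ a (AlternatingMap.alternatizeUncurryFin C) v =
      ((k.factorial : ℝ) * l.factorial)⁻¹ *
      ∑ s : Equiv.Perm (Fin m), ((Equiv.Perm.sign s : ℤ) : ℝ) *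
        (A (v (s (idxL h₁ 0))) (fun i => v (s (idxL h₁ i.succ))) *
            c (fun j => v (s (idxR h₁ j))) +
          a (fun i => v (s (idxL h₁ i.succ))) *
            C (v (s (idxL h₁ 0))) (fun j => v (s (idxR h₁ j)))) := by
  have hkl : ((k.factorial : ℝ) * l.factorial) ≠ 0 := by positivity
  apply mul_left_cancel₀ hkl
  rw [mul_inv_cancel_left₀ hkl, mul_add, sum_perm_alternatizeUncurryFin_left,
    mul_left_comm, sum_perm_alternatizeUncurryFin_right]
  simp only [mul_add, Finset.sum_add_distrib]
  congr 1
  have hm : k < m := by omega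
  -- In the second term the differentiating vector sits in position k, behind the arguments of a.
  -- The cycle bringing it to position 0 has sign (-1)^k, the sign of the Leibniz rule.
  set r : Equiv.Perm (Fin m) := (⟨k, hm⟩ : Fin m).cycleRange with hr
  have hsr : Equiv.Perm.sign r = (-1) ^ k := Fin.sign_cycleRange _
  have hrL : ∀ i, r (idxL h₂ i) = idxL h₁ i.succ := by
    intro i
    apply Fin.ext
    rw [hr, Fin.coe_cycleRange_of_lt]
    · simp
    · rw [Fin.lt_def]
      exact i.2
  have hr0 : r (idxR h₂ 0) = idxL h₁ 0 := by
    have h0 : idxR h₂ 0 = ⟨k, hm⟩ := Fin.ext rfl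
    have : NeZero m := ⟨by omega⟩
    rw [h0, hr, Fin.cycleRange_self]
    exact Fin.ext (by simp)
  have hrR : ∀ j, r (idxR h₂ j.succ) = idxR h₁ j := by
    intro j
    rw [hr, Fin.cycleRange_of_gt]
    · exact Fin.ext (by simp; omega)
    · rw [Fin.lt_def]
      simp
  rw [Finset.mul_sum]
  symm
  refine Fintype.sum_equiv (Equiv.mulRight r) _ _ fun s => ?_
  have hsign : ((Equiv.Perm.sign (s * r) : ℤ) : ℝ) =
      ((Equiv.Perm.sign s : ℤ) : ℝ) * (-1) ^ k := by
    rw [Equiv.Perm.sign_mul, hsr]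
    push_cast
    rfl
  have hsq : ((-1 : ℝ) ^ k) * (-1) ^ k = 1 := by
    rw [← pow_add, Even.neg_one_pow ⟨_, rfl⟩]
  simp only [Equiv.coe_mulRight, hsign, Equiv.Perm.coe_mul, Function.comp_apply, hrL, hrR, hr0]
  linear_combination (-(((Equiv.Perm.sign s : ℤ) : ℝ) * (a (fun i => v (s (idxL h₁ i.succ))) *
            C (v (s (idxL h₁ 0))) (fun j => v (s (idxR h₁ j)))))) * hsq

/-- The linear map `v ↦ t(v) a`. -/
def tensorAlt (t : V [⋀^Fin 1]→ₗ[ℝ] ℝ) (a : V [⋀^Fin k]→ₗ[ℝ] ℝ) :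
    V →ₗ[ℝ] V [⋀^Fin k]→ₗ[ℝ] ℝ where
  toFun v := t (fun _ => v) • a
  map_add' v w := by
    have := t.map_update_add (fun _ => 0) 0 v w
    have e : ∀ x : V, Function.update (fun _ : Fin 1 => (0 : V)) 0 x = fun _ => x := by
      intro x
      funext i
      rw [Subsingleton.elim i 0, Function.update_self]
    rw [e, e, e] at this
    rw [this, add_smul]
  map_smul' c v := by
    have := t.map_update_smul (fun _ => 0) 0 c v
    have e : ∀ x : V, Function.update (fun _ : Fin 1 => (0 : V)) 0 x = fun _ => x := by
      intro x
      funext i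
      rw [Subsingleton.elim i 0, Function.update_self]
    rw [e, e] at this
    rw [this, RingHom.id_apply, smul_assoc]

theorem tensorAlt_apply (t : V [⋀^Fin 1]→ₗ[ℝ] ℝ) (a : V [⋀^Fin k]→ₗ[ℝ] ℝ) (v : V) :
    tensorAlt t a v = t (fun _ => v) • a := rfl

/-- The wedge product with a `1`-form. -/
theorem wedgeAlt_one_left (t : V [⋀^Fin 1]→ₗ[ℝ] ℝ) (a : V [⋀^Fin k]→ₗ[ℝ] ℝ) :
    wedgeAlt (Nat.add_comm 1 k) t a = AlternatingMap.alternatizeUncurryFin (tensorAlt t a) := by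
  ext v
  -- Wedging with the constant 0-form 1 (so l = 0) turns the block lemma into a formula for a single
  -- alternatization as a sum over all permutations.
  have h0 := sum_perm_alternatizeUncurryFin_left (l := 0) rfl (tensorAlt t a)
    (AlternatingMap.constOfIsEmpty ℝ V (Fin 0) 1) v
  have h1 := factorial_mul_wedgeAlt_apply (Nat.add_comm 1 k) t a v
  have h2 := factorial_mul_wedgeAlt_apply (l := 0) rfl
    (AlternatingMap.alternatizeUncurryFin (tensorAlt t a))
    (AlternatingMap.constOfIsEmpty ℝ V (Fin 0) 1) v
  have hv : ∀ s : Equiv.Perm (Fin (k + 1)),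
      AlternatingMap.alternatizeUncurryFin (tensorAlt t a)
        (fun i => v (s (idxL (l := 0) rfl i))) = ((Equiv.Perm.sign s : ℤ) : ℝ) *
      AlternatingMap.alternatizeUncurryFin (tensorAlt t a) v := by
    intro s
    have := (AlternatingMap.alternatizeUncurryFin (tensorAlt t a)).map_perm v s
    rw [Units.smul_def, zsmul_eq_mul] at this
    rw [← this]
    rfl
  simp only [hv, AlternatingMap.constOfIsEmpty_apply, Function.const_apply, mul_one] at h2
  have hs : ∀ s : Equiv.Perm (Fin (k + 1)), ((Equiv.Perm.sign s : ℤ) : ℝ) *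
      (((Equiv.Perm.sign s : ℤ) : ℝ) *
        AlternatingMap.alternatizeUncurryFin (tensorAlt t a) v) =
      AlternatingMap.alternatizeUncurryFin (tensorAlt t a) v := by
    intro s
    rw [← mul_assoc, ← Int.cast_mul, ← Units.val_mul, Int.units_mul_self]
    simp
  simp only [hs] at h2
  simp only [Finset.sum_const, Finset.card_univ, Fintype.card_perm, Fintype.card_fin,
    nsmul_eq_mul, Nat.factorial_zero, Nat.cast_one, mul_one] at h2
  have h3 : wedgeAlt (l := 0) rfl (AlternatingMap.alternatizeUncurryFin (tensorAlt t a))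
    (AlternatingMap.constOfIsEmpty ℝ V (Fin 0) 1) v =
      AlternatingMap.alternatizeUncurryFin (tensorAlt t a) v := by
    refine mul_left_cancel₀ ?_ h2
    positivity
  rw [h3] at h0
  have hk : (k.factorial : ℝ) ≠ 0 := by positivity
  apply mul_left_cancel₀ hk
  simp only [Nat.factorial_one, Nat.factorial_zero, Nat.cast_one, mul_one, one_mul] at h0 h1
  rw [h0, h1]
  refine Finset.sum_congr rfl fun s _ => ?_
  simp only [tensorAlt_apply, AlternatingMap.smul_apply, smul_eq_mul,
    AlternatingMap.constOfIsEmpty_apply, Function.const_apply, mul_one]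
  congr 2
  · congr 1
    funext i
    congr 2
    exact Fin.ext (by simp)
  · congr 1
    funext i
    congr 2
    exact Fin.ext (by simp; omega)

end Algebra

end Leafwise

/-! ### Concatenation of tuples and sums over index tuples -/

namespace Leafwise

section Join

variable {k l m : ℕ} {X Y : Type*}

/-- The concatenation of a `k`-tuple and an `l`-tuple. -/
def join (h : k + l = m) (v : Fin k → X) (w : Fin l → X) : Fin m → X :=
  Sum.elim v w ∘ (finSumFinEquiv.trans (finCongr h)).symm

theorem join_idxL (h : k + l = m) (v : Fin k → X) (w : Fin l → X) (i : Fin k) :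
    join h v w (idxL h i) = v i :=
  congrArg (Sum.elim v w) ((finSumFinEquiv.trans (finCongr h)).symm_apply_apply (Sum.inl i))

theorem join_idxR (h : k + l = m) (v : Fin k → X) (w : Fin l → X) (j : Fin l) :
    join h v w (idxR h j) = w j :=
  congrArg (Sum.elim v w) ((finSumFinEquiv.trans (finCongr h)).symm_apply_apply (Sum.inr j))

theorem exists_idx (h : k + l = m) (i : Fin m) : (∃ j, i = idxL h j) ∨ ∃ j, i = idxR h j := by
  obtain ⟨x, rfl⟩ := (finSumFinEquiv.trans (finCongr h)).surjective i
  rcases x with x | x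
  · exact Or.inl ⟨x, rfl⟩
  · exact Or.inr ⟨x, rfl⟩

theorem join_eq_iff (h : k + l = m) (v : Fin k → X) (w : Fin l → X) (u : Fin m → X) :
    join h v w = u ↔ v = (fun i => u (idxL h i)) ∧ w = (fun j => u (idxR h j)) := by
  constructor
  · rintro rfl
    exact ⟨by simp [join_idxL], by simp [join_idxR]⟩
  · rintro ⟨rfl, rfl⟩
    funext i
    rcases exists_idx h i with ⟨j, rfl⟩ | ⟨j, rfl⟩
    · rw [join_idxL]
    · rw [join_idxR]

theorem comp_join (h : k + l = m) (f : X → Y) (v : Fin k → X) (w : Fin l → X) :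
    join h (fun i => f (v i)) (fun j => f (w j)) = fun i => f (join h v w i) := by
  rw [join_eq_iff]
  simp [join_idxL, join_idxR]

theorem join_update_right (h : k + l = m) (v : Fin k → X) (w : Fin l → X) (j : Fin l) (x : X) :
    join h v (Function.update w j x) = Function.update (join h v w) (idxR h j) x := by
  rw [join_eq_iff]
  constructor
  · funext i
    rw [Function.update_of_ne, join_idxL]
    intro hij
    have := congrArg Fin.val hij
    simp at this
    omega
  · funext i
    by_cases hij : i = j
    · subst hij
      simp
    · rw [Function.update_of_ne hij, Function.update_of_ne, join_idxR]
      intro hij'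
      have := congrArg Fin.val hij'
      simp at this
      exact hij (Fin.ext this)

theorem join_update_left (h : k + l = m) (v : Fin k → X) (w : Fin l → X) (j : Fin k) (x : X) :
    join h (Function.update v j x) w = Function.update (join h v w) (idxL h j) x := by
  rw [join_eq_iff]
  constructor
  · funext i
    by_cases hij : i = j
    · subst hij
      simp
    · rw [Function.update_of_ne hij, Function.update_of_ne, join_idxL]
      intro hij'
      have := congrArg Fin.val hij'
      simp at this
      exact hij (Fin.ext this)
  · funext i
    rw [Function.update_of_ne, join_idxR]
    intro hij
    have := congrArg Fin.val hij
    simp at this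
    omega

/-- Pairs of tuples are the same as long tuples. -/
def joinEquiv (X : Type*) (h : k + l = m) : ((Fin k → X) × (Fin l → X)) ≃ (Fin m → X) where
  toFun q := join h q.1 q.2
  invFun u := (fun i => u (idxL h i), fun j => u (idxR h j))
  left_inv q := by
    ext
    · simp [join_idxL]
    · simp [join_idxR]
  right_inv u := by
    rw [join_eq_iff]
    simp

/-- A sum over tuples which is supported on the rearrangements of one of them. -/
theorem sum_eq_factorial_mul {ι κ X : Type*} [Fintype ι] [DecidableEq ι] [Fintype X]
    (s : ι ⊕ κ ≃ X) (G : (ι → X) → ℝ)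
    (h0 : ∀ I, ¬ Function.Injective (Sum.elim I (fun j => s (Sum.inr j))) → G I = 0)
    (h1 : ∀ ρ : Equiv.Perm ι, G (fun i => s (Sum.inl (ρ i))) = G (fun i => s (Sum.inl i))) :
    ∑ I, G I = (Fintype.card ι).factorial * G (fun i => s (Sum.inl i)) := by
  classical
  have hinj : Function.Injective
      (fun (ρ : Equiv.Perm ι) (i : ι) => s (Sum.inl (ρ i))) := by
    intro ρ ρ' hρ
    ext i
    have := congrFun hρ i
    simpa using this
  rw [← Fintype.sum_of_injective _ hinj (fun _ => G (fun i => s (Sum.inl i))) G]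
  · simp [Fintype.card_perm]
  · intro I hI
    apply h0
    intro hIinj
    apply hI
    -- An I that is injective together with the fixed complement avoids it, so it permutes the
    -- remaining values.
    have hex : ∀ i, ∃ i', s (Sum.inl i') = I i := by
      intro i
      obtain ⟨x, hx⟩ := s.surjective (I i)
      rcases x with x | x
      · exact ⟨x, hx⟩
      · have : Sum.elim I (fun j => s (Sum.inr j)) (Sum.inl i) =
            Sum.elim I (fun j => s (Sum.inr j)) (Sum.inr x) := hx.symm
        exact absurd (hIinj this) (by simp)
    choose ρ hρ using hex
    have hρi : Function.Injective ρ := by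
      intro i j hij
      have : I i = I j := by rw [← hρ, ← hρ, hij]
      have : Sum.elim I (fun j => s (Sum.inr j)) (Sum.inl i) =
            Sum.elim I (fun j => s (Sum.inr j)) (Sum.inl j) := this
      simpa using hIinj this
    exact ⟨Equiv.ofBijective ρ (Finite.injective_iff_bijective.1 hρi), funext hρ⟩
  · intro ρ
    exact (h1 ρ).symm

/-- Lets the value of a form on k distinct basis vectors be read off a permutation of the whole
basis, where the star has a one-term formula. -/
theorem exists_perm_extending (h : k + l = m) (I : Fin k → Fin m) (hI : Function.Injective I) :
    ∃ s : Equiv.Perm (Fin m), ∀ i, s (idxL h i) = I i := by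
  classical
  obtain ⟨g, hg⟩ := Finset.exists_equiv_extend_of_card_eq (α := Fin m) (β := Fin m)
    (t := Finset.univ) (by simp) (s := Finset.univ.image (idxL h))
    (f := fun j => if hj : (j : ℕ) < k then I ⟨j, hj⟩ else j) (Finset.subset_univ _) (by
      intro x hx y hy hxy
      simp only [Finset.coe_image, Finset.coe_univ, Set.image_univ, Set.mem_range] at hx hy
      obtain ⟨i, rfl⟩ := hx
      obtain ⟨j, rfl⟩ := hy
      have hi : ((idxL h i : Fin m) : ℕ) < k := i.2
      have hj : ((idxL h j : Fin m) : ℕ) < k := j.2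
      simp only [dif_pos hi, dif_pos hj] at hxy
      exact congrArg (idxL h) (hI hxy))
  refine ⟨g.trans (Equiv.subtypeUnivEquiv (by simp)), fun i => ?_⟩
  have := hg (idxL h i) (by simp)
  simpa using this

end Join

/-! ### Insertion of vectors into an alternating form -/

section Contract

variable {p k l m : ℕ} {V : Type*} [AddCommGroup V] [Module ℝ V]

theorem alt_sum_apply {ι : Type*} (t : Finset ι) (f : ι → V [⋀^Fin k]→ₗ[ℝ] ℝ) (v : Fin k → V) :
    (∑ i ∈ t, f i) v = ∑ i ∈ t, f i v := by
  classical
  induction t using Finset.induction_on with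
  | empty => simp
  | insert i t hi ih => rw [Finset.sum_insert hi, Finset.sum_insert hi, AlternatingMap.add_apply, ih]

/-- Insertion of `k` vectors into the first arguments of an alternating form. -/
def contractL (h : k + l = m) (χ : V [⋀^Fin m]→ₗ[ℝ] ℝ) (w : Fin k → V) :
    V [⋀^Fin l]→ₗ[ℝ] ℝ where
  toFun v := χ (join h w v)
  map_update_add' := by
    intro inst v i x y
    rw [Subsingleton.elim inst (instDecidableEqFin l)]
    simp only [join_update_right, AlternatingMap.map_update_add]
  map_update_smul' := by
    intro inst v i c x
    rw [Subsingleton.elim inst (instDecidableEqFin l)]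
    simp only [join_update_right, AlternatingMap.map_update_smul]
  map_eq_zero_of_eq' := by
    intro v i j hv hij
    refine χ.map_eq_zero_of_eq _ (i := idxR h i) (j := idxR h j) ?_ ?_
    · simpa [join_idxR] using hv
    · intro hij'
      have := congrArg Fin.val hij'
      simp at this
      exact hij (Fin.ext this)

/-- Insertion of `l` vectors into the last arguments of an alternating form. -/
def contractR (h : k + l = m) (χ : V [⋀^Fin m]→ₗ[ℝ] ℝ) (w : Fin l → V) :
    V [⋀^Fin k]→ₗ[ℝ] ℝ where
  toFun v := χ (join h v w)
  map_update_add' := by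
    intro inst v i x y
    rw [Subsingleton.elim inst (instDecidableEqFin k)]
    simp only [join_update_left, AlternatingMap.map_update_add]
  map_update_smul' := by
    intro inst v i c x
    rw [Subsingleton.elim inst (instDecidableEqFin k)]
    simp only [join_update_left, AlternatingMap.map_update_smul]
  map_eq_zero_of_eq' := by
    intro v i j hv hij
    refine χ.map_eq_zero_of_eq _ (i := idxL h i) (j := idxL h j) ?_ ?_
    · simpa [join_idxL] using hv
    · intro hij'
      have := congrArg Fin.val hij'
      simp at this
      exact hij (Fin.ext this)

theorem contractL_apply (h : k + l = m) (χ : V [⋀^Fin m]→ₗ[ℝ] ℝ) (w : Fin k → V)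
    (v : Fin l → V) : contractL h χ w v = χ (join h w v) := rfl

theorem contractR_apply (h : k + l = m) (χ : V [⋀^Fin m]→ₗ[ℝ] ℝ) (w : Fin l → V)
    (v : Fin k → V) : contractR h χ w v = χ (join h v w) := rfl

end Contract

/-! ### The Hodge star of an oriented Euclidean space in an orthonormal basis -/

section Hodge

variable {p k l : ℕ} {V : Type*} [NormedAddCommGroup V] [InnerProductSpace ℝ V]

/-- The expansion of a form in an orthonormal basis. -/
theorem alt_apply_eq_sum {ι : Type*} [Fintype ι] (e : OrthonormalBasis ι ℝ V)
    (a : V [⋀^Fin k]→ₗ[ℝ] ℝ) (v : Fin k → V) :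
    a v = ∑ I : Fin k → ι, (∏ i, inner ℝ (e (I i)) (v i)) * a (fun i => e (I i)) := by
  classical
  have hv : v = fun i => ∑ j, (inner ℝ (e j) (v i) : ℝ) • e j := by
    funext i
    exact (e.sum_repr' (v i)).symm
  conv_lhs => rw [hv]
  refine (a.toMultilinearMap.map_sum
      (g := fun (i : Fin k) (j : ι) => (inner ℝ (e j) (v i) : ℝ) • e j)).trans
    (Finset.sum_congr rfl fun r _ => ?_)
  exact a.toMultilinearMap.map_smul_univ _ _

variable [Fact (Module.finrank ℝ V = p)] (o : Orientation ℝ V (Fin p))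

theorem volumeForm_mul_self (e : OrthonormalBasis (Fin p) ℝ V) :
    o.volumeForm e * o.volumeForm e = 1 := by
  rw [← abs_mul_abs_self, o.abs_volumeForm_apply_of_orthonormal]
  simp

theorem volumeForm_perm_mul_self (e : OrthonormalBasis (Fin p) ℝ V) (s : Equiv.Perm (Fin p)) :
    o.volumeForm (fun i => e (s i)) * o.volumeForm (fun i => e (s i)) = 1 := by
  have := volumeForm_mul_self o (e.reindex s.symm)
  rwa [show ⇑(e.reindex s.symm) = fun i => e (s i) by ext; simp] at this

/-- Top forms are a line, and the volume form is ±1 on `e`, hence its own inverse there. Writing the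
coefficient as a product avoids requiring `e` to be positively oriented. -/
theorem eq_smul_volumeForm (e : OrthonormalBasis (Fin p) ℝ V) (τ : V [⋀^Fin p]→ₗ[ℝ] ℝ) :
    τ = (τ e * o.volumeForm e) • o.volumeForm := by
  refine Module.Basis.ext_alternating e.toBasis fun s hs => ?_
  have h1 := volumeForm_mul_self o e
  let ρ : Equiv.Perm (Fin p) := Equiv.ofBijective s (Finite.injective_iff_bijective.1 hs)
  have h2 := τ.map_perm e ρ
  have h3 := o.volumeForm.map_perm e ρ
  have h4 : (fun i => e.toBasis (s i)) = ⇑e ∘ ⇑ρ := by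
    funext i
    simp [ρ]
  rw [h4, AlternatingMap.smul_apply, h2, h3, smul_eq_mul, Units.smul_def, Units.smul_def,
    zsmul_eq_mul, zsmul_eq_mul]
  linear_combination (-((Equiv.Perm.sign ρ : ℤ) : ℝ) * τ e) * h1

/-- The Hodge star operator in an orthonormal basis. -/
def starS (e : OrthonormalBasis (Fin p) ℝ V) (h : k + l = p) (b : V [⋀^Fin k]→ₗ[ℝ] ℝ) :
    V [⋀^Fin l]→ₗ[ℝ] ℝ :=
  (k.factorial : ℝ)⁻¹ • ∑ I : Fin k → Fin p,
    b (fun i => e (I i)) • contractL h o.volumeForm (fun i => e (I i))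

/-- The inverse of the Hodge star operator in an orthonormal basis. -/
def starT (e : OrthonormalBasis (Fin p) ℝ V) (h : k + l = p) (c : V [⋀^Fin l]→ₗ[ℝ] ℝ) :
    V [⋀^Fin k]→ₗ[ℝ] ℝ :=
  (l.factorial : ℝ)⁻¹ • ∑ J : Fin l → Fin p,
    c (fun i => e (J i)) • contractR h o.volumeForm (fun i => e (J i))

theorem starS_apply (e : OrthonormalBasis (Fin p) ℝ V) (h : k + l = p)
    (b : V [⋀^Fin k]→ₗ[ℝ] ℝ) (v : Fin l → V) :
    starS o e h b v = (k.factorial : ℝ)⁻¹ * ∑ I : Fin k → Fin p,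
      b (fun i => e (I i)) * o.volumeForm (join h (fun i => e (I i)) v) := by
  rw [starS, AlternatingMap.smul_apply, smul_eq_mul, alt_sum_apply]
  rfl

theorem starT_apply (e : OrthonormalBasis (Fin p) ℝ V) (h : k + l = p)
    (c : V [⋀^Fin l]→ₗ[ℝ] ℝ) (v : Fin k → V) :
    starT o e h c v = (l.factorial : ℝ)⁻¹ * ∑ J : Fin l → Fin p,
      c (fun i => e (J i)) * o.volumeForm (join h v (fun i => e (J i))) := by
  rw [starT, AlternatingMap.smul_apply, smul_eq_mul, alt_sum_apply]
  rfl

/-- The wedge product of complementary degrees as a double sum over an orthonormal basis. -/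
theorem wedgeAlt_basis_mul (e : OrthonormalBasis (Fin p) ℝ V) (h : k + l = p)
    (a : V [⋀^Fin k]→ₗ[ℝ] ℝ) (c : V [⋀^Fin l]→ₗ[ℝ] ℝ) :
    wedgeAlt h a c e * o.volumeForm e = ((k.factorial : ℝ) * l.factorial)⁻¹ *
      ∑ I : Fin k → Fin p, ∑ J : Fin l → Fin p,
        a (fun i => e (I i)) * c (fun j => e (J j)) *
          o.volumeForm (join h (fun i => e (I i)) (fun j => e (J j))) := by
  rw [wedgeAlt_apply, mul_assoc]
  congr 1
  rw [← Fintype.sum_prod_type', Finset.sum_mul]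
  have h1 : ∀ q : (Fin k → Fin p) × (Fin l → Fin p),
      a (fun i => e (q.1 i)) * c (fun j => e (q.2 j)) *
          o.volumeForm (join h (fun i => e (q.1 i)) (fun j => e (q.2 j))) =
      (fun K : Fin p → Fin p => a (fun i => e (K (idxL h i))) * c (fun j => e (K (idxR h j))) *
        o.volumeForm (fun i => e (K i))) (joinEquiv (Fin p) h q) := by
    intro q
    simp only [joinEquiv, Equiv.coe_fn_mk, join_idxL, join_idxR, comp_join h e]
  simp only [h1]
  rw [Equiv.sum_comp (joinEquiv (Fin p) h)
    (fun K : Fin p → Fin p => a (fun i => e (K (idxL h i))) * c (fun j => e (K (idxR h j))) *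
        o.volumeForm (fun i => e (K i)))]
  refine Fintype.sum_of_injective (fun s : Equiv.Perm (Fin p) => (s : Fin p → Fin p))
    DFunLike.coe_injective _ _ ?_ ?_
  · intro K hK
    rw [o.volumeForm.map_eq_zero_of_not_injective, mul_zero]
    intro hinj
    have hKi : Function.Injective K := fun i j hij => hinj (by simp [hij])
    exact hK ⟨Equiv.ofBijective K (Finite.injective_iff_bijective.1 hKi), rfl⟩
  · intro s
    have h3 := o.volumeForm.map_perm e s
    rw [Units.smul_def, zsmul_eq_mul] at h3
    rw [show (fun i => e (s i)) = ⇑e ∘ ⇑s from rfl, h3]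
    ring

/-- The volume form kills repetitions, so only the rearrangements of the complementary index tuple
survive in the sum; the k! of them agree because both factors change by the same sign. -/
theorem starS_basis (e : OrthonormalBasis (Fin p) ℝ V) (h : k + l = p)
    (b : V [⋀^Fin k]→ₗ[ℝ] ℝ) (s : Equiv.Perm (Fin p)) :
    starS o e h b (fun j => e (s (idxR h j))) =
      o.volumeForm (fun i => e (s i)) * b (fun i => e (s (idxL h i))) := by
  rw [starS_apply]
  have h1 := sum_eq_factorial_mul ((finSumFinEquiv.trans (finCongr h)).trans s)
    (fun I : Fin k → Fin p => b (fun i => e (I i)) *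
      o.volumeForm (join h (fun i => e (I i)) (fun j => e (s (idxR h j))))) ?_ ?_
  · rw [h1, Fintype.card_fin, inv_mul_cancel_left₀ (by positivity), mul_comm]
    congr 2
    rw [join_eq_iff]
    exact ⟨rfl, rfl⟩
  · intro I hI
    rw [o.volumeForm.map_eq_zero_of_not_injective, mul_zero]
    intro hinj
    apply hI
    rw [comp_join h e] at hinj
    intro x y hxy
    have hx : ∀ x, join h I (fun j => s (idxR h j)) ((finSumFinEquiv.trans (finCongr h)) x) =
        Sum.elim I (fun j => s (idxR h j)) x := fun x => by simp [join]
    exact (finSumFinEquiv.trans (finCongr h)).injective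
      (hinj (congrArg e ((hx x).trans (hxy.trans (hx y).symm))))
  · intro ρ
    have h2 := b.map_perm (fun i => e (s (idxL h i))) ρ
    have h3 := (contractR h o.volumeForm (fun j => e (s (idxR h j)))).map_perm
      (fun i => e (s (idxL h i))) ρ
    simp only [contractR_apply] at h3
    rw [Units.smul_def, zsmul_eq_mul] at h2 h3
    have hs : ((Equiv.Perm.sign ρ : ℤ) : ℝ) * ((Equiv.Perm.sign ρ : ℤ) : ℝ) = 1 := by
      rw [← Int.cast_mul, ← Units.val_mul, Int.units_mul_self]
      simp
    refine (congrArg₂ (· * ·) h2 h3).trans ?_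
    change _ = b (fun i => e (s (idxL h i))) *
      o.volumeForm (join h (fun i => e (s (idxL h i))) (fun j => e (s (idxR h j))))
    linear_combination (b (fun i => e (s (idxL h i))) *
      o.volumeForm (join h (fun i => e (s (idxL h i))) (fun j => e (s (idxR h j))))) * hs

theorem starT_basis (e : OrthonormalBasis (Fin p) ℝ V) (h : k + l = p)
    (c : V [⋀^Fin l]→ₗ[ℝ] ℝ) (s : Equiv.Perm (Fin p)) :
    starT o e h c (fun i => e (s (idxL h i))) =
      o.volumeForm (fun i => e (s i)) * c (fun j => e (s (idxR h j))) := by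
  rw [starT_apply]
  have h1 := sum_eq_factorial_mul
    -- The summed tuple now occupies the last block, so the blocks are swapped before
    -- `sum_eq_factorial_mul` applies.
    (((Equiv.sumComm _ _).trans (finSumFinEquiv.trans (finCongr h))).trans s)
    (fun J : Fin l → Fin p => c (fun i => e (J i)) *
      o.volumeForm (join h (fun i => e (s (idxL h i))) (fun j => e (J j)))) ?_ ?_
  · rw [h1, Fintype.card_fin, inv_mul_cancel_left₀ (by positivity), mul_comm]
    congr 2
    rw [join_eq_iff]
    exact ⟨rfl, rfl⟩
  · intro J hJ
    rw [o.volumeForm.map_eq_zero_of_not_injective, mul_zero]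
    intro hinj
    apply hJ
    rw [comp_join h e] at hinj
    intro x y hxy
    have hx : ∀ x, join h (fun i => s (idxL h i)) J
        (((Equiv.sumComm _ _).trans (finSumFinEquiv.trans (finCongr h))) x) =
        Sum.elim J (fun i => s (idxL h i)) x := fun x => by
      rcases x with x | x <;> simp [join]
    exact ((Equiv.sumComm _ _).trans (finSumFinEquiv.trans (finCongr h))).injective
      (hinj (congrArg e ((hx x).trans (hxy.trans (hx y).symm))))
  · intro ρ
    have h2 := c.map_perm (fun i => e (s (idxR h i))) ρ
    have h3 := (contractL h o.volumeForm (fun j => e (s (idxL h j)))).map_perm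
      (fun i => e (s (idxR h i))) ρ
    simp only [contractL_apply] at h3
    rw [Units.smul_def, zsmul_eq_mul] at h2 h3
    have hs : ((Equiv.Perm.sign ρ : ℤ) : ℝ) * ((Equiv.Perm.sign ρ : ℤ) : ℝ) = 1 := by
      rw [← Int.cast_mul, ← Units.val_mul, Int.units_mul_self]
      simp
    refine (congrArg₂ (· * ·) h2 h3).trans ?_
    change _ = c (fun i => e (s (idxR h i))) *
      o.volumeForm (join h (fun i => e (s (idxL h i))) (fun j => e (s (idxR h j))))
    linear_combination (c (fun i => e (s (idxR h i))) *
      o.volumeForm (join h (fun i => e (s (idxL h i))) (fun j => e (s (idxR h j))))) * hs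

/-- Both one-term formulas carry the same factor ±1, whose square is 1. No sign (-1)^{kl} appears
because `starT` inserts into the last arguments where `starS` inserts into the first. -/
theorem starT_starS (e : OrthonormalBasis (Fin p) ℝ V) (h : k + l = p)
    (b : V [⋀^Fin k]→ₗ[ℝ] ℝ) : starT o e h (starS o e h b) = b := by
  refine Module.Basis.ext_alternating e.toBasis fun I hI => ?_
  obtain ⟨s, hs⟩ := exists_perm_extending h I hI
  have h1 : (fun i => e.toBasis (I i)) = fun i => e (s (idxL h i)) := by
    funext i
    simp [hs]
  rw [h1, starT_basis, starS_basis, ← mul_assoc, volumeForm_perm_mul_self, one_mul]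

theorem starS_starT (e : OrthonormalBasis (Fin p) ℝ V) (h : k + l = p)
    (c : V [⋀^Fin l]→ₗ[ℝ] ℝ) : starS o e h (starT o e h c) = c := by
  refine Module.Basis.ext_alternating e.toBasis fun I hI => ?_
  obtain ⟨s, hs⟩ : ∃ s : Equiv.Perm (Fin p), ∀ i, s (idxR h i) = I i := by
    obtain ⟨s, hs⟩ := exists_perm_extending ((Nat.add_comm l k).trans h) I hI
    -- `exists_perm_extending` prescribes a first block; exchanging the blocks prescribes the last
    -- one instead.
    refine ⟨(((finSumFinEquiv.trans (finCongr h)).symm.trans (Equiv.sumComm _ _)).trans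
      (finSumFinEquiv.trans (finCongr ((Nat.add_comm l k).trans h)))).trans s, fun i => ?_⟩
    rw [← hs]
    have : (finSumFinEquiv.trans (finCongr h)).symm (idxR h i) = Sum.inr i :=
      (finSumFinEquiv.trans (finCongr h)).symm_apply_apply (Sum.inr i)
    simp only [Equiv.trans_apply] at this ⊢
    rw [Equiv.symm_trans_apply] at this ⊢
    rw [this]
    rfl
  have h1 : (fun i => e.toBasis (I i)) = fun i => e (s (idxR h i)) := by
    funext i
    simp [hs]
  rw [h1, starS_basis, starT_basis, ← mul_assoc, volumeForm_perm_mul_self, one_mul]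

theorem volumeForm_ne_zero_of_basis (e : OrthonormalBasis (Fin p) ℝ V) : o.volumeForm ≠ 0 := by
  intro h0
  have := volumeForm_mul_self o e
  simp [h0] at this

variable [FiniteDimensional ℝ V]

/-- The inner product of forms does not depend on the orthonormal basis. -/
theorem innerAlt_eq_sum {ι : Type*} [Fintype ι] (e : OrthonormalBasis ι ℝ V)
    (a b : V [⋀^Fin k]→ₗ[ℝ] ℝ) :
    innerAlt a b = (k.factorial : ℝ)⁻¹ * ∑ I : Fin k → ι,
      a (fun j => e (I j)) * b (fun j => e (I j)) := by
  classical
  unfold innerAlt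
  congr 1
  set f := stdOrthonormalBasis ℝ V with hf
  -- Expand a in the basis e; after exchanging the sums, the sum over I is the expansion of b in f,
  -- evaluated on vectors of e.
  have hb : ∀ I : Fin k → Fin (Module.finrank ℝ V), a (fun j => f (I j)) * b (fun j => f (I j)) =
      ∑ J : Fin k → ι, (a (fun j => e (J j))) *
        ((∏ i, inner ℝ (e (J i)) (f (I i))) * b (fun j => f (I j))) := by
    intro I
    conv_lhs => rw [alt_apply_eq_sum e a]
    rw [Finset.sum_mul]
    exact Finset.sum_congr rfl fun J _ => by ring
  simp only [hb]
  rw [Finset.sum_comm]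
  refine Finset.sum_congr rfl fun J _ => ?_
  rw [← Finset.mul_sum, alt_apply_eq_sum f b]
  congr 1
  refine Finset.sum_congr rfl fun I _ => ?_
  congr 1
  exact Finset.prod_congr rfl fun i _ => real_inner_comm _ _

theorem innerAlt_comm (a b : V [⋀^Fin k]→ₗ[ℝ] ℝ) : innerAlt a b = innerAlt b a := by
  simp only [innerAlt, mul_comm]

theorem innerAlt_add_left (a b c : V [⋀^Fin k]→ₗ[ℝ] ℝ) :
    innerAlt (a + b) c = innerAlt a c + innerAlt b c := by
  simp only [innerAlt, AlternatingMap.add_apply, add_mul, Finset.sum_add_distrib, mul_add]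

theorem innerAlt_smul_left (r : ℝ) (a c : V [⋀^Fin k]→ₗ[ℝ] ℝ) :
    innerAlt (r • a) c = r * innerAlt a c := by
  simp only [innerAlt, AlternatingMap.smul_apply, smul_eq_mul, Finset.mul_sum]
  exact Finset.sum_congr rfl fun J _ => by ring

theorem innerAlt_smul_right (r : ℝ) (a c : V [⋀^Fin k]→ₗ[ℝ] ℝ) :
    innerAlt a (r • c) = r * innerAlt a c := by
  rw [innerAlt_comm, innerAlt_smul_left, innerAlt_comm]

theorem innerAlt_sub_right (a b c : V [⋀^Fin k]→ₗ[ℝ] ℝ) :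
    innerAlt a (b - c) = innerAlt a b - innerAlt a c := by
  have : b - c = b + (-1 : ℝ) • c := by
    ext v
    simp [sub_eq_add_neg]
  rw [this, innerAlt_comm, innerAlt_add_left, innerAlt_smul_left, innerAlt_comm b,
    innerAlt_comm c]
  ring

theorem innerAlt_self_nonneg (a : V [⋀^Fin k]→ₗ[ℝ] ℝ) : 0 ≤ innerAlt a a := by
  unfold innerAlt
  have : 0 ≤ ∑ I : Fin k → Fin (Module.finrank ℝ V),
    a (fun j => stdOrthonormalBasis ℝ V (I j)) * a (fun j => stdOrthonormalBasis ℝ V (I j)) :=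
    Finset.sum_nonneg fun I _ => mul_self_nonneg _
  positivity

theorem innerAlt_self_eq_zero {a : V [⋀^Fin k]→ₗ[ℝ] ℝ} (ha : innerAlt a a = 0) : a = 0 := by
  unfold innerAlt at ha
  have hk : (k.factorial : ℝ)⁻¹ ≠ 0 := by positivity
  have h1 := (mul_eq_zero.1 ha).resolve_left hk
  rw [Finset.sum_eq_zero_iff_of_nonneg fun I _ => mul_self_nonneg _] at h1
  refine Module.Basis.ext_alternating (stdOrthonormalBasis ℝ V).toBasis fun I _ => ?_
  have := h1 I (Finset.mem_univ _)
  simpa using this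

/-- Carrying out the sum over J first in `wedgeAlt_basis_mul` leaves the pairing of a with `starT`
c. Summing over I first gives the companion with `starS` a. -/
theorem wedgeAlt_eq_innerAlt_starT (e : OrthonormalBasis (Fin p) ℝ V) (h : k + l = p)
    (a : V [⋀^Fin k]→ₗ[ℝ] ℝ) (c : V [⋀^Fin l]→ₗ[ℝ] ℝ) :
    wedgeAlt h a c = innerAlt a (starT o e h c) • o.volumeForm := by
  rw [eq_smul_volumeForm o e (wedgeAlt h a c), wedgeAlt_basis_mul, innerAlt_eq_sum e]
  congr 1
  rw [mul_inv, mul_assoc]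
  congr 1
  rw [Finset.mul_sum]
  refine Finset.sum_congr rfl fun I _ => ?_
  rw [starT_apply, Finset.mul_sum, Finset.mul_sum, Finset.mul_sum]
  exact Finset.sum_congr rfl fun J _ => by ring

theorem wedgeAlt_eq_innerAlt_starS (e : OrthonormalBasis (Fin p) ℝ V) (h : k + l = p)
    (a : V [⋀^Fin k]→ₗ[ℝ] ℝ) (c : V [⋀^Fin l]→ₗ[ℝ] ℝ) :
    wedgeAlt h a c = innerAlt (starS o e h a) c • o.volumeForm := by
  rw [eq_smul_volumeForm o e (wedgeAlt h a c), wedgeAlt_basis_mul, innerAlt_eq_sum e]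
  congr 1
  rw [mul_inv, mul_comm (k.factorial : ℝ)⁻¹, mul_assoc]
  congr 1
  rw [Finset.sum_comm, Finset.mul_sum]
  refine Finset.sum_congr rfl fun J _ => ?_
  rw [starS_apply, Finset.mul_sum, Finset.mul_sum, Finset.sum_mul]
  exact Finset.sum_congr rfl fun I _ => by ring

/-- The defining relation says that `starT` c and b have the same inner product with every a;
definiteness makes them equal, and applying `starS` recovers c. -/
theorem isStarAlt_iff (e : OrthonormalBasis (Fin p) ℝ V) (h : k + l = p)
    (b : V [⋀^Fin k]→ₗ[ℝ] ℝ) (c : V [⋀^Fin l]→ₗ[ℝ] ℝ) :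
    IsStarAlt o h b c ↔ c = starS o e h b := by
  constructor
  · intro hc
    have h1 : ∀ a, innerAlt a (starT o e h c) = innerAlt a b := by
      intro a
      have := hc a
      rw [wedgeAlt_eq_innerAlt_starT o e] at this
      exact smul_left_injective ℝ (volumeForm_ne_zero_of_basis o e) this
    have h2 : starT o e h c - b = 0 := by
      apply innerAlt_self_eq_zero
      rw [innerAlt_sub_right, h1, sub_self]
    rw [← sub_eq_zero.1 h2, starS_starT]
  · rintro rfl a
    rw [wedgeAlt_eq_innerAlt_starT o e, starT_starS]

theorem existsUnique_isStarAlt (e : OrthonormalBasis (Fin p) ℝ V) (h : k + l = p)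
    (b : V [⋀^Fin k]→ₗ[ℝ] ℝ) : ∃! c, IsStarAlt o h b c :=
  ⟨starS o e h b, (isStarAlt_iff o e h b _).2 rfl, fun c hc => (isStarAlt_iff o e h b c).1 hc⟩

/-- Replaces the star chosen from its defining property by a formula valid in every orthonormal
basis, whatever its orientation, so that smooth frames yield smooth results. -/
theorem starAlt_eq_starS (e : OrthonormalBasis (Fin p) ℝ V) (h : k + l = p)
    (b : V [⋀^Fin k]→ₗ[ℝ] ℝ) : starAlt o h b = starS o e h b := by
  have hex : ∃ c, IsStarAlt o h b c := (existsUnique_isStarAlt o e h b).exists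
  rw [starAlt, dif_pos hex]
  exact (isStarAlt_iff o e h b _).1 hex.choose_spec

end Hodge

end Leafwise

/-! ### Smoothness of functions with values in alternating forms -/

namespace Leafwise

section AltSmooth

variable {n k : ℕ} {E : Type*} [NormedAddCommGroup E] [NormedSpace ℝ E] {s : Set E}

theorem cam_apply_eq_sum (a : Model n [⋀^Fin k]→L[ℝ] ℝ) (v : Fin k → Model n) :
    a v = ∑ r : Fin k → Fin n,
      (∏ i, v i (r i)) * a (fun i => EuclideanSpace.basisFun (Fin n) ℝ (r i)) := by
  have h := alt_apply_eq_sum (EuclideanSpace.basisFun (Fin n) ℝ) a.toAlternatingMap v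
  refine h.trans (Finset.sum_congr rfl fun r _ => ?_)
  congr 1
  refine Finset.prod_congr rfl fun i _ => ?_
  rw [EuclideanSpace.basisFun_apply, EuclideanSpace.inner_single_left]
  simp

/-- Smoothness of a form-valued function can be checked on constant vectors. -/
theorem contDiffOn_alt {f : E → Model n [⋀^Fin k]→L[ℝ] ℝ}
    (hf : ∀ v : Fin k → Model n, ContDiffOn ℝ ∞ (fun u => f u v) s) : ContDiffOn ℝ ∞ f s := by
  -- Evaluation on basis tuples is injective into a finite-dimensional space, and its linear left
  -- inverse is automatically continuous.
  let ev : (Model n [⋀^Fin k]→L[ℝ] ℝ) →ₗ[ℝ] ((Fin k → Fin n) → ℝ) :=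
    { toFun := fun a r => a (fun i => EuclideanSpace.basisFun (Fin n) ℝ (r i))
      map_add' := fun a b => rfl
      map_smul' := fun c a => rfl }
  have hev : LinearMap.ker ev = ⊥ := by
    rw [LinearMap.ker_eq_bot]
    intro a b hab
    ext v
    rw [cam_apply_eq_sum a, cam_apply_eq_sum b]
    exact Finset.sum_congr rfl fun r _ => by rw [show a _ = b _ from congrFun hab r]
  obtain ⟨g, hg⟩ := LinearMap.exists_leftInverse_of_injective ev hev
  have hfg : f = fun u => LinearMap.toContinuousLinearMap g (ev (f u)) := by
    funext u
    exact (LinearMap.congr_fun hg (f u)).symm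
  rw [hfg]
  refine (ContinuousLinearMap.contDiff _).comp_contDiffOn ?_
  rw [contDiffOn_pi]
  exact fun r => hf _

theorem contDiffOn_alt_apply {f : E → Model n [⋀^Fin k]→L[ℝ] ℝ} (hf : ContDiffOn ℝ ∞ f s)
    {v : Fin k → E → Model n} (hv : ∀ i, ContDiffOn ℝ ∞ (v i) s) :
    ContDiffOn ℝ ∞ (fun u => f u (fun i => v i u)) s := by
  have h1 : (fun u => f u (fun i => v i u)) = fun u => ∑ r : Fin k → Fin n,
      (∏ i, v i u (r i)) * f u (fun i => EuclideanSpace.basisFun (Fin n) ℝ (r i)) :=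
    funext fun u => cam_apply_eq_sum _ _
  rw [h1]
  refine ContDiffOn.sum fun r _ => ContDiffOn.mul (contDiffOn_prod fun i _ => ?_) ?_
  · exact (EuclideanSpace.proj (𝕜 := ℝ) (r i)).contDiff.comp_contDiffOn (hv i)
  · exact (ContinuousAlternatingMap.apply ℝ (Model n) ℝ _).contDiff.comp_contDiffOn hf

end AltSmooth

/-! ### Charts of the maximal atlas and their transitions -/

section Charts

variable {n : ℕ} {M : Type*} [TopologicalSpace M] [ChartedSpace (Model n) M]
  [IsManifold (𝓡 n) ∞ M] {φ ψ : OpenPartialHomeomorph M (Model n)}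

theorem mdifferentiable_of_mem (hφ : φ ∈ IsManifold.maximalAtlas (𝓡 n) ∞ M) :
    φ.MDifferentiable (𝓡 n) (𝓡 n) :=
  ⟨(contMDiffOn_of_mem_maximalAtlas hφ).mdifferentiableOn (by simp),
    (contMDiffOn_symm_of_mem_maximalAtlas hφ).mdifferentiableOn (by simp)⟩

theorem chartDeriv_chartInvDeriv (hφ : φ ∈ IsManifold.maximalAtlas (𝓡 n) ∞ M) {u : Model n}
    (hu : u ∈ φ.target) (v : Model n) : chartDeriv φ (φ.symm u) (chartInvDeriv φ u v) = v :=
  DFunLike.congr_fun ((mdifferentiable_of_mem hφ).comp_symm_deriv hu) v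

theorem chartInvDeriv_chartDeriv (hφ : φ ∈ IsManifold.maximalAtlas (𝓡 n) ∞ M) {u : Model n}
    (hu : u ∈ φ.target) (v : TangentSpace (𝓡 n) (φ.symm u)) :
    chartInvDeriv φ u (chartDeriv φ (φ.symm u) v) = v := by
  have h1 := (mdifferentiable_of_mem hφ).symm_comp_deriv (φ.map_target hu)
  rw [φ.right_inv hu] at h1
  exact DFunLike.congr_fun h1 v

theorem contDiffOn_transition (hφ : φ ∈ IsManifold.maximalAtlas (𝓡 n) ∞ M)
    (hψ : ψ ∈ IsManifold.maximalAtlas (𝓡 n) ∞ M) :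
    ContDiffOn ℝ ∞ (ψ ∘ φ.symm) (φ.target ∩ φ.symm ⁻¹' ψ.source) := by
  rw [← contMDiffOn_iff_contDiffOn]
  exact (contMDiffOn_of_mem_maximalAtlas hψ).comp
    ((contMDiffOn_symm_of_mem_maximalAtlas hφ).mono Set.inter_subset_left) fun u hu => hu.2

theorem isOpen_transition (φ ψ : OpenPartialHomeomorph M (Model n)) :
    IsOpen (φ.target ∩ φ.symm ⁻¹' ψ.source) :=
  φ.isOpen_inter_preimage_symm ψ.open_source

theorem chartDeriv_transition (hφ : φ ∈ IsManifold.maximalAtlas (𝓡 n) ∞ M)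
    (hψ : ψ ∈ IsManifold.maximalAtlas (𝓡 n) ∞ M) {x : M} (hx : x ∈ φ.source) (hx' : x ∈ ψ.source)
    (v : TangentSpace (𝓡 n) x) :
    fderiv ℝ (ψ ∘ φ.symm) (φ x) (chartDeriv φ x v) = chartDeriv ψ x v := by
  have hu : φ x ∈ φ.target ∩ φ.symm ⁻¹' ψ.source :=
    ⟨φ.map_source hx, by simpa [φ.left_inv hx] using hx'⟩
  have h1 : MDifferentiableAt (𝓡 n) (𝓡 n) (ψ ∘ φ.symm) (φ x) :=
    (((contDiffOn_transition hφ hψ).contDiffAt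
      ((isOpen_transition φ ψ).mem_nhds hu)).differentiableAt (by simp)).mdifferentiableAt
  have h2 : MDifferentiableAt (𝓡 n) (𝓡 n) φ x := (mdifferentiable_of_mem hφ).mdifferentiableAt hx
  have h3 := mfderiv_comp x h1 h2
  have h4 : (ψ ∘ φ.symm) ∘ φ =ᶠ[nhds x] ψ := by
    filter_upwards [φ.open_source.mem_nhds hx] with y hy
    simp [φ.left_inv hy]
  rw [h4.mfderiv_eq] at h3
  rw [← mfderiv_eq_fderiv]
  exact (DFunLike.congr_fun h3 v).symm

end Charts

/-! ### Metric coefficients in a chart -/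

section Metric

variable {n : ℕ} {M : Type*} [TopologicalSpace M] [ChartedSpace (Model n) M]
  [IsManifold (𝓡 n) ∞ M] {φ ψ : OpenPartialHomeomorph M (Model n)}
  [RiemannianBundle (fun x : M => TangentSpace (𝓡 n) x)]
  [IsContMDiffRiemannianBundle (𝓡 n) ∞ (Model n) (fun x : M => TangentSpace (𝓡 n) x)]

/-- The coefficients of the Riemannian metric in the chart `φ`. -/
def chartMetric (φ : OpenPartialHomeomorph M (Model n)) (u v w : Model n) : ℝ :=
  inner ℝ (chartInvDeriv φ u v) (chartInvDeriv φ u w)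

theorem contDiffOn_chartMetric_const (hφ : φ ∈ IsManifold.maximalAtlas (𝓡 n) ∞ M)
    (v w : Model n) : ContDiffOn ℝ ∞ (fun u => chartMetric φ u v w) φ.target := by
  -- A coordinate field along the inverse chart is the tangent map of `φ.symm` applied to a constant
  -- section, hence smooth; the bundle metric then pairs two of them smoothly.
  have key : ∀ v : Model n, ContMDiffOn (𝓡 n) (𝓡 n).tangent ∞
      (fun u => (⟨φ.symm u, chartInvDeriv φ u v⟩ : TotalSpace (Model n)
        (fun x : M => TangentSpace (𝓡 n) x))) φ.target := by
    intro v
    have h1 := (contMDiffOn_symm_of_mem_maximalAtlas hφ).contMDiffOn_tangentMapWithin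
      (m := ∞) (by simp) φ.open_target.uniqueMDiffOn
    have h2 : ContMDiff (𝓡 n) (𝓡 n).tangent ∞
        (fun u : Model n => (⟨u, v⟩ : TangentBundle (𝓡 n) (Model n))) := by
      exact contMDiff_vectorSpace_iff_contDiff.2 contDiff_const
    refine (h1.comp h2.contMDiffOn (s := φ.target) (fun u hu => hu)).congr fun u hu => ?_
    simp only [tangentMapWithin, chartInvDeriv, Function.comp_apply,
      mfderivWithin_of_isOpen φ.open_target hu]
    rfl
  have h3 := (key v).inner_bundle (key w)
  rw [contMDiffOn_iff_contDiffOn] at h3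
  exact h3

theorem chartMetric_eq_sum (φ : OpenPartialHomeomorph M (Model n)) (u v w : Model n) :
    chartMetric φ u v w = ∑ i, ∑ j, v i * w j *
      chartMetric φ u (EuclideanSpace.basisFun (Fin n) ℝ i)
        (EuclideanSpace.basisFun (Fin n) ℝ j) := by
  have hv : ∀ v : Model n, v = ∑ i, v i • EuclideanSpace.basisFun (Fin n) ℝ i := fun v => by
    simpa using ((EuclideanSpace.basisFun (Fin n) ℝ).sum_repr v).symm
  unfold chartMetric
  conv_lhs => rw [hv v, hv w]
  simp only [map_sum, map_smul, sum_inner, inner_sum, inner_smul_left, inner_smul_right]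
  rw [Finset.sum_comm' (t' := Finset.univ) (s' := fun _ => Finset.univ) (by simp)]
  refine Finset.sum_congr rfl fun i _ => ?_
  rw [Finset.mul_sum]
  refine Finset.sum_congr rfl fun j _ => ?_
  simp
  ring

theorem contDiffOn_chartMetric (hφ : φ ∈ IsManifold.maximalAtlas (𝓡 n) ∞ M)
    {v w : Model n → Model n} (hv : ContDiffOn ℝ ∞ v φ.target) (hw : ContDiffOn ℝ ∞ w φ.target) :
    ContDiffOn ℝ ∞ (fun u => chartMetric φ u (v u) (w u)) φ.target := by
  have h1 : (fun u => chartMetric φ u (v u) (w u)) = fun u => ∑ i, ∑ j, v u i * w u j *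
      chartMetric φ u (EuclideanSpace.basisFun (Fin n) ℝ i)
        (EuclideanSpace.basisFun (Fin n) ℝ j) := funext fun u => chartMetric_eq_sum φ u _ _
  rw [h1]
  refine ContDiffOn.sum fun i _ => ContDiffOn.sum fun j _ => ContDiffOn.mul (ContDiffOn.mul ?_ ?_)
    (contDiffOn_chartMetric_const hφ _ _)
  · exact (EuclideanSpace.proj (𝕜 := ℝ) i).contDiff.comp_contDiffOn hv
  · exact (EuclideanSpace.proj (𝕜 := ℝ) j).contDiff.comp_contDiffOn hw

theorem chartMetric_chartDeriv (hφ : φ ∈ IsManifold.maximalAtlas (𝓡 n) ∞ M) {u : Model n}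
    (hu : u ∈ φ.target) (v w : TangentSpace (𝓡 n) (φ.symm u)) :
    chartMetric φ u (chartDeriv φ (φ.symm u) v) (chartDeriv φ (φ.symm u) w) = inner ℝ v w := by
  rw [chartMetric, chartInvDeriv_chartDeriv hφ hu, chartInvDeriv_chartDeriv hφ hu]

end Metric

end Leafwise

/-! ### Leafwise forms in charts, smooth orthonormal leaf frames and the leafwise differential -/

namespace Leafwise

variable {n p k l m : ℕ} {M : Type*} [TopologicalSpace M] [ChartedSpace (Model n) M]
  [IsManifold (𝓡 n) ∞ M] {φ ψ : OpenPartialHomeomorph M (Model n)}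
  [RiemannianBundle (fun x : M => TangentSpace (𝓡 n) x)] {F : Foliation n M p}

theorem chartForm_apply (α : LeafForm F k) (φ : OpenPartialHomeomorph M (Model n)) (u : Model n)
    (v : Fin k → Model n) : chartForm α φ u v =
      α (φ.symm u) (fun i => (F.tangent (φ.symm u)).orthogonalProjectionOnto
        (chartInvDeriv φ u (v i))) := rfl

theorem chartForm_chartDeriv_symm (hφ : φ ∈ IsManifold.maximalAtlas (𝓡 n) ∞ M)
    (α : LeafForm F k) {u : Model n} (hu : u ∈ φ.target)
    (v : Fin k → TangentSpace (𝓡 n) (φ.symm u)) :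
    chartForm α φ u (fun i => chartDeriv φ (φ.symm u) (v i)) =
      α (φ.symm u) (fun i => (F.tangent (φ.symm u)).orthogonalProjectionOnto (v i)) := by
  rw [chartForm_apply]
  congr 1
  funext i
  rw [chartInvDeriv_chartDeriv hφ hu]

theorem chartForm_chartDeriv (hφ : φ ∈ IsManifold.maximalAtlas (𝓡 n) ∞ M)
    (α : LeafForm F k) {x : M} (hx : x ∈ φ.source) (v : Fin k → TangentSpace (𝓡 n) x) :
    chartForm α φ (φ x) (fun i => chartDeriv φ x (v i)) =
      α x (fun i => (F.tangent x).orthogonalProjectionOnto (v i)) := by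
  obtain ⟨u, hu, rfl⟩ : ∃ u ∈ φ.target, φ.symm u = x := ⟨φ x, φ.map_source hx, φ.left_inv hx⟩
  rw [φ.right_inv hu]
  exact chartForm_chartDeriv_symm hφ α hu v

/-- Extension by zero on the normal bundle is a single form on M, so its chart representatives are
pullbacks of one another. This moves smoothness and the differential between atlas charts and
foliated charts. -/
theorem chartForm_transition (hφ : φ ∈ IsManifold.maximalAtlas (𝓡 n) ∞ M)
    (hψ : ψ ∈ IsManifold.maximalAtlas (𝓡 n) ∞ M) (α : LeafForm F k) {u : Model n}
    (hu : u ∈ φ.target ∩ φ.symm ⁻¹' ψ.source) :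
    chartForm α φ u = (chartForm α ψ ((ψ ∘ φ.symm) u)).compContinuousLinearMap
      (fderiv ℝ (ψ ∘ φ.symm) u) := by
  ext v
  have h1 : ∀ i, fderiv ℝ (ψ ∘ φ.symm) u (v i) =
      chartDeriv ψ (φ.symm u) (chartInvDeriv φ u (v i)) := by
    intro i
    have := chartDeriv_transition hφ hψ (φ.map_target hu.1) hu.2 (chartInvDeriv φ u (v i))
    rwa [chartDeriv_chartInvDeriv hφ hu.1, φ.right_inv hu.1] at this
  have h2 := chartForm_chartDeriv hψ α hu.2 (fun i => chartInvDeriv φ u (v i))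
  rw [chartForm_apply, ← h2]
  simp only [ContinuousAlternatingMap.compContinuousLinearMap_apply, Function.comp_def]
  congr 1
  funext i
  exact (h1 i).symm

theorem contDiffOn_chartForm_transition (hφ : φ ∈ IsManifold.maximalAtlas (𝓡 n) ∞ M)
    (hψ : ψ ∈ IsManifold.maximalAtlas (𝓡 n) ∞ M) {α : LeafForm F k}
    (hα : ContDiffOn ℝ ∞ (chartForm α ψ) ψ.target) :
    ContDiffOn ℝ ∞ (chartForm α φ) (φ.target ∩ φ.symm ⁻¹' ψ.source) := by
  have hf := contDiffOn_transition hφ hψ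
  refine ContDiffOn.congr ?_ fun u hu => chartForm_transition hφ hψ α hu
  refine contDiffOn_alt fun v => ?_
  refine contDiffOn_alt_apply (f := fun u => chartForm α ψ ((ψ ∘ φ.symm) u))
    (v := fun i u => fderiv ℝ (ψ ∘ φ.symm) u (v i)) (hα.comp hf fun u hu => ψ.map_source hu.2) ?_
  intro i
  exact (hf.fderiv_of_isOpen (isOpen_transition φ ψ) (m := ∞) (by simp)).clm_apply contDiffOn_const

/-- Smoothness is tested on the atlas, whereas foliated charts belong only to the maximal atlas. -/
theorem contDiffOn_chartForm {α : LeafForm F k} (hα : IsSmooth α)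
    (hφ : φ ∈ IsManifold.maximalAtlas (𝓡 n) ∞ M) : ContDiffOn ℝ ∞ (chartForm α φ) φ.target := by
  refine contDiffOn_of_locally_contDiffOn fun u hu => ?_
  refine ⟨φ.target ∩ φ.symm ⁻¹' (chartAt (Model n) (φ.symm u)).source, isOpen_transition _ _,
    ⟨hu, mem_chart_source _ _⟩, ?_⟩
  refine (contDiffOn_chartForm_transition hφ (IsManifold.chart_mem_maximalAtlas (φ.symm u))
    (hα _ (chart_mem_atlas _ _))).mono Set.inter_subset_right

theorem isSmooth_of_forall_exists {α : LeafForm F k}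
    (h : ∀ x : M, ∃ φ ∈ IsManifold.maximalAtlas (𝓡 n) ∞ M, x ∈ φ.source ∧
      ContDiffOn ℝ ∞ (chartForm α φ) φ.target) : IsSmooth α := by
  intro φ hφ
  refine contDiffOn_of_locally_contDiffOn fun u hu => ?_
  obtain ⟨ψ, hψ, hx, hψα⟩ := h (φ.symm u)
  refine ⟨φ.target ∩ φ.symm ⁻¹' ψ.source, isOpen_transition _ _, ⟨hu, hx⟩, ?_⟩
  exact (contDiffOn_chartForm_transition (IsManifold.subset_maximalAtlas hφ) hψ hψα).mono
    Set.inter_subset_right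

/-- The leafwise differential can be computed in any smooth chart. -/
theorem leafD_apply {α : LeafForm F k} (hα : IsSmooth α)
    (hφ : φ ∈ IsManifold.maximalAtlas (𝓡 n) ∞ M) {x : M} (hx : x ∈ φ.source)
    (v : Fin (k + 1) → F.tangent x) :
    leafD α x v = extDeriv (chartForm α φ) (φ x) (fun i => chartDeriv φ x (v i)) := by
  set ψ := chartAt (Model n) x with hψdef
  have hψ : ψ ∈ IsManifold.maximalAtlas (𝓡 n) ∞ M := IsManifold.chart_mem_maximalAtlas x
  have hxψ : x ∈ ψ.source := mem_chart_source _ x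
  have hu : ψ x ∈ ψ.target ∩ ψ.symm ⁻¹' φ.source :=
    ⟨ψ.map_source hxψ, by simpa [ψ.left_inv hxψ] using hx⟩
  have h1 : chartForm α ψ =ᶠ[nhds (ψ x)] fun u => (chartForm α φ
      ((φ ∘ ψ.symm) u)).compContinuousLinearMap (fderiv ℝ (φ ∘ ψ.symm) u) := by
    filter_upwards [(isOpen_transition ψ φ).mem_nhds hu] with u hu'
    exact chartForm_transition hψ hφ α hu'
  have hφx : (φ ∘ ψ.symm) (ψ x) = φ x := by simp [ψ.left_inv hxψ]
  have h2 : DifferentiableAt ℝ (chartForm α φ) ((φ ∘ ψ.symm) (ψ x)) := by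
    rw [hφx]
    exact ((contDiffOn_chartForm hα hφ).contDiffAt
      (φ.open_target.mem_nhds (φ.map_source hx))).differentiableAt (by simp)
  have h3 : ContDiffAt ℝ ∞ (φ ∘ ψ.symm) (ψ x) :=
    (contDiffOn_transition hψ hφ).contDiffAt ((isOpen_transition ψ φ).mem_nhds hu)
  have h4 := extDeriv_pullback h2 h3 (by
    rw [minSmoothness_of_isRCLikeNormedField]
    exact WithTop.coe_le_coe.2 le_top)
  have h5 : leafD α x v = extDeriv (chartForm α ψ) (ψ x) (fun i => chartDeriv ψ x (v i)) := rfl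
  rw [h5, h1.extDeriv_eq, h4, hφx]
  simp only [ContinuousAlternatingMap.compContinuousLinearMap_apply, Function.comp_def]
  congr 1
  funext i
  exact chartDeriv_transition hψ hφ hxψ hx (v i)

theorem le_of_foliation (F : Foliation n M p) (x : M) : p ≤ n := by
  have h1 := Submodule.finrank_le (F.tangent x)
  rw [F.finrank_tangent x] at h1
  refine h1.trans (le_of_eq ?_)
  exact (finrank_euclideanSpace_fin (𝕜 := ℝ) (n := n))

/-- The `i`-th coordinate vector of `ℝᵖ × {0}`. -/
def leafVec (hpn : p ≤ n) (i : Fin p) : Model n :=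
  EuclideanSpace.basisFun (Fin n) ℝ (Fin.castLE hpn i)

theorem leafVec_mem (hpn : p ≤ n) (i : Fin p) : leafVec hpn i ∈ leafModel n p := by
  intro j hj
  rw [leafVec, EuclideanSpace.basisFun_apply]
  simp
  intro h
  subst h
  simp at hj
  omega

theorem linearIndependent_leafVec (hpn : p ≤ n) : LinearIndependent ℝ (leafVec hpn) :=
  (EuclideanSpace.basisFun (Fin n) ℝ).orthonormal.linearIndependent.comp _
    (Fin.castLE_injective hpn)

theorem chartInvDeriv_mem (hφ : IsFlatChart p F.tangent φ) {u : Model n} (hu : u ∈ φ.target)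
    {v : Model n} (hv : v ∈ leafModel n p) : chartInvDeriv φ u v ∈ F.tangent (φ.symm u) := by
  refine (hφ.2 _ (φ.map_target hu) _).2 ?_
  have : chartDeriv φ (φ.symm u) (chartInvDeriv φ u v) ∈ leafModel n p := by
    rwa [chartDeriv_chartInvDeriv hφ.1 hu v]
  exact this

/-- The projections of the leafwise coordinate fields to the leaf. -/
def coordField (F : Foliation n M p) (hpn : p ≤ n) (φ : OpenPartialHomeomorph M (Model n))
    (u : Model n) (i : Fin p) : F.tangent (φ.symm u) :=
  (F.tangent (φ.symm u)).orthogonalProjectionOnto (chartInvDeriv φ u (leafVec hpn i))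

/-- In a flat chart the first p coordinate fields are already tangent to the leaves, so the
projection in `coordField` changes nothing. -/
theorem coe_coordField (hφ : IsFlatChart p F.tangent φ) (hpn : p ≤ n) {u : Model n}
    (hu : u ∈ φ.target) (i : Fin p) :
    (coordField F hpn φ u i : TangentSpace (𝓡 n) (φ.symm u)) =
      chartInvDeriv φ u (leafVec hpn i) := by
  have h := chartInvDeriv_mem hφ hu (leafVec_mem hpn i)
  exact Submodule.starProjection_eq_self_iff.2 h

theorem linearIndependent_coordField (hφ : IsFlatChart p F.tangent φ) (hpn : p ≤ n) {u : Model n}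
    (hu : u ∈ φ.target) : LinearIndependent ℝ (coordField F hpn φ u) := by
  have h1 : LinearIndependent ℝ (fun i => chartInvDeriv φ u (leafVec hpn i)) := by
    refine (linearIndependent_leafVec hpn).map' (chartInvDeriv φ u).toLinearMap ?_
    rw [LinearMap.ker_eq_bot]
    exact Function.LeftInverse.injective (chartDeriv_chartInvDeriv hφ.1 hu)
  refine LinearIndependent.of_comp (F.tangent (φ.symm u)).subtype ?_
  convert h1 using 1
  funext i
  exact coe_coordField hφ hpn hu i

/-- An orthonormal frame of the leafwise tangent bundle over a chart domain. -/
def leafFrame (F : Foliation n M p) (hpn : p ≤ n) (φ : OpenPartialHomeomorph M (Model n))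
    (u : Model n) : OrthonormalBasis (Fin p) ℝ (F.tangent (φ.symm u)) :=
  InnerProductSpace.gramSchmidtOrthonormalBasis
    (by rw [F.finrank_tangent, Fintype.card_fin]) (coordField F hpn φ u)

/-- The frame `leafFrame` in the chart `φ`. -/
def frameVec (F : Foliation n M p) (hpn : p ≤ n) (φ : OpenPartialHomeomorph M (Model n))
    (i : Fin p) (u : Model n) : Model n :=
  chartDeriv φ (φ.symm u) (leafFrame F hpn φ u i)

section Smooth

variable [IsContMDiffRiemannianBundle (𝓡 n) ∞ (Model n) (fun x : M => TangentSpace (𝓡 n) x)]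

/-- Strong induction along the Gram–Schmidt recursion, rewritten with `chartMetric` so that
everything lives on an open set of ℝⁿ. The denominators are squared norms, nonzero since the
coordinate fields are independent. -/
theorem contDiffOn_gramSchmidt (hφ : IsFlatChart p F.tangent φ) (hpn : p ≤ n) (i : Fin p) :
    ContDiffOn ℝ ∞ (fun u => chartDeriv φ (φ.symm u)
      (InnerProductSpace.gramSchmidt ℝ (coordField F hpn φ u) i : F.tangent (φ.symm u)))
      φ.target := by
  induction i using WellFoundedLT.induction with
  | ind i ih =>
    have h1 : ∀ j < i, ContDiffOn ℝ ∞ (fun u =>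
        (chartMetric φ u (chartDeriv φ (φ.symm u)
          (InnerProductSpace.gramSchmidt ℝ (coordField F hpn φ u) j : F.tangent (φ.symm u)))
          (leafVec hpn i) / chartMetric φ u (chartDeriv φ (φ.symm u)
          (InnerProductSpace.gramSchmidt ℝ (coordField F hpn φ u) j : F.tangent (φ.symm u)))
          (chartDeriv φ (φ.symm u)
          (InnerProductSpace.gramSchmidt ℝ (coordField F hpn φ u) j : F.tangent (φ.symm u)))) •
        chartDeriv φ (φ.symm u)
          (InnerProductSpace.gramSchmidt ℝ (coordField F hpn φ u) j : F.tangent (φ.symm u)))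
        φ.target := by
      intro j hj
      refine ContDiffOn.smul (ContDiffOn.div (contDiffOn_chartMetric hφ.1 (ih j hj)
        contDiffOn_const) (contDiffOn_chartMetric hφ.1 (ih j hj) (ih j hj)) ?_) (ih j hj)
      intro u hu
      rw [chartMetric_chartDeriv hφ.1 hu, ← Submodule.coe_inner, real_inner_self_eq_norm_sq]
      exact pow_ne_zero 2 (norm_ne_zero_iff.2
        (InnerProductSpace.gramSchmidt_ne_zero j (linearIndependent_coordField hφ hpn hu)))
    refine ((contDiffOn_const (c := leafVec hpn i)).sub
      (ContDiffOn.sum (s := Finset.Iio i) fun j hj => h1 j (Finset.mem_Iio.1 hj))).congr ?_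
    intro u hu
    have h2 := InnerProductSpace.gramSchmidt_def'' ℝ (coordField F hpn φ u) i
    have h3 := congrArg (fun w : F.tangent (φ.symm u) =>
      chartDeriv φ (φ.symm u) (w : TangentSpace (𝓡 n) (φ.symm u))) h2
    simp only [Submodule.coe_add, map_add, Submodule.coe_sum, map_sum, Submodule.coe_smul,
      map_smul] at h3
    rw [coe_coordField hφ hpn hu, chartDeriv_chartInvDeriv hφ.1 hu] at h3
    rw [eq_sub_iff_add_eq]
    refine Eq.trans ?_ h3.symm
    congr 1
    refine Finset.sum_congr rfl fun j _ => ?_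
    congr 1
    have h4 : leafVec hpn i = chartDeriv φ (φ.symm u) (coordField F hpn φ u i :
        TangentSpace (𝓡 n) (φ.symm u)) := by
      rw [coe_coordField hφ hpn hu, chartDeriv_chartInvDeriv hφ.1 hu]
    rw [h4, chartMetric_chartDeriv hφ.1 hu, chartMetric_chartDeriv hφ.1 hu,
      ← Submodule.coe_inner, ← Submodule.coe_inner, real_inner_self_eq_norm_sq]
    rfl

theorem contDiffOn_frameVec (hφ : IsFlatChart p F.tangent φ) (hpn : p ≤ n) (i : Fin p) :
    ContDiffOn ℝ ∞ (frameVec F hpn φ i) φ.target := by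
  have h1 := contDiffOn_gramSchmidt hφ hpn i
  have h2 := contDiffOn_chartMetric hφ.1 h1 h1
  have h3 : ∀ u ∈ φ.target, InnerProductSpace.gramSchmidt ℝ (coordField F hpn φ u) i ≠ 0 :=
    fun u hu => InnerProductSpace.gramSchmidt_ne_zero i (linearIndependent_coordField hφ hpn hu)
  have h4 : ∀ u ∈ φ.target, chartMetric φ u (chartDeriv φ (φ.symm u)
      (InnerProductSpace.gramSchmidt ℝ (coordField F hpn φ u) i : F.tangent (φ.symm u)))
      (chartDeriv φ (φ.symm u)
      (InnerProductSpace.gramSchmidt ℝ (coordField F hpn φ u) i : F.tangent (φ.symm u))) =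
      ‖InnerProductSpace.gramSchmidt ℝ (coordField F hpn φ u) i‖ ^ 2 := by
    intro u hu
    rw [chartMetric_chartDeriv hφ.1 hu, ← Submodule.coe_inner, real_inner_self_eq_norm_sq]
  have h5 := ((h2.sqrt fun u hu => by
    rw [h4 u hu]
    exact pow_ne_zero 2 (norm_ne_zero_iff.2 (h3 u hu))).inv fun u hu => by
      rw [h4 u hu, Real.sqrt_sq (norm_nonneg _)]
      exact norm_ne_zero_iff.2 (h3 u hu)).smul h1
  refine h5.congr fun u hu => ?_
  rw [frameVec, leafFrame, InnerProductSpace.gramSchmidtOrthonormalBasis_apply]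
  · simp only [Pi.smul_apply', Pi.inv_apply, h4 u hu, Real.sqrt_sq (norm_nonneg _)]
    rw [InnerProductSpace.gramSchmidtNormed, Submodule.coe_smul, map_smul]
    simp
  · rw [← norm_ne_zero_iff, InnerProductSpace.gramSchmidtNormed_unit_length i
      (linearIndependent_coordField hφ hpn hu)]
    exact one_ne_zero

theorem chartForm_frameVec (hφ : IsFlatChart p F.tangent φ) (hpn : p ≤ n) (α : LeafForm F k)
    {u : Model n} (hu : u ∈ φ.target) (I : Fin k → Fin p) :
    chartForm α φ u (fun i => frameVec F hpn φ (I i) u) =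
      α (φ.symm u) (fun i => leafFrame F hpn φ u (I i)) := by
  simp only [frameVec]
  rw [chartForm_chartDeriv_symm hφ.1 α hu
    (fun i => (leafFrame F hpn φ u (I i) : TangentSpace (𝓡 n) (φ.symm u)))]
  simp

/-- The coefficients of a smooth form with respect to the orthonormal frame are smooth. -/
theorem IsSmooth.contDiffOn_frame {α : LeafForm F k} (hα : IsSmooth α)
    (hφ : IsFlatChart p F.tangent φ) (hpn : p ≤ n) (I : Fin k → Fin p) :
    ContDiffOn ℝ ∞ (fun u => α (φ.symm u) (fun i => leafFrame F hpn φ u (I i))) φ.target :=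
  (contDiffOn_alt_apply (contDiffOn_chartForm hα hφ.1)
    (v := fun i => frameVec F hpn φ (I i)) fun i => contDiffOn_frameVec hφ hpn (I i)).congr
      fun _ hu => (chartForm_frameVec hφ hpn α hu I).symm

/-- Pairing with a leaf vector does not see the orthogonal projection, so the projection is absorbed
into metric coefficients, which are smooth. -/
theorem chartForm_eq_sum (hφ : IsFlatChart p F.tangent φ) (hpn : p ≤ n) (α : LeafForm F k)
    {u : Model n} (hu : u ∈ φ.target) (v : Fin k → Model n) :
    chartForm α φ u v = ∑ I : Fin k → Fin p, (∏ i, chartMetric φ u (frameVec F hpn φ (I i) u)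
      (v i)) * α (φ.symm u) (fun i => leafFrame F hpn φ u (I i)) := by
  rw [chartForm_apply, alt_apply_eq_sum (leafFrame F hpn φ u)]
  refine Finset.sum_congr rfl fun I _ => ?_
  congr 1
  refine Finset.prod_congr rfl fun i _ => ?_
  rw [frameVec, chartMetric, chartInvDeriv_chartDeriv hφ.1 hu]
  exact Submodule.inner_orthogonalProjectionOnto_eq_of_mem_left _ _

/-- A form is smooth if its coefficients with respect to orthonormal frames are smooth. -/
theorem isSmooth_of_frame {α : LeafForm F k}
    (h : ∀ (hpn : p ≤ n) (φ : OpenPartialHomeomorph M (Model n)), IsFlatChart p F.tangent φ →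
      ∀ I : Fin k → Fin p,
        ContDiffOn ℝ ∞ (fun u => α (φ.symm u) (fun i => leafFrame F hpn φ u (I i))) φ.target) :
    IsSmooth α := by
  refine isSmooth_of_forall_exists fun x => ?_
  obtain ⟨φ, hx, hφ⟩ := F.exists_flatChart x
  have hpn := le_of_foliation F x
  refine ⟨φ, hφ.1, hx, contDiffOn_alt fun v => ?_⟩
  refine ContDiffOn.congr ?_ fun u hu => chartForm_eq_sum hφ hpn α hu v
  refine ContDiffOn.sum fun I _ => ContDiffOn.mul (contDiffOn_prod fun i _ => ?_) (h hpn φ hφ I)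
  exact contDiffOn_chartMetric hφ.1 (contDiffOn_frameVec hφ hpn _) contDiffOn_const

theorem IsSmooth.add {α β : LeafForm F k} (hα : IsSmooth α) (hβ : IsSmooth β) :
    IsSmooth (α + β) :=
  isSmooth_of_frame fun hpn _ hφ I =>
    (hα.contDiffOn_frame hφ hpn I).add (hβ.contDiffOn_frame hφ hpn I)

theorem IsSmooth.const_smul {α : LeafForm F k} (hα : IsSmooth α) (c : ℝ) : IsSmooth (c • α) :=
  isSmooth_of_frame fun hpn _ hφ I => contDiffOn_const.mul (hα.contDiffOn_frame hφ hpn I)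

theorem isSmooth_zero : IsSmooth (0 : LeafForm F k) :=
  isSmooth_of_frame fun _ _ _ _ => contDiffOn_const

theorem IsSmooth.neg {α : LeafForm F k} (hα : IsSmooth α) : IsSmooth (-α) :=
  isSmooth_of_frame fun hpn _ hφ I => (hα.contDiffOn_frame hφ hpn I).neg

theorem IsSmooth.sub {α β : LeafForm F k} (hα : IsSmooth α) (hβ : IsSmooth β) :
    IsSmooth (α - β) :=
  isSmooth_of_frame fun hpn _ hφ I =>
    (hα.contDiffOn_frame hφ hpn I).sub (hβ.contDiffOn_frame hφ hpn I)

theorem contDiffOn_comp_symm (hφ : φ ∈ IsManifold.maximalAtlas (𝓡 n) ∞ M) {f : M → ℝ}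
    (hf : ContMDiff (𝓡 n) 𝓘(ℝ, ℝ) ∞ f) : ContDiffOn ℝ ∞ (fun u => f (φ.symm u)) φ.target := by
  rw [← contMDiffOn_iff_contDiffOn]
  exact hf.comp_contMDiffOn (contMDiffOn_symm_of_mem_maximalAtlas hφ)

theorem IsSmooth.smul {α : LeafForm F k} (hα : IsSmooth α) {f : M → ℝ}
    (hf : ContMDiff (𝓡 n) 𝓘(ℝ, ℝ) ∞ f) : IsSmooth (fun x => f x • α x : LeafForm F k) :=
  isSmooth_of_frame fun hpn _ hφ I =>
    (contDiffOn_comp_symm hφ.1 hf).mul (hα.contDiffOn_frame hφ hpn I)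

theorem IsSmooth.wedge (h : k + l = m) {α : LeafForm F k} {β : LeafForm F l} (hα : IsSmooth α)
    (hβ : IsSmooth β) : IsSmooth (wedge h α β) := by
  refine isSmooth_of_frame fun hpn φ hφ I => ?_
  simp only [Leafwise.wedge, wedgeAlt_apply]
  exact contDiffOn_const.mul (ContDiffOn.sum fun s _ => contDiffOn_const.mul
    ((hα.contDiffOn_frame hφ hpn _).mul (hβ.contDiffOn_frame hφ hpn _)))

theorem contDiffOn_extDeriv {f : Model n → Model n [⋀^Fin k]→L[ℝ] ℝ} {s : Set (Model n)}
    (hs : IsOpen s) (hf : ContDiffOn ℝ ∞ f s) : ContDiffOn ℝ ∞ (extDeriv f) s :=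
  ContDiff.comp_contDiffOn (g := ContinuousAlternatingMap.alternatizeUncurryFinCLM ℝ (Model n) ℝ)
    (ContinuousLinearMap.contDiff _) (hf.fderiv_of_isOpen hs (m := ∞) (by simp))

theorem leafD_apply_symm {α : LeafForm F k} (hα : IsSmooth α)
    (hφ : φ ∈ IsManifold.maximalAtlas (𝓡 n) ∞ M) {u : Model n} (hu : u ∈ φ.target)
    (v : Fin (k + 1) → F.tangent (φ.symm u)) :
    leafD α (φ.symm u) v =
      extDeriv (chartForm α φ) u (fun i => chartDeriv φ (φ.symm u) (v i)) := by
  rw [leafD_apply hα hφ (φ.map_target hu), φ.right_inv hu]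

theorem IsSmooth.leafD {α : LeafForm F k} (hα : IsSmooth α) : IsSmooth (leafD α) := by
  refine isSmooth_of_frame fun hpn φ hφ I => ?_
  exact (contDiffOn_alt_apply
    (contDiffOn_extDeriv φ.open_target (contDiffOn_chartForm hα hφ.1))
    (v := fun i => frameVec F hpn φ (I i)) fun i => contDiffOn_frameVec hφ hpn (I i)).congr
      fun u hu => leafD_apply_symm hα hφ.1 hu _

theorem IsSmooth.twistedD {η : LeafForm F 1} (hη : IsSmooth η) {α : LeafForm F k}
    (hα : IsSmooth α) : IsSmooth (twistedD η α) :=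
  hα.leafD.add (hη.wedge _ hα)

theorem contDiffOn_innerAlt {α β : LeafForm F k} (hα : IsSmooth α) (hβ : IsSmooth β)
    (hφ : IsFlatChart p F.tangent φ) :
    ContDiffOn ℝ ∞ (fun u => innerAlt (α (φ.symm u)) (β (φ.symm u))) φ.target := by
  -- Any point of M forces p ≤ n, so in the other case there is no point to consider.
  by_cases hpn : p ≤ n
  · simp only [fun u => innerAlt_eq_sum (leafFrame F hpn φ u) (α (φ.symm u)) (β (φ.symm u))]
    exact contDiffOn_const.mul (ContDiffOn.sum fun I _ =>
      (hα.contDiffOn_frame hφ hpn I).mul (hβ.contDiffOn_frame hφ hpn I))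
  · intro u _
    exact absurd (le_of_foliation F (φ.symm u)) hpn

theorem continuous_innerAlt {α β : LeafForm F k} (hα : IsSmooth α) (hβ : IsSmooth β) :
    Continuous (fun x => innerAlt (α x) (β x)) := by
  rw [continuous_iff_continuousAt]
  intro x
  obtain ⟨φ, hx, hφ⟩ := F.exists_flatChart x
  have h1 := (contDiffOn_innerAlt hα hβ hφ).continuousOn.comp φ.continuousOn fun y hy =>
    φ.map_source hy
  refine (h1.congr fun y hy => ?_).continuousAt (φ.open_source.mem_nhds hx)
  exact congrArg (fun z => innerAlt (α z) (β z)) (φ.left_inv hy).symm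

end Smooth

end Leafwise

/-! ### Smoothness of the leafwise volume form and of the star -/

namespace Leafwise

/-- The basis b need not be positively oriented: if it is not, both θ b and the volume form on b are
negative, and the absolute value accounts for both cases at once. -/
theorem volumeForm_apply_of_ray {p : ℕ} {V : Type*} [NormedAddCommGroup V] [InnerProductSpace ℝ V]
    [FiniteDimensional ℝ V] [Fact (Module.finrank ℝ V = p)] (o : Orientation ℝ V (Fin p))
    (θ : V [⋀^Fin p]→ₗ[ℝ] ℝ) (h : θ ≠ 0) (ho : o = rayOfNeZero ℝ θ h)
    (b : OrthonormalBasis (Fin p) ℝ V) :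
    θ b ≠ 0 ∧ o.volumeForm = |θ b|⁻¹ • θ := by
  have hdet : b.toBasis.det b = 1 := by
    have := b.toBasis.det_self
    rwa [OrthonormalBasis.coe_toBasis] at this
  have hθ : θ = θ b • b.toBasis.det := by
    have := θ.eq_smul_basis_det b.toBasis
    rwa [OrthonormalBasis.coe_toBasis] at this
  have hdet0 : b.toBasis.det ≠ 0 := b.toBasis.det_ne_zero
  have hθb : θ b ≠ 0 := by
    intro h0
    rw [h0, zero_smul] at hθ
    exact h hθ
  refine ⟨hθb, ?_⟩
  by_cases hb : b.toBasis.orientation = o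
  · rw [o.volumeForm_robust b hb]
    rw [ho, Module.Basis.orientation, ray_eq_iff, hθ,
      sameRay_smul_right_iff_of_ne hdet0 hθb] at hb
    rw [abs_of_pos hb]
    conv_rhs => rw [hθ]
    rw [smul_smul]
    simp [hdet, hb.ne']
  · rw [o.volumeForm_robust_neg b hb]
    have hb' := (b.toBasis.orientation_eq_or_eq_neg o).resolve_left (Ne.symm hb)
    rw [ho, Module.Basis.orientation, neg_rayOfNeZero, ray_eq_iff, ← sameRay_neg_swap] at hb'
    have h2 : SameRay ℝ (-θ b • b.toBasis.det) b.toBasis.det := by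
      have h3 : -θ b • b.toBasis.det = -θ := by
        ext v
        conv_rhs => rw [hθ]
        simp
      rwa [h3]
    rw [sameRay_smul_left_iff_of_ne hdet0 (neg_ne_zero.2 hθb)] at h2
    rw [abs_of_neg (by linarith)]
    conv_rhs => rw [hθ]
    rw [smul_smul]
    simp [hdet, hθb]

variable {n p k l m : ℕ} {M : Type*} [TopologicalSpace M] [ChartedSpace (Model n) M]
  [IsManifold (𝓡 n) ∞ M] {φ ψ : OpenPartialHomeomorph M (Model n)}
  [RiemannianBundle (fun x : M => TangentSpace (𝓡 n) x)] {F : Foliation n M p}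

/-- The leafwise volume form. -/
def volForm (o : ∀ x : M, Orientation ℝ (F.tangent x) (Fin p)) : LeafForm F p :=
  fun x => (o x).volumeForm

/-- Some orthonormal basis of the tangent space of the leaf. -/
def leafBasis (F : Foliation n M p) (x : M) : OrthonormalBasis (Fin p) ℝ (F.tangent x) :=
  (stdOrthonormalBasis ℝ (F.tangent x)).reindex (finCongr (F.finrank_tangent x))

/-- The inverse of the leafwise Hodge star operator. -/
def starInv (o : ∀ x : M, Orientation ℝ (F.tangent x) (Fin p)) (h : k + l = p)
    (γ : LeafForm F l) : LeafForm F k :=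
  fun x => starT (o x) (leafBasis F x) h (γ x)

variable (o : ∀ x : M, Orientation ℝ (F.tangent x) (Fin p))

theorem hodgeStar_apply (h : k + l = p) (β : LeafForm F k) (x : M)
    (e : OrthonormalBasis (Fin p) ℝ (F.tangent x)) :
    hodgeStar o h β x = starS (o x) e h (β x) := starAlt_eq_starS (o x) e h (β x)

/-- `starS` is independent of the basis, being the invariantly defined star; hence so is its
inverse. This allows a smooth frame in place of the arbitrary `leafBasis`. -/
theorem starInv_apply (h : k + l = p) (γ : LeafForm F l) (x : M)
    (e : OrthonormalBasis (Fin p) ℝ (F.tangent x)) :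
    starInv o h γ x = starT (o x) e h (γ x) := by
  rw [starInv]
  conv_lhs => rw [← starS_starT (o x) e h (γ x), ← starAlt_eq_starS (o x) e,
    starAlt_eq_starS (o x) (leafBasis F x), starT_starS]

theorem hodgeStar_starInv (h : k + l = p) (γ : LeafForm F l) :
    hodgeStar o h (starInv o h γ) = γ := by
  funext x
  rw [hodgeStar_apply o h _ x (leafBasis F x), starInv, starS_starT]

theorem wedge_eq_innerAlt_starInv (h : k + l = p) (α : LeafForm F k) (γ : LeafForm F l) (x : M) :
    wedgeAlt h (α x) (γ x) = innerAlt (α x) (starInv o h γ x) • volForm o x := by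
  rw [wedgeAlt_eq_innerAlt_starT (o x) (leafBasis F x)]
  rfl

theorem wedge_eq_innerAlt_hodgeStar (h : k + l = p) (α : LeafForm F k) (γ : LeafForm F l)
    (x : M) : wedgeAlt h (α x) (γ x) = innerAlt (hodgeStar o h α x) (γ x) • volForm o x := by
  rw [wedgeAlt_eq_innerAlt_starS (o x) (leafBasis F x), hodgeStar_apply o h _ x (leafBasis F x)]
  rfl

theorem hodgeStar_add (h : k + l = p) (α β : LeafForm F k) :
    hodgeStar o h (α + β) = hodgeStar o h α + hodgeStar o h β := by
  funext x
  ext v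
  simp only [Pi.add_apply, AlternatingMap.add_apply, hodgeStar_apply o h _ x (leafBasis F x),
    starS_apply, add_mul, Finset.sum_add_distrib, mul_add]

theorem hodgeStar_smul (h : k + l = p) (c : ℝ) (α : LeafForm F k) :
    hodgeStar o h (c • α) = c • hodgeStar o h α := by
  funext x
  ext v
  simp only [Pi.smul_apply, AlternatingMap.smul_apply, hodgeStar_apply o h _ x (leafBasis F x),
    starS_apply, smul_eq_mul, Finset.mul_sum]
  exact Finset.sum_congr rfl fun I _ => by ring

section Smooth

variable [IsContMDiffRiemannianBundle (𝓡 n) ∞ (Model n) (fun x : M => TangentSpace (𝓡 n) x)]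

/-- On the orthonormal frame the volume form is θ divided by |θ(frame)|; since θ never vanishes on a
basis, the absolute value is smooth there. -/
theorem isSmooth_volForm (ho : IsLeafOrientation o) : IsSmooth (volForm o) := by
  obtain ⟨θ, hθ, hoθ⟩ := ho
  refine isSmooth_of_frame fun hpn φ hφ I => ?_
  have h1 := hθ.contDiffOn_frame hφ hpn id
  have h2 : ∀ u, θ (φ.symm u) (fun i => leafFrame F hpn φ u (id i)) ≠ 0 := by
    intro u
    obtain ⟨h, hx⟩ := hoθ (φ.symm u)
    exact (volumeForm_apply_of_ray _ _ h hx (leafFrame F hpn φ u)).1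
  have h3 : ContDiffOn ℝ ∞ (fun u => |θ (φ.symm u) (fun i => leafFrame F hpn φ u (id i))|⁻¹)
      φ.target :=
    ContDiffOn.inv (fun u hu => ContDiffAt.comp_contDiffWithinAt (g := fun t : ℝ => |t|) u
      (contDiffAt_abs (h2 u)) (h1 u hu))
      fun u _ => abs_ne_zero.2 (h2 u)
  refine (h3.mul (hθ.contDiffOn_frame hφ hpn I)).congr fun u hu => ?_
  obtain ⟨h, hx⟩ := hoθ (φ.symm u)
  rw [volForm, (volumeForm_apply_of_ray _ _ h hx (leafFrame F hpn φ u)).2]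
  rfl

theorem IsSmooth.hodgeStar (ho : IsLeafOrientation o) (h : k + l = p) {β : LeafForm F k}
    (hβ : IsSmooth β) : IsSmooth (hodgeStar o h β) := by
  refine isSmooth_of_frame fun hpn φ hφ J => ?_
  simp only [fun u => hodgeStar_apply o h β (φ.symm u) (leafFrame F hpn φ u), starS_apply]
  refine contDiffOn_const.mul (ContDiffOn.sum fun I _ => (hβ.contDiffOn_frame hφ hpn I).mul ?_)
  refine ((isSmooth_volForm o ho).contDiffOn_frame hφ hpn (join h I J)).congr fun u _ => ?_
  rw [comp_join h (leafFrame F hpn φ u)]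
  rfl

theorem IsSmooth.starInv (ho : IsLeafOrientation o) (h : k + l = p) {γ : LeafForm F l}
    (hγ : IsSmooth γ) : IsSmooth (starInv o h γ) := by
  refine isSmooth_of_frame fun hpn φ hφ I => ?_
  simp only [fun u => starInv_apply o h γ (φ.symm u) (leafFrame F hpn φ u), starT_apply]
  refine contDiffOn_const.mul (ContDiffOn.sum fun J _ => (hγ.contDiffOn_frame hφ hpn J).mul ?_)
  refine ((isSmooth_volForm o ho).contDiffOn_frame hφ hpn (join h I J)).congr fun u _ => ?_
  rw [comp_join h (leafFrame F hpn φ u)]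
  rfl

end Smooth

end Leafwise

/-! ### The Riemannian volume measure -/

namespace Leafwise

variable {n : ℕ} {M : Type*} [TopologicalSpace M] [ChartedSpace (Model n) M]
  [IsManifold (𝓡 n) ∞ M] {φ ψ : OpenPartialHomeomorph M (Model n)}
  [RiemannianBundle (fun x : M => TangentSpace (𝓡 n) x)]
  [IsContMDiffRiemannianBundle (𝓡 n) ∞ (Model n) (fun x : M => TangentSpace (𝓡 n) x)]

/-- The Gram matrix of the coordinate fields. -/
def gramMatrix (φ : OpenPartialHomeomorph M (Model n)) (u : Model n) : Matrix (Fin n) (Fin n) ℝ :=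
  Matrix.of fun i j => chartMetric φ u (EuclideanSpace.basisFun (Fin n) ℝ i)
    (EuclideanSpace.basisFun (Fin n) ℝ j)

theorem volDensity_eq (φ : OpenPartialHomeomorph M (Model n)) (u : Model n) :
    volDensity φ u = √(gramMatrix φ u).det := rfl

theorem det_gramMatrix_pos (hφ : φ ∈ IsManifold.maximalAtlas (𝓡 n) ∞ M) {u : Model n}
    (hu : u ∈ φ.target) : 0 < (gramMatrix φ u).det := by
  have h1 : LinearIndependent ℝ
      (fun i => chartInvDeriv φ u (EuclideanSpace.basisFun (Fin n) ℝ i)) := by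
    refine (EuclideanSpace.basisFun (Fin n) ℝ).orthonormal.linearIndependent.map'
      (chartInvDeriv φ u).toLinearMap ?_
    rw [LinearMap.ker_eq_bot]
    exact Function.LeftInverse.injective (chartDeriv_chartInvDeriv hφ hu)
  have h2 := (Matrix.posDef_gram_iff_linearIndependent (𝕜 := ℝ)).2 h1
  exact h2.det_pos

theorem volDensity_pos (hφ : φ ∈ IsManifold.maximalAtlas (𝓡 n) ∞ M) {u : Model n}
    (hu : u ∈ φ.target) : 0 < volDensity φ u := Real.sqrt_pos.2 (det_gramMatrix_pos hφ hu)

theorem chartMetric_transition (hφ : φ ∈ IsManifold.maximalAtlas (𝓡 n) ∞ M)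
    (hψ : ψ ∈ IsManifold.maximalAtlas (𝓡 n) ∞ M) {u : Model n}
    (hu : u ∈ φ.target ∩ φ.symm ⁻¹' ψ.source) (v w : Model n) :
    chartMetric φ u v w = chartMetric ψ ((ψ ∘ φ.symm) u) (fderiv ℝ (ψ ∘ φ.symm) u v)
      (fderiv ℝ (ψ ∘ φ.symm) u w) := by
  have h1 : ∀ v, fderiv ℝ (ψ ∘ φ.symm) u v =
      chartDeriv ψ (φ.symm u) (chartInvDeriv φ u v) := by
    intro v
    have := chartDeriv_transition hφ hψ (φ.map_target hu.1) hu.2 (chartInvDeriv φ u v)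
    rwa [chartDeriv_chartInvDeriv hφ hu.1, φ.right_inv hu.1] at this
  have h2 : ∀ x ∈ ψ.source, ∀ v w : TangentSpace (𝓡 n) x,
      chartMetric ψ (ψ x) (chartDeriv ψ x v) (chartDeriv ψ x w) = inner ℝ v w := by
    intro x hx
    obtain ⟨y, hy, rfl⟩ : ∃ y ∈ ψ.target, ψ.symm y = x := ⟨ψ x, ψ.map_source hx, ψ.left_inv hx⟩
    intro v w
    rw [ψ.right_inv hy, chartMetric_chartDeriv hψ hy]
  rw [h1, h1]
  exact (h2 _ hu.2 _ _).symm

/-- Gram matrices transform as JᵀGJ, so the root of the determinant picks up |det J|, exactly the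
factor in the change of variables. -/
theorem volDensity_transition (hφ : φ ∈ IsManifold.maximalAtlas (𝓡 n) ∞ M)
    (hψ : ψ ∈ IsManifold.maximalAtlas (𝓡 n) ∞ M) {u : Model n}
    (hu : u ∈ φ.target ∩ φ.symm ⁻¹' ψ.source) :
    volDensity φ u = |(fderiv ℝ (ψ ∘ φ.symm) u).det| * volDensity ψ ((ψ ∘ φ.symm) u) := by
  set L := fderiv ℝ (ψ ∘ φ.symm) u with hL
  set b := (EuclideanSpace.basisFun (Fin n) ℝ).toBasis with hb
  set J : Matrix (Fin n) (Fin n) ℝ := LinearMap.toMatrix b b L.toLinearMap with hJ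
  have hdet : L.det = J.det := (LinearMap.det_toMatrix b L.toLinearMap).symm
  have hLe : ∀ i j, L (EuclideanSpace.basisFun (Fin n) ℝ i) j = J j i := by
    intro i j
    rw [hJ, LinearMap.toMatrix_apply]
    simp [hb]
  have hG : gramMatrix φ u = J.transpose * gramMatrix ψ ((ψ ∘ φ.symm) u) * J := by
    ext i j
    rw [gramMatrix, Matrix.of_apply, chartMetric_transition hφ hψ hu, chartMetric_eq_sum]
    simp only [← hL, hLe, Matrix.mul_apply, Matrix.transpose_apply, Finset.sum_mul]
    rw [Finset.sum_comm]
    refine Finset.sum_congr rfl fun a _ => Finset.sum_congr rfl fun c _ => ?_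
    simp only [gramMatrix, Matrix.of_apply]
    ring
  rw [volDensity_eq, volDensity_eq, hG, Matrix.det_mul, Matrix.det_mul, Matrix.det_transpose,
    hdet, show J.det * (gramMatrix ψ ((ψ ∘ φ.symm) u)).det * J.det =
      J.det ^ 2 * (gramMatrix ψ ((ψ ∘ φ.symm) u)).det by ring,
    Real.sqrt_mul (sq_nonneg _), Real.sqrt_sq_eq_abs]

theorem contDiffOn_volDensity (hφ : φ ∈ IsManifold.maximalAtlas (𝓡 n) ∞ M) :
    ContDiffOn ℝ ∞ (volDensity φ) φ.target := by
  have h1 : ContDiffOn ℝ ∞ (fun u => (gramMatrix φ u).det) φ.target := by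
    simp only [Matrix.det_apply]
    refine ContDiffOn.sum fun s _ => ContDiffOn.const_smul _ (contDiffOn_prod fun i _ => ?_)
    exact contDiffOn_chartMetric_const hφ _ _
  exact h1.sqrt fun u hu => (det_gramMatrix_pos hφ hu).ne'

variable [MeasurableSpace M] [BorelSpace M]

theorem aemeasurable_symm (φ : OpenPartialHomeomorph M (Model n)) :
    AEMeasurable φ.symm ((volume : Measure (Model n)).restrict φ.target) :=
  φ.continuousOn_symm.aemeasurable φ.open_target.measurableSet

theorem aemeasurable_volDensity (hφ : φ ∈ IsManifold.maximalAtlas (𝓡 n) ∞ M) :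
    AEMeasurable (volDensity φ) ((volume : Measure (Model n)).restrict φ.target) :=
  (contDiffOn_volDensity hφ).continuousOn.aemeasurable φ.open_target.measurableSet

theorem aemeasurable_symm_withDensity (φ : OpenPartialHomeomorph M (Model n)) :
    AEMeasurable φ.symm (((volume : Measure (Model n)).restrict φ.target).withDensity
      fun u => ENNReal.ofReal (volDensity φ u)) :=
  (aemeasurable_symm φ).mono_ac (withDensity_absolutelyContinuous _ _)

theorem measurableSet_target_inter (φ : OpenPartialHomeomorph M (Model n)) {s : Set M}
    (hs : MeasurableSet s) : MeasurableSet (φ.target ∩ φ.symm ⁻¹' s) := by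
  have h1 : Measurable (φ.target.domRestrict φ.symm) :=
    (continuousOn_iff_continuous_domRestrict.1 φ.continuousOn_symm).measurable
  have h2 := (MeasurableEmbedding.subtype_coe φ.open_target.measurableSet).measurableSet_image.2
    (h1 hs)
  convert h2 using 1
  ext u
  simp
  tauto

theorem chartVolume_apply (φ : OpenPartialHomeomorph M (Model n)) {s : Set M}
    (hs : MeasurableSet s) :
    chartVolume φ s = ∫⁻ u in φ.target ∩ φ.symm ⁻¹' s, ENNReal.ofReal (volDensity φ u) := by
  rw [chartVolume, Measure.map_apply_of_aemeasurable (aemeasurable_symm_withDensity φ) hs,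
    withDensity_apply', Measure.restrict_restrict' φ.open_target.measurableSet, Set.inter_comm]

theorem chartVolume_inter_source (φ : OpenPartialHomeomorph M (Model n)) {s : Set M}
    (hs : MeasurableSet s) : chartVolume φ (s ∩ φ.source) = chartVolume φ s := by
  rw [chartVolume_apply φ hs, chartVolume_apply φ (hs.inter φ.open_source.measurableSet)]
  congr 2
  ext u
  simp only [Set.mem_inter_iff, Set.mem_preimage]
  constructor
  · rintro ⟨h1, h2, -⟩
    exact ⟨h1, h2⟩
  · rintro ⟨h1, h2⟩
    exact ⟨h1, h2, φ.map_target h1⟩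

theorem chartVolume_eq_of_subset (hφ : φ ∈ IsManifold.maximalAtlas (𝓡 n) ∞ M)
    (hψ : ψ ∈ IsManifold.maximalAtlas (𝓡 n) ∞ M) {s : Set M} (hs : MeasurableSet s)
    (hsφ : s ⊆ φ.source) (hsψ : s ⊆ ψ.source) : chartVolume φ s = chartVolume ψ s := by
  rw [chartVolume_apply φ hs, chartVolume_apply ψ hs]
  set A := φ.target ∩ φ.symm ⁻¹' s with hA
  have hAW : A ⊆ φ.target ∩ φ.symm ⁻¹' ψ.source := fun u hu => ⟨hu.1, hsψ hu.2⟩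
  have himg : (ψ ∘ φ.symm) '' A = ψ.target ∩ ψ.symm ⁻¹' s := by
    ext y
    constructor
    · rintro ⟨u, hu, rfl⟩
      refine ⟨ψ.map_source (hsψ hu.2), ?_⟩
      simpa [ψ.left_inv (hsψ hu.2)] using hu.2
    · rintro ⟨hy, hys⟩
      refine ⟨φ (ψ.symm y), ⟨φ.map_source (hsφ hys), ?_⟩, ?_⟩
      · simpa [φ.left_inv (hsφ hys)] using hys
      · simp [φ.left_inv (hsφ hys), ψ.right_inv hy]
  have hinj : Set.InjOn (ψ ∘ φ.symm) A := by
    intro u hu v hv huv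
    have h1 := ψ.injOn (hsψ hu.2) (hsψ hv.2) huv
    exact φ.symm.injOn hu.1 hv.1 h1
  have hderiv : ∀ u ∈ A, HasFDerivWithinAt (ψ ∘ φ.symm) (fderiv ℝ (ψ ∘ φ.symm) u) A u :=
    fun u hu => ((((contDiffOn_transition hφ hψ).contDiffAt
      ((isOpen_transition φ ψ).mem_nhds (hAW hu))).differentiableAt
        (by simp)).hasFDerivAt).hasFDerivWithinAt
  rw [← himg, lintegral_image_eq_lintegral_abs_det_fderiv_mul volume
    (measurableSet_target_inter φ hs) hderiv hinj]
  refine setLIntegral_congr_fun (measurableSet_target_inter φ hs) fun u hu => ?_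
  rw [volDensity_transition hφ hψ (hAW hu), ENNReal.ofReal_mul (abs_nonneg _)]

variable [CompactSpace M]

/-- Compactness supplies a finite subcover; it is listed as a sequence so that it can be made
disjoint. -/
theorem exists_chart_sequence [Nonempty M] :
    ∃ x : ℕ → M, ⋃ i, (chartAt (Model n) (x i)).source = Set.univ := by
  obtain ⟨t, ht⟩ := isCompact_univ.elim_nhds_subcover (fun x : M => (chartAt (Model n) x).source)
    fun x _ => (chartAt (Model n) x).open_source.mem_nhds (mem_chart_source _ x)
  have htne : (t : Set M).Nonempty := by
    obtain ⟨x⟩ := ‹Nonempty M›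
    have := ht.2 (Set.mem_univ x)
    simp only [Set.mem_iUnion] at this
    obtain ⟨y, hy, -⟩ := this
    exact ⟨y, hy⟩
  obtain ⟨x, hx⟩ := t.countable_toSet.exists_eq_range htne
  refine ⟨x, Set.eq_univ_of_univ_subset (ht.2.trans ?_)⟩
  intro y hy
  simp only [Set.mem_iUnion] at hy ⊢
  obtain ⟨z, hz, hyz⟩ := hy
  have hz' : z ∈ (t : Set M) := hz
  rw [hx] at hz'
  obtain ⟨i, rfl⟩ := hz'
  exact ⟨i, hyz⟩

/-- The Riemannian volume restricts to the chart volume on every smooth chart. -/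
theorem riemannianVolume_apply (hφ : φ ∈ IsManifold.maximalAtlas (𝓡 n) ∞ M) {s : Set M}
    (hs : MeasurableSet s) (hsφ : s ⊆ φ.source) : riemannianVolume n M s = chartVolume φ s := by
  rcases s.eq_empty_or_nonempty with rfl | ⟨x₀, -⟩
  · simp
  have : Nonempty M := ⟨x₀⟩
  obtain ⟨x, hx⟩ := exists_chart_sequence (n := n) (M := M)
  set c : ℕ → OpenPartialHomeomorph M (Model n) := fun i => chartAt (Model n) (x i) with hc
  have hcm : ∀ i, c i ∈ IsManifold.maximalAtlas (𝓡 n) ∞ M := fun i =>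
    IsManifold.chart_mem_maximalAtlas (x i)
  -- Disjoint Borel pieces, each inside one atlas chart: on a piece all chart volumes agree, so
  -- every measure can be compared piece by piece.
  set A : ℕ → Set M := disjointed fun i => (c i).source with hA
  have hAm : ∀ i, MeasurableSet (A i) := fun i =>
    MeasurableSet.disjointed (fun i => (c i).open_source.measurableSet) i
  have hAc : ∀ i, A i ⊆ (c i).source := fun i => disjointed_subset _ i
  have hAd : Pairwise (Function.onFun Disjoint A) := disjoint_disjointed _
  have hAu : ⋃ i, A i = Set.univ := by rw [hA, iUnion_disjointed]; exact hx
  have hsplit : ∀ (μ : Measure M) (t : Set M), MeasurableSet t → μ t = ∑' i, μ (t ∩ A i) := by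
    intro μ t ht
    rw [← measure_iUnion (fun i j hij => ((hAd hij).mono Set.inter_subset_right
      Set.inter_subset_right)) fun i => ht.inter (hAm i), ← Set.inter_iUnion, hAu, Set.inter_univ]
  have hsum : ∀ (ψ : OpenPartialHomeomorph M (Model n)),
      ψ ∈ IsManifold.maximalAtlas (𝓡 n) ∞ M → ∀ t ⊆ ψ.source, MeasurableSet t →
      chartVolume ψ t = ∑' i, chartVolume (c i) (t ∩ A i) := by
    intro ψ hψ t htψ ht
    rw [hsplit _ t ht]
    refine tsum_congr fun i => ?_
    exact chartVolume_eq_of_subset hψ (hcm i) (ht.inter (hAm i))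
      (Set.inter_subset_left.trans htψ) (Set.inter_subset_right.trans (hAc i))
  apply le_antisymm
  -- The measure glued from the pieces dominates every atlas chart volume, hence their supremum;
  -- this is the upper bound. The lower bound needs only that each piece lies in an atlas chart.
  · set ν : Measure M := Measure.sum fun i => (chartVolume (c i)).restrict (A i) with hν
    have hνt : ∀ t, MeasurableSet t → ν t = ∑' i, chartVolume (c i) (t ∩ A i) := by
      intro t ht
      rw [hν, Measure.sum_apply _ ht]
      exact tsum_congr fun i => Measure.restrict_apply ht
    have hle : riemannianVolume n M ≤ ν := by
      refine iSup₂_le fun ψ hψ => Measure.le_iff.2 fun t ht => ?_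
      have ht' : MeasurableSet (t ∩ ψ.source) := ht.inter ψ.open_source.measurableSet
      rw [← chartVolume_inter_source ψ ht, hsum ψ (IsManifold.subset_maximalAtlas hψ) _
        Set.inter_subset_right ht', ← hνt _ ht']
      exact measure_mono Set.inter_subset_left
    rw [hsum φ hφ s hsφ hs, ← hνt s hs]
    exact hle s
  · rw [hsum φ hφ s hsφ hs, hsplit (riemannianVolume n M) s hs]
    refine ENNReal.tsum_le_tsum fun i => ?_
    have hle : chartVolume (c i) ≤ riemannianVolume n M :=
      le_iSup₂_of_le (f := fun (ψ : OpenPartialHomeomorph M (Model n))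
        (_ : ψ ∈ atlas (Model n) M) => chartVolume ψ) (c i) (chart_mem_atlas _ _) le_rfl
    exact hle _

theorem riemannianVolume_restrict (hφ : φ ∈ IsManifold.maximalAtlas (𝓡 n) ∞ M) :
    (riemannianVolume n M).restrict φ.source = chartVolume φ := by
  ext s hs
  rw [Measure.restrict_apply hs, riemannianVolume_apply hφ
    (hs.inter φ.open_source.measurableSet) Set.inter_subset_right, chartVolume_inter_source φ hs]

theorem integral_riemannianVolume (hφ : φ ∈ IsManifold.maximalAtlas (𝓡 n) ∞ M) {f : M → ℝ}
    (hf : Continuous f) (h0 : ∀ x, x ∉ φ.source → f x = 0) :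
    ∫ x, f x ∂(riemannianVolume n M) = ∫ u in φ.target, volDensity φ u * f (φ.symm u) := by
  rw [← setIntegral_eq_integral_of_forall_compl_eq_zero (s := φ.source) fun x hx => h0 x hx,
    riemannianVolume_restrict hφ, chartVolume, integral_map (aemeasurable_symm_withDensity φ)
      hf.measurable.aestronglyMeasurable,
    integral_withDensity_eq_integral_toReal_smul₀ (aemeasurable_volDensity hφ).ennreal_ofReal
      (by simp)]
  refine integral_congr_ae (Filter.Eventually.of_forall fun u => ?_)
  simp only [smul_eq_mul]
  rw [ENNReal.toReal_ofReal (show 0 ≤ volDensity φ u from Real.sqrt_nonneg _)]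

/-- The density is continuous, hence integrable over small closed coordinate balls; compactness of M
turns local finiteness into finiteness. -/
instance isFiniteMeasure_riemannianVolume : IsFiniteMeasure (riemannianVolume n M) := by
  have hloc : IsLocallyFiniteMeasure (riemannianVolume n M) := by
    refine ⟨fun x => ?_⟩
    set φ := chartAt (Model n) x with hφdef
    have hφ : φ ∈ IsManifold.maximalAtlas (𝓡 n) ∞ M := IsManifold.chart_mem_maximalAtlas x
    have hx : x ∈ φ.source := mem_chart_source _ x
    obtain ⟨r, hr, hball⟩ := Metric.nhds_basis_closedBall.mem_iff.1
      (φ.open_target.mem_nhds (φ.map_source hx))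
    refine ⟨φ.source ∩ φ ⁻¹' (Metric.ball (φ x) r),
      (φ.isOpen_inter_preimage Metric.isOpen_ball).mem_nhds ⟨hx, Metric.mem_ball_self hr⟩, ?_⟩
    have hopen := φ.isOpen_inter_preimage (Metric.isOpen_ball (x := φ x) (ε := r))
    rw [riemannianVolume_apply hφ hopen.measurableSet Set.inter_subset_left,
      chartVolume_apply φ hopen.measurableSet]
    have h1 : IntegrableOn (volDensity φ) (Metric.closedBall (φ x) r) volume :=
      ((contDiffOn_volDensity hφ).continuousOn.mono hball).integrableOn_compact
        (isCompact_closedBall _ _)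
    refine lt_of_le_of_lt (lintegral_mono_set ?_) h1.lintegral_lt_top
    rintro u ⟨hu, -, hu'⟩
    rw [Set.mem_preimage, φ.right_inv hu] at hu'
    exact Metric.ball_subset_closedBall hu'
  exact ⟨isCompact_univ.measure_lt_top⟩

/-- Positivity of the density; it makes the L² product definite on smooth forms, hence adjoints
unique. -/
instance isOpenPosMeasure_riemannianVolume : (riemannianVolume n M).IsOpenPosMeasure := by
  refine ⟨fun U hU ⟨x, hx⟩ => ?_⟩
  set φ := chartAt (Model n) x with hφdef
  have hφ : φ ∈ IsManifold.maximalAtlas (𝓡 n) ∞ M := IsManifold.chart_mem_maximalAtlas x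
  have hxφ : x ∈ φ.source := mem_chart_source _ x
  have hopen : IsOpen (U ∩ φ.source) := hU.inter φ.open_source
  intro h0
  have h1 : riemannianVolume n M (U ∩ φ.source) = 0 :=
    measure_mono_null Set.inter_subset_left h0
  rw [riemannianVolume_apply hφ hopen.measurableSet Set.inter_subset_right,
    chartVolume_apply φ hopen.measurableSet] at h1
  have hO : IsOpen (φ.target ∩ φ.symm ⁻¹' (U ∩ φ.source)) := φ.isOpen_inter_preimage_symm hopen
  have hne : (φ.target ∩ φ.symm ⁻¹' (U ∩ φ.source)).Nonempty :=
    ⟨φ x, φ.map_source hxφ, by simpa [φ.left_inv hxφ] using ⟨hx, hxφ⟩⟩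
  have hae : AEMeasurable (fun u => ENNReal.ofReal (volDensity φ u))
      ((volume : Measure (Model n)).restrict (φ.target ∩ φ.symm ⁻¹' (U ∩ φ.source))) :=
    ((aemeasurable_volDensity hφ).mono_measure
      (Measure.restrict_mono Set.inter_subset_left le_rfl)).ennreal_ofReal
  rw [lintegral_eq_zero_iff' hae, Filter.EventuallyEq, ae_restrict_iff' hO.measurableSet] at h1
  refine (hO.measure_pos volume hne).ne' (measure_mono_null ?_ h1)
  intro u hu hcon
  have h2 := hcon hu
  simp only [Pi.zero_apply, ENNReal.ofReal_eq_zero] at h2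
  exact absurd (volDensity_pos hφ hu.1) (not_lt.2 h2)

theorem integrable_of_continuous {f : M → ℝ} (hf : Continuous f) :
    Integrable f (riemannianVolume n M) :=
  hf.integrable_of_hasCompactSupport (HasCompactSupport.of_compactSpace f)

end Leafwise

/-! ### The transverse density of a bundle-like metric -/

namespace Leafwise

/-- If B is the matrix of v in an orthonormal basis, the Gram matrix is BᵀB and the volume form is
±det B; squaring removes the orientation sign. -/
theorem volumeForm_sq_eq_det_gram {p : ℕ} {V : Type*} [NormedAddCommGroup V]
    [InnerProductSpace ℝ V] [FiniteDimensional ℝ V] [Fact (Module.finrank ℝ V = p)]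
    (o : Orientation ℝ V (Fin p)) (b : OrthonormalBasis (Fin p) ℝ V) (v : Fin p → V) :
    o.volumeForm v ^ 2 = (Matrix.of fun i j => (inner ℝ (v i) (v j) : ℝ)).det := by
  rw [← sq_abs, o.volumeForm_robust' b, sq_abs, Module.Basis.det_apply]
  have h1 : (Matrix.of fun i j => (inner ℝ (v i) (v j) : ℝ)) =
      (b.toBasis.toMatrix v).transpose * b.toBasis.toMatrix v := by
    ext i j
    simp only [Matrix.mul_apply, Matrix.transpose_apply, Matrix.of_apply,
      Module.Basis.toMatrix_apply, OrthonormalBasis.coe_toBasis_repr_apply,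
      OrthonormalBasis.repr_apply_apply]
    rw [← b.sum_inner_mul_inner (v i) (v j)]
    exact Finset.sum_congr rfl fun a _ => by rw [real_inner_comm]
  rw [h1, Matrix.det_mul, Matrix.det_transpose, sq]

theorem inner_eq_inner_starProjection_add {V : Type*} [NormedAddCommGroup V]
    [InnerProductSpace ℝ V] [FiniteDimensional ℝ V] (T : Submodule ℝ V) (a b : V) :
    (inner ℝ a b : ℝ) = inner ℝ (T.orthogonalProjectionOnto a) (T.orthogonalProjectionOnto b) +
      inner ℝ (Tᗮ.starProjection a) (Tᗮ.starProjection b) := by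
  have h1 : (inner ℝ (T.orthogonalProjectionOnto a) (T.orthogonalProjectionOnto b) : ℝ) =
      inner ℝ (T.starProjection a) (T.starProjection b) := rfl
  have h2 : ∀ x ∈ T, ∀ y ∈ Tᗮ, (inner ℝ x y : ℝ) = 0 := fun x hx y hy => hy x hx
  have h3 : ∀ x ∈ T, ∀ x' ∈ T, ∀ y ∈ Tᗮ, ∀ y' ∈ Tᗮ,
      (inner ℝ (x + y) (x' + y') : ℝ) = inner ℝ x x' + inner ℝ y y' := by
    intro x hx x' hx' y hy y' hy'
    rw [inner_add_left, inner_add_right, inner_add_right, h2 x hx y' hy', real_inner_comm x' y,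
      h2 x' hx' y hy]
    ring
  have h4 := h3 _ (T.starProjection_apply_mem a) _ (T.starProjection_apply_mem b)
    _ (Tᗮ.starProjection_apply_mem a) _ (Tᗮ.starProjection_apply_mem b)
  rwa [T.starProjection_add_starProjection_orthogonal, T.starProjection_add_starProjection_orthogonal,
    ← h1] at h4

/-- The Gram determinant of a basis of a subspace extended by further vectors. -/
theorem det_gram_extend {p q : ℕ} {V : Type*} [NormedAddCommGroup V] [InnerProductSpace ℝ V]
    [FiniteDimensional ℝ V] (T : Submodule ℝ V) (hT : Module.finrank ℝ T = p) (v : Fin p → T)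
    (hv : LinearIndependent ℝ v) (w : Fin q → V) :
    (Matrix.of fun i j : Fin p ⊕ Fin q =>
      (inner ℝ (Sum.elim (fun a => (v a : V)) w i) (Sum.elim (fun a => (v a : V)) w j) : ℝ)).det =
    (Matrix.of fun i j => (inner ℝ (v i) (v j) : ℝ)).det *
      (Matrix.of fun i j =>
        (inner ℝ (Tᗮ.starProjection (w i)) (Tᗮ.starProjection (w j)) : ℝ)).det := by
  set A : Matrix (Fin p) (Fin p) ℝ := Matrix.of fun i j => (inner ℝ (v i) (v j) : ℝ) with hA
  have hApos : A.PosDef := (Matrix.posDef_gram_iff_linearIndependent (𝕜 := ℝ)).2 hv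
  let bas : Module.Basis (Fin p) ℝ T :=
    basisOfLinearIndependentOfCardEqFinrank' v hv (by simp [hT])
  have hbas : ∀ i, bas i = v i := fun i => by simp [bas]
  set c : Matrix (Fin q) (Fin p) ℝ :=
    Matrix.of fun j a => bas.repr (T.orthogonalProjectionOnto (w j)) a with hc
  have hP : ∀ j, T.orthogonalProjectionOnto (w j) = ∑ a, c j a • v a := by
    intro j
    conv_lhs => rw [← bas.sum_repr (T.orthogonalProjectionOnto (w j))]
    exact Finset.sum_congr rfl fun a _ => by rw [hbas]; rfl
  have hAs : A.transpose = A := by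
    ext i j
    simp [hA, real_inner_comm]
  have hB : ∀ a j, (inner ℝ (v a : V) (w j) : ℝ) = (A * c.transpose) a j := by
    intro a j
    rw [← Submodule.inner_orthogonalProjectionOnto_eq_of_mem_left, hP, inner_sum, Matrix.mul_apply]
    refine Finset.sum_congr rfl fun i _ => ?_
    rw [inner_smul_right, Matrix.transpose_apply, mul_comm]
    rfl
  have hC : ∀ j a, (inner ℝ (w j) (v a : V) : ℝ) = (c * A) j a := by
    intro j a
    rw [real_inner_comm, hB, ← Matrix.transpose_apply (A * c.transpose), Matrix.transpose_mul,
      Matrix.transpose_transpose, hAs]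
  have hD : ∀ i j, (inner ℝ (w i) (w j) : ℝ) = (c * A * c.transpose) i j +
      inner ℝ (Tᗮ.starProjection (w i)) (Tᗮ.starProjection (w j)) := by
    intro i j
    have h1 : (c * A * c.transpose) i j =
        inner ℝ (T.orthogonalProjectionOnto (w i)) (T.orthogonalProjectionOnto (w j)) := by
      rw [hP, hP, sum_inner, Matrix.mul_apply]
      simp only [Matrix.mul_apply, Finset.sum_mul, inner_sum, inner_smul_left, inner_smul_right,
        Matrix.transpose_apply]
      rw [Finset.sum_comm]
      refine Finset.sum_congr rfl fun a _ => ?_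
      refine Finset.sum_congr rfl fun b _ => ?_
      simp [hA]
      ring
    rw [h1]
    exact inner_eq_inner_starProjection_add T (w i) (w j)
  have hblock : (Matrix.of fun i j : Fin p ⊕ Fin q =>
      (inner ℝ (Sum.elim (fun a => (v a : V)) w i) (Sum.elim (fun a => (v a : V)) w j) : ℝ)) =
      Matrix.fromBlocks A (A * c.transpose) (c * A) (Matrix.of fun i j => (inner ℝ (w i) (w j) : ℝ)) := by
    ext i j
    rcases i with i | i <;> rcases j with j | j
    · rfl
    · exact hB i j
    · exact hC i j
    · rfl
  have : Invertible A := hApos.isUnit.invertible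
  -- The Schur complement of the tangential block is the Gram matrix of the normal components, since
  -- c A cᵀ is the contribution of the tangential projections.
  rw [hblock, Matrix.det_fromBlocks₁₁]
  congr 2
  ext i j
  rw [Matrix.sub_apply, Matrix.of_apply, hD]
  rw [show c * A * ⅟A * (A * c.transpose) = c * A * c.transpose by
    rw [Matrix.mul_assoc c A, mul_invOf_self, Matrix.mul_one, Matrix.mul_assoc]]
  simp

theorem hasDerivAt_det_of_entries {q : ℕ} {N : ℝ → Matrix (Fin q) (Fin q) ℝ} {x : ℝ}
    (h : ∀ i j, HasDerivAt (fun t => N t i j) 0 x) : HasDerivAt (fun t => (N t).det) 0 x := by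
  simp only [Matrix.det_apply]
  have h1 : ∀ s : Equiv.Perm (Fin q), HasDerivAt
      (fun t => Equiv.Perm.sign s • ∏ i, N t (s i) i) 0 x := by
    intro s
    have h2 := HasDerivAt.fun_finsetProd (u := Finset.univ) (f := fun i t => N t (s i) i)
      (f' := fun _ => 0) (x := x) fun i _ => h (s i) i
    simp only [smul_zero, Finset.sum_const_zero] at h2
    have h3 := h2.fun_const_smul (Equiv.Perm.sign s)
    rw [smul_zero] at h3
    exact h3
  simpa using HasDerivAt.fun_sum (u := Finset.univ) fun s _ => h1 s

variable {n p : ℕ} {M : Type*} [TopologicalSpace M] [ChartedSpace (Model n) M]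
  [IsManifold (𝓡 n) ∞ M] {φ : OpenPartialHomeomorph M (Model n)}
  [RiemannianBundle (fun x : M => TangentSpace (𝓡 n) x)]
  [IsContMDiffRiemannianBundle (𝓡 n) ∞ (Model n) (fun x : M => TangentSpace (𝓡 n) x)]
  {F : Foliation n M p} (o : ∀ x : M, Orientation ℝ (F.tangent x) (Fin p))

/-- Subtracting the tangential part, written by Parseval in the smooth leaf frame, shows that the
normal coefficients are smooth. Only then does the vanishing of `fderiv` in `IsBundleLike` express
an actual derivative rather than a default value. -/
theorem normalMetric_eq (hφ : IsFlatChart p F.tangent φ) (hpn : p ≤ n) (v w : Model n)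
    {u : Model n} (hu : u ∈ φ.target) :
    normalMetric F φ v w u = chartMetric φ u v w - ∑ i, chartMetric φ u (frameVec F hpn φ i u) v *
      chartMetric φ u (frameVec F hpn φ i u) w := by
  have h1 : ∀ (i : Fin p) (v : Model n), chartMetric φ u (frameVec F hpn φ i u) v =
      inner ℝ (leafFrame F hpn φ u i)
        ((F.tangent (φ.symm u)).orthogonalProjectionOnto (chartInvDeriv φ u v)) := by
    intro i v
    rw [frameVec, chartMetric, chartInvDeriv_chartDeriv hφ.1 hu,
      Submodule.inner_orthogonalProjectionOnto_eq_of_mem_left]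
  simp only [h1]
  have h2 := inner_eq_inner_starProjection_add (F.tangent (φ.symm u)) (chartInvDeriv φ u v)
    (chartInvDeriv φ u w)
  have h3 := (leafFrame F hpn φ u).sum_inner_mul_inner
    ((F.tangent (φ.symm u)).orthogonalProjectionOnto (chartInvDeriv φ u v))
    ((F.tangent (φ.symm u)).orthogonalProjectionOnto (chartInvDeriv φ u w))
  rw [normalMetric, chartMetric, h2, ← h3, eq_sub_iff_add_eq, add_comm]
  congr 1
  exact Finset.sum_congr rfl fun i _ => by rw [real_inner_comm]

theorem contDiffOn_normalMetric (hφ : IsFlatChart p F.tangent φ) (v w : Model n) :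
    ContDiffOn ℝ ∞ (normalMetric F φ v w) φ.target := by
  by_cases hpn : p ≤ n
  · refine ContDiffOn.congr ?_ fun u hu => normalMetric_eq hφ hpn v w hu
    refine (contDiffOn_chartMetric_const hφ.1 v w).sub (ContDiffOn.sum fun i _ => ContDiffOn.mul ?_ ?_)
    · exact contDiffOn_chartMetric hφ.1 (contDiffOn_frameVec hφ hpn i) contDiffOn_const
    · exact contDiffOn_chartMetric hφ.1 (contDiffOn_frameVec hφ hpn i) contDiffOn_const
  · intro u _
    exact absurd (le_of_foliation F (φ.symm u)) hpn

/-- The quotient of the volume density and the leafwise volume form on the coordinate fields. -/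
def transDensity (hpn : p ≤ n) (φ : OpenPartialHomeomorph M (Model n)) (u : Model n) : ℝ :=
  volDensity φ u / chartForm (volForm o) φ u (leafVec hpn)

theorem chartForm_leafVec {k : ℕ} (hpn : p ≤ n) (α : LeafForm F k) (u : Model n)
    (I : Fin k → Fin p) : chartForm α φ u (fun i => leafVec hpn (I i)) =
      α (φ.symm u) (fun i => coordField F hpn φ u (I i)) := rfl

theorem chartForm_volForm_ne_zero (hφ : IsFlatChart p F.tangent φ) (hpn : p ≤ n) {u : Model n}
    (hu : u ∈ φ.target) : chartForm (volForm o) φ u (leafVec hpn) ≠ 0 := by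
  have h1 : chartForm (volForm o) φ u (leafVec hpn) =
    (o (φ.symm u)).volumeForm (coordField F hpn φ u) := rfl
  intro h0
  have h2 := volumeForm_sq_eq_det_gram (o (φ.symm u)) (leafBasis F (φ.symm u))
    (coordField F hpn φ u)
  rw [← h1, h0] at h2
  have h3 : (Matrix.gram ℝ (coordField F hpn φ u)).PosDef :=
    (Matrix.posDef_gram_iff_linearIndependent (𝕜 := ℝ)).2 (linearIndependent_coordField hφ hpn hu)
  have h4 := h3.det_pos
  have h5 : (Matrix.gram ℝ (coordField F hpn φ u)).det = 0 := by
    refine Eq.trans ?_ h2.symm |>.trans (by simp)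
    rfl
  exact h4.ne' h5

/-- The Gram determinant of all coordinate fields factors into a leafwise and a normal one, and the
leafwise factor is the square of the denominator. Hence only the normal metric remains, which is
what bundle-likeness controls. -/
theorem transDensity_sq (hφ : IsFlatChart p F.tangent φ) {q : ℕ} (hpq : p + q = n) (hpn : p ≤ n)
    {u : Model n} (hu : u ∈ φ.target) :
    transDensity o hpn φ u ^ 2 = (Matrix.of fun i j : Fin q =>
      normalMetric F φ (EuclideanSpace.basisFun (Fin n) ℝ (idxR hpq i))
        (EuclideanSpace.basisFun (Fin n) ℝ (idxR hpq j)) u).det := by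
  have h0 := chartForm_volForm_ne_zero o hφ hpn hu
  have h1 : chartForm (volForm o) φ u (leafVec hpn) =
    (o (φ.symm u)).volumeForm (coordField F hpn φ u) := rfl
  have h2 := volumeForm_sq_eq_det_gram (o (φ.symm u)) (leafBasis F (φ.symm u))
    (coordField F hpn φ u)
  have h3 := det_gram_extend (F.tangent (φ.symm u)) (F.finrank_tangent _) (coordField F hpn φ u)
    (linearIndependent_coordField hφ hpn hu)
    (fun j : Fin q => chartInvDeriv φ u (EuclideanSpace.basisFun (Fin n) ℝ (idxR hpq j)))
  have h4 : (gramMatrix φ u).det = (Matrix.of fun i j : Fin p ⊕ Fin q =>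
      (inner ℝ (Sum.elim (fun a => (coordField F hpn φ u a : TangentSpace (𝓡 n) (φ.symm u)))
        (fun j : Fin q => chartInvDeriv φ u (EuclideanSpace.basisFun (Fin n) ℝ (idxR hpq j))) i)
        (Sum.elim (fun a => (coordField F hpn φ u a : TangentSpace (𝓡 n) (φ.symm u)))
        (fun j : Fin q => chartInvDeriv φ u (EuclideanSpace.basisFun (Fin n) ℝ (idxR hpq j))) j) :
          ℝ)).det := by
    rw [← Matrix.det_reindex_self (finSumFinEquiv.trans (finCongr hpq)).symm (gramMatrix φ u)]
    have h5 : ∀ i : Fin p ⊕ Fin q, Sum.elim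
        (fun a => (coordField F hpn φ u a : TangentSpace (𝓡 n) (φ.symm u)))
        (fun j : Fin q => chartInvDeriv φ u (EuclideanSpace.basisFun (Fin n) ℝ (idxR hpq j))) i =
        chartInvDeriv φ u (EuclideanSpace.basisFun (Fin n) ℝ
          ((finSumFinEquiv.trans (finCongr hpq)) i)) := by
      intro i
      rcases i with i | i
      · exact coe_coordField hφ hpn hu i
      · rfl
    simp only [h5]
    rfl
  rw [transDensity, div_pow, volDensity_eq, Real.sq_sqrt (det_gramMatrix_pos hφ.1 hu).le, h4, h3,
    ← h2, ← h1, mul_div_assoc, mul_comm, div_mul_cancel₀]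
  · rfl
  · exact pow_ne_zero 2 h0

theorem contDiffOn_transDensity (ho : IsLeafOrientation o) (hφ : IsFlatChart p F.tangent φ)
    (hpn : p ≤ n) : ContDiffOn ℝ ∞ (transDensity o hpn φ) φ.target :=
  (contDiffOn_volDensity hφ.1).div (contDiffOn_alt_apply
    (contDiffOn_chartForm (isSmooth_volForm o ho) hφ.1) (v := fun i _ => leafVec hpn i)
      fun _ => contDiffOn_const) fun _ hu => chartForm_volForm_ne_zero o hφ hpn hu

/-- For a bundle-like metric the transverse density is constant along the leaves. -/
theorem fderiv_transDensity (hF : IsBundleLike F) (ho : IsLeafOrientation o)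
    (hφ : IsFlatChart p F.tangent φ) (hpn : p ≤ n) {u : Model n} (hu : u ∈ φ.target)
    {e : Model n} (he : e ∈ leafModel n p) : fderiv ℝ (transDensity o hpn φ) u e = 0 := by
  obtain ⟨q, hpq⟩ := Nat.exists_eq_add_of_le hpn
  have hpq : p + q = n := hpq.symm
  have hline : HasDerivAt (fun t : ℝ => u + t • e) e 0 := by
    simpa using ((hasDerivAt_id (0 : ℝ)).smul_const e).const_add u
  have hu0 : u + (0 : ℝ) • e = u := by rw [zero_smul, add_zero]
  have hnhds : ∀ᶠ t in nhds (0 : ℝ), u + t • e ∈ φ.target := by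
    refine hline.continuousAt.eventually_mem (φ.open_target.mem_nhds ?_)
    simpa using hu
  have hN : HasDerivAt (fun t : ℝ => (Matrix.of fun i j : Fin q =>
      normalMetric F φ (EuclideanSpace.basisFun (Fin n) ℝ (idxR hpq i))
        (EuclideanSpace.basisFun (Fin n) ℝ (idxR hpq j)) (u + t • e)).det) 0 0 := by
    refine hasDerivAt_det_of_entries fun i j => ?_
    have h1 := (((contDiffOn_normalMetric hφ (EuclideanSpace.basisFun (Fin n) ℝ (idxR hpq i))
      (EuclideanSpace.basisFun (Fin n) ℝ (idxR hpq j))).contDiffAt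
      (φ.open_target.mem_nhds hu)).differentiableAt (by simp)).hasFDerivAt
    rw [← hu0] at h1
    have h2 := HasFDerivAt.comp_hasDerivAt (0 : ℝ) (f := fun t : ℝ => u + t • e) h1 hline
    rw [hu0] at h2
    rw [hF φ hφ _ _ u hu e he] at h2
    exact h2
  have ht : DifferentiableAt ℝ (transDensity o hpn φ) u :=
    ((contDiffOn_transDensity o ho hφ hpn).contDiffAt
      (φ.open_target.mem_nhds hu)).differentiableAt (by simp)
  have h3 : HasDerivAt (fun t : ℝ => transDensity o hpn φ (u + t • e))
      (fderiv ℝ (transDensity o hpn φ) u e) 0 := by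
    have ht' := ht.hasFDerivAt
    rw [← hu0] at ht'
    have := HasFDerivAt.comp_hasDerivAt (0 : ℝ) (f := fun t : ℝ => u + t • e) ht' hline
    rwa [hu0] at this
  have h4 := h3.fun_pow 2
  have h5 : (fun t : ℝ => transDensity o hpn φ (u + t • e) ^ 2) =ᶠ[nhds 0]
      fun t : ℝ => (Matrix.of fun i j : Fin q =>
      normalMetric F φ (EuclideanSpace.basisFun (Fin n) ℝ (idxR hpq i))
        (EuclideanSpace.basisFun (Fin n) ℝ (idxR hpq j)) (u + t • e)).det := by
    filter_upwards [hnhds] with t ht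
    exact transDensity_sq o hφ hpq hpn ht
  have h6 := h4.unique (hN.congr_of_eventuallyEq h5)
  -- The square has derivative zero along the leaf; as the density itself is nonzero, so does the
  -- density.
  have h7 : transDensity o hpn φ u ≠ 0 :=
    div_ne_zero (volDensity_pos hφ.1 hu).ne' (chartForm_volForm_ne_zero o hφ hpn hu)
  simpa [h7] using h6

end Leafwise

/-! ### Leafwise Stokes theorem in a foliated chart -/

namespace Leafwise

/-- The integral of a directional derivative of a compactly supported function vanishes. -/
theorem integrableOn_fderiv_and_integral_eq_zero {n : ℕ} {U K : Set (Model n)} (hU : IsOpen U)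
    (hK : IsCompact K) (hKU : K ⊆ U) {g : Model n → ℝ} (hg : ContDiffOn ℝ ∞ g U)
    (h0 : ∀ u ∈ U, u ∉ K → g u = 0) (e : Model n) :
    IntegrableOn (fun u => fderiv ℝ g u e) U ∧ ∫ u in U, fderiv ℝ g u e = 0 := by
  classical
  -- Extension by zero is continuously differentiable on all of ℝⁿ because g vanishes off a compact
  -- subset of U.
  set G : Model n → ℝ := U.indicator g with hG
  have hGU : ∀ u ∈ U, G =ᶠ[nhds u] g := fun u hu => by
    filter_upwards [hU.mem_nhds hu] with y hy
    exact Set.indicator_of_mem hy g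
  have hGK : ∀ y, y ∉ K → G y = 0 := by
    intro y hy
    by_cases hyU : y ∈ U
    · rw [hG, Set.indicator_of_mem hyU, h0 y hyU hy]
    · exact Set.indicator_of_notMem hyU g
  have hGK' : ∀ u, u ∉ K → G =ᶠ[nhds u] fun _ => 0 := fun u hu => by
    filter_upwards [hK.isClosed.isOpen_compl.mem_nhds hu] with y hy
    exact hGK y hy
  have hGd : ContDiff ℝ 1 G := by
    rw [contDiff_iff_contDiffAt]
    intro u
    by_cases hu : u ∈ U
    · exact ((hg.contDiffAt (hU.mem_nhds hu)).of_le (by exact_mod_cast le_top)).congr_of_eventuallyEq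
        (hGU u hu)
    · exact contDiffAt_const.congr_of_eventuallyEq (hGK' u fun hk => hu (hKU hk))
  have hGs : HasCompactSupport G := HasCompactSupport.intro hK hGK
  have hfd : Set.EqOn (fun u => fderiv ℝ G u e) (fun u => fderiv ℝ g u e) U := fun u hu => by
    simp only [Filter.EventuallyEq.fderiv_eq (𝕜 := ℝ) (hGU u hu)]
  have hfd0 : ∀ u, u ∉ U → fderiv ℝ G u e = 0 := fun u hu => by
    rw [Filter.EventuallyEq.fderiv_eq (𝕜 := ℝ) (hGK' u fun hk => hu (hKU hk))]
    simp
  have h1 : ∫ u in U, fderiv ℝ g u e = ∫ u, fderiv ℝ G u e :=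
    (setIntegral_congr_fun hU.measurableSet hfd).symm.trans
      (setIntegral_eq_integral_of_forall_compl_eq_zero hfd0)
  have hint : Integrable (fun u => fderiv ℝ G u e) volume := by
    refine Continuous.integrable_of_hasCompactSupport ?_ (hGs.fderiv_apply ℝ e)
    exact (hGd.continuous_fderiv one_ne_zero).clm_apply continuous_const
  have hint' : Integrable G volume := hGd.continuous.integrable_of_hasCompactSupport hGs
  -- Integration by parts against the constant function 1.
  have h2 := integral_mul_fderiv_eq_neg_fderiv_mul_of_integrable (μ := volume)
    (f := fun _ : Model n => (1 : ℝ)) (g := G) (v := e) (by simp) (by simpa using hint)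
    (by simpa using hint') (by simp) (fun u _ => hGd.differentiable (by simp) u)
  refine ⟨hint.integrableOn.congr_fun hfd hU.measurableSet, ?_⟩
  rw [h1]
  simpa using h2

variable {n p k l : ℕ} {M : Type*} [TopologicalSpace M] [ChartedSpace (Model n) M]
  [IsManifold (𝓡 n) ∞ M] {φ : OpenPartialHomeomorph M (Model n)}
  [RiemannianBundle (fun x : M => TangentSpace (𝓡 n) x)]
  [IsContMDiffRiemannianBundle (𝓡 n) ∞ (Model n) (fun x : M => TangentSpace (𝓡 n) x)]
  {F : Foliation n M p} (o : ∀ x : M, Orientation ℝ (F.tangent x) (Fin p))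

/-- The leafwise derivative of a form in the chart `φ`, as a linear map on the leafwise tangent
space. -/
def leafDeriv (α : LeafForm F k) (φ : OpenPartialHomeomorph M (Model n)) (u : Model n) :
    F.tangent (φ.symm u) →ₗ[ℝ] (F.tangent (φ.symm u)) [⋀^Fin k]→ₗ[ℝ] ℝ where
  toFun w := (fderiv ℝ (chartForm α φ) u (chartDeriv φ (φ.symm u) w)).toAlternatingMap.compLinearMap
    ((chartDeriv φ (φ.symm u)).toLinearMap ∘ₗ (F.tangent (φ.symm u)).subtype)
  map_add' v w := by
    ext x
    simp
  map_smul' c w := by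
    ext x
    simp

theorem leafDeriv_apply (α : LeafForm F k) (φ : OpenPartialHomeomorph M (Model n)) (u : Model n)
    (w : F.tangent (φ.symm u)) (v : Fin k → F.tangent (φ.symm u)) :
    leafDeriv α φ u w v = fderiv ℝ (chartForm α φ) u (chartDeriv φ (φ.symm u) w)
      (fun i => chartDeriv φ (φ.symm u) (v i)) := rfl

/-- Both d_𝓕 and the wedge with η are alternatizations of a linear map into k-forms, so their sum
has the shape to which the algebraic Leibniz rule applies. -/
theorem twistedD_eq (η : LeafForm F 1) {α : LeafForm F k} (hα : IsSmooth α)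
    (hφ : φ ∈ IsManifold.maximalAtlas (𝓡 n) ∞ M) {u : Model n} (hu : u ∈ φ.target) :
    twistedD η α (φ.symm u) = AlternatingMap.alternatizeUncurryFin
      (leafDeriv α φ u + tensorAlt (η (φ.symm u)) (α (φ.symm u))) := by
  rw [AlternatingMap.alternatizeUncurryFin_add, ← wedgeAlt_one_left]
  have h1 : leafD α (φ.symm u) = AlternatingMap.alternatizeUncurryFin (leafDeriv α φ u) := by
    ext v
    rw [leafD_apply_symm hα hφ hu, AlternatingMap.alternatizeUncurryFin_apply, extDeriv,
      ContinuousAlternatingMap.alternatizeUncurryFin_apply]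
    rfl
  rw [← h1]
  rfl

/-- Coordinate fields are constant vectors in the chart, so differentiating the form and then
evaluating is differentiating its coefficient. -/
theorem leafDeriv_coordField (hφ : IsFlatChart p F.tangent φ) (hpn : p ≤ n) {α : LeafForm F k}
    (hα : IsSmooth α) {u : Model n} (hu : u ∈ φ.target) (a : Fin p) (I : Fin k → Fin p) :
    leafDeriv α φ u (coordField F hpn φ u a) (fun i => coordField F hpn φ u (I i)) =
      fderiv ℝ (fun y => chartForm α φ y (fun i => leafVec hpn (I i))) u (leafVec hpn a) := by
  have h1 : ∀ b, chartDeriv φ (φ.symm u) (coordField F hpn φ u b) = leafVec hpn b := fun b => by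
    rw [coe_coordField hφ hpn hu, chartDeriv_chartInvDeriv hφ.1 hu]
  rw [leafDeriv_apply]
  simp only [h1]
  have h2 : HasFDerivAt (chartForm α φ) (fderiv ℝ (chartForm α φ) u) u :=
    (((contDiffOn_chartForm hα hφ.1).contDiffAt
      (φ.open_target.mem_nhds hu)).differentiableAt (by simp)).hasFDerivAt
  have h3 := ((ContinuousAlternatingMap.apply ℝ (Model n) ℝ
    (fun i => leafVec hpn (I i))).hasFDerivAt).comp u h2
  have h4 := h3.fderiv
  have h5 := DFunLike.congr_fun h4 (leafVec hpn a)
  exact h5.symm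

/-- The Leibniz rule in a foliated chart. -/
theorem wedge_twistedD_add (hφ : IsFlatChart p F.tangent φ) (hpn : p ≤ n) (η : LeafForm F 1)
    {α : LeafForm F k} (hα : IsSmooth α) {σ : LeafForm F l} (hσ : IsSmooth σ)
    (h₁ : (k + 1) + l = p) (h₂ : k + (l + 1) = p) {u : Model n} (hu : u ∈ φ.target) :
    wedgeAlt h₁ (twistedD η α (φ.symm u)) (σ (φ.symm u)) (coordField F hpn φ u) +
      (-1) ^ k * wedgeAlt h₂ (α (φ.symm u)) (twistedD (-η) σ (φ.symm u)) (coordField F hpn φ u) =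
    ((k.factorial : ℝ) * l.factorial)⁻¹ * ∑ s : Equiv.Perm (Fin p),
      ((Equiv.Perm.sign s : ℤ) : ℝ) * fderiv ℝ (fun y =>
        chartForm α φ y (fun i => leafVec hpn (s (idxL h₁ i.succ))) *
          chartForm σ φ y (fun j => leafVec hpn (s (idxR h₁ j)))) u
        (leafVec hpn (s (idxL h₁ 0))) := by
  rw [twistedD_eq η hα hφ.1 hu, twistedD_eq (-η) hσ hφ.1 hu, wedgeAlt_alternatizeUncurryFin_add]
  congr 1
  refine Finset.sum_congr rfl fun s _ => ?_
  congr 1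
  have hd : ∀ {j : ℕ} {β : LeafForm F j}, IsSmooth β → ∀ I : Fin j → Fin p,
      DifferentiableAt ℝ (fun y => chartForm β φ y (fun i => leafVec hpn (I i))) u := by
    intro j β hβ I
    exact ((contDiffOn_alt_apply (contDiffOn_chartForm hβ hφ.1)
      (v := fun i _ => leafVec hpn (I i)) fun _ => contDiffOn_const).contDiffAt
        (φ.open_target.mem_nhds hu)).differentiableAt (by simp)
  rw [fderiv_fun_mul (hd hα _) (hd hσ _)]
  simp only [LinearMap.add_apply, AlternatingMap.add_apply, leafDeriv_coordField hφ hpn hα hu,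
    leafDeriv_coordField hφ hpn hσ hu, tensorAlt_apply, AlternatingMap.smul_apply, smul_eq_mul,
    Pi.neg_apply, AlternatingMap.neg_apply, _root_.add_apply, _root_.smul_apply,
    chartForm_leafVec]
  -- The term η(v) α σ from the first factor cancels against -η(v) α σ from the second; this is why
  -- duality reverses the sign of the twist.
  ring

/-- The integrand of Stokes' theorem. -/
def stokesIntegrand (η : LeafForm F 1) (h₁ : (k + 1) + l = p) (h₂ : k + (l + 1) = p)
    (α : LeafForm F k) (σ : LeafForm F l) (x : M) : ℝ :=
  innerAlt (twistedD η α x) (starInv o h₁ σ x) +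
    (-1) ^ k * innerAlt (α x) (starInv o h₂ (twistedD (-η) σ) x)

theorem continuous_stokesIntegrand (ho : IsLeafOrientation o) {η : LeafForm F 1} (hη : IsSmooth η)
    (h₁ : (k + 1) + l = p) (h₂ : k + (l + 1) = p) {α : LeafForm F k} (hα : IsSmooth α)
    {σ : LeafForm F l} (hσ : IsSmooth σ) : Continuous (stokesIntegrand o η h₁ h₂ α σ) :=
  (continuous_innerAlt (hη.twistedD hα) (hσ.starInv o ho h₁)).add
    (continuous_const.mul (continuous_innerAlt hα ((hη.neg.twistedD hσ).starInv o ho h₂)))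

theorem twistedD_eq_zero_of_notMem (η : LeafForm F 1) {α : LeafForm F k} {K : Set M}
    (hK : IsClosed K) (h0 : ∀ x, x ∉ K → α x = 0) {x : M} (hx : x ∉ K) : twistedD η α x = 0 := by
  have h1 : chartForm α (chartAt (Model n) x) =ᶠ[nhds (chartAt (Model n) x x)] fun _ => 0 := by
    have h2 : (chartAt (Model n) x).symm ⁻¹' Kᶜ ∈ nhds (chartAt (Model n) x x) := by
      refine ((chartAt (Model n) x).continuousAt_symm
        (mem_chart_target _ x)).preimage_mem_nhds (hK.isOpen_compl.mem_nhds ?_)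
      rwa [(chartAt (Model n) x).left_inv (mem_chart_source _ x)]
    filter_upwards [h2] with u hu
    ext v
    rw [chartForm_apply, h0 _ hu]
    rfl
  have h3 : extDeriv (chartForm α (chartAt (Model n) x)) (chartAt (Model n) x x) = 0 := by
    rw [h1.extDeriv_eq, extDeriv]
    ext v
    simp [ContinuousAlternatingMap.alternatizeUncurryFin_apply]
  have h4 : leafD α x = 0 := by
    rw [leafD, h3]
    rfl
  have h5 : wedge (Nat.add_comm 1 k) η α x = 0 := by
    rw [wedge, h0 x hx, wedgeAlt_one_left]
    ext v
    simp [AlternatingMap.alternatizeUncurryFin_apply, tensorAlt_apply]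
  change leafD α x + wedge (Nat.add_comm 1 k) η α x = 0
  rw [h4, h5, add_zero]

variable [MeasurableSpace M] [BorelSpace M] [CompactSpace M] [T2Space M]

/-- Stokes' theorem for forms supported in a foliated chart. -/
theorem integral_stokesIntegrand_of_support (hF : IsBundleLike F) (ho : IsLeafOrientation o)
    {η : LeafForm F 1} (hη : IsSmooth η) (h₁ : (k + 1) + l = p) (h₂ : k + (l + 1) = p)
    {α : LeafForm F k} (hα : IsSmooth α) {σ : LeafForm F l} (hσ : IsSmooth σ)
    (hφ : IsFlatChart p F.tangent φ) {K : Set M} (hK : IsClosed K) (hKφ : K ⊆ φ.source)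
    (h0 : ∀ x, x ∉ K → α x = 0) :
    ∫ x, stokesIntegrand o η h₁ h₂ α σ x ∂(riemannianVolume n M) = 0 := by
  by_cases hpn : p ≤ n
  swap
  · have : IsEmpty M := ⟨fun x => hpn (le_of_foliation F x)⟩
    rw [Measure.eq_zero_of_isEmpty (riemannianVolume n M), integral_zero_measure]
  have hz : ∀ x, x ∉ K → stokesIntegrand o η h₁ h₂ α σ x = 0 := by
    intro x hx
    rw [stokesIntegrand, twistedD_eq_zero_of_notMem η hK h0 hx, h0 x hx]
    simp [innerAlt]
  rw [integral_riemannianVolume hφ.1 (continuous_stokesIntegrand o ho hη h₁ h₂ hα hσ)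
    fun x hx => hz x fun hk => hx (hKφ hk)]
  set q : Equiv.Perm (Fin p) → Model n → ℝ := fun s y =>
    chartForm α φ y (fun i => leafVec hpn (s (idxL h₁ i.succ))) *
      chartForm σ φ y (fun j => leafVec hpn (s (idxR h₁ j))) with hq
  have hqs : ∀ s, ContDiffOn ℝ ∞ (q s) φ.target := fun s =>
    (contDiffOn_alt_apply (contDiffOn_chartForm hα hφ.1)
      (v := fun i _ => leafVec hpn (s (idxL h₁ i.succ))) fun _ => contDiffOn_const).mul
    (contDiffOn_alt_apply (contDiffOn_chartForm hσ hφ.1)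
      (v := fun j _ => leafVec hpn (s (idxR h₁ j))) fun _ => contDiffOn_const)
  have ht := contDiffOn_transDensity o ho hφ hpn
  -- The volume density is `transDensity` times the leafwise volume of the coordinate fields. The
  -- latter turns the integrand into leafwise derivatives of the q s; the former has no leafwise
  -- derivative and moves inside them.
  have hpt : ∀ u ∈ φ.target, volDensity φ u * stokesIntegrand o η h₁ h₂ α σ (φ.symm u) =
      ∑ s : Equiv.Perm (Fin p), (((k.factorial : ℝ) * l.factorial)⁻¹ *
        ((Equiv.Perm.sign s : ℤ) : ℝ)) *
        fderiv ℝ (fun y => transDensity o hpn φ y * q s y) u (leafVec hpn (s (idxL h₁ 0))) := by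
    intro u hu
    have hχ := chartForm_volForm_ne_zero o hφ hpn hu
    have e1 : stokesIntegrand o η h₁ h₂ α σ (φ.symm u) *
        chartForm (volForm o) φ u (leafVec hpn) =
        ((k.factorial : ℝ) * l.factorial)⁻¹ * ∑ s : Equiv.Perm (Fin p),
          ((Equiv.Perm.sign s : ℤ) : ℝ) * fderiv ℝ (q s) u (leafVec hpn (s (idxL h₁ 0))) := by
      rw [← wedge_twistedD_add hφ hpn η hα hσ h₁ h₂ hu, wedge_eq_innerAlt_starInv o h₁,
        wedge_eq_innerAlt_starInv o h₂]
      simp only [AlternatingMap.smul_apply, smul_eq_mul, stokesIntegrand]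
      have e2 : chartForm (volForm o) φ u (leafVec hpn) =
        volForm o (φ.symm u) (coordField F hpn φ u) := rfl
      rw [e2]
      ring
    have e3 : volDensity φ u * stokesIntegrand o η h₁ h₂ α σ (φ.symm u) =
        transDensity o hpn φ u * (stokesIntegrand o η h₁ h₂ α σ (φ.symm u) *
          chartForm (volForm o) φ u (leafVec hpn)) := by
      rw [transDensity]
      field_simp
    rw [e3, e1, Finset.mul_sum, Finset.mul_sum]
    refine Finset.sum_congr rfl fun s _ => ?_
    rw [fderiv_fun_mul ((ht.contDiffAt (φ.open_target.mem_nhds hu)).differentiableAt (by simp))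
      (((hqs s).contDiffAt (φ.open_target.mem_nhds hu)).differentiableAt (by simp))]
    simp only [_root_.add_apply, _root_.smul_apply, smul_eq_mul,
      fderiv_transDensity o hF ho hφ hpn hu (leafVec_mem hpn _), mul_zero, add_zero]
    ring
  rw [setIntegral_congr_fun φ.open_target.measurableSet hpt]
  have hKc : IsCompact (φ '' K) := hK.isCompact.image_of_continuousOn (φ.continuousOn.mono hKφ)
  have hKt : φ '' K ⊆ φ.target := by
    rintro _ ⟨x, hx, rfl⟩
    exact φ.map_source (hKφ hx)
  have hq0 : ∀ s, ∀ u ∈ φ.target, u ∉ φ '' K → transDensity o hpn φ u * q s u = 0 := by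
    intro s u hu huK
    have hx : φ.symm u ∉ K := fun hk => huK ⟨φ.symm u, hk, φ.right_inv hu⟩
    have : chartForm α φ u (fun i => leafVec hpn (s (idxL h₁ i.succ))) = 0 := by
      rw [chartForm_apply, h0 _ hx]
      rfl
    simp only [hq, this, zero_mul, mul_zero]
  have hI := fun s => integrableOn_fderiv_and_integral_eq_zero φ.open_target hKc hKt (ht.mul (hqs s)) (hq0 s)
    (leafVec hpn (s (idxL h₁ 0)))
  rw [integral_finsetSum _ fun s _ => (hI s).1.const_mul _]
  refine Finset.sum_eq_zero fun s _ => ?_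
  rw [integral_const_mul, (hI s).2, mul_zero]

end Leafwise

/-! ### Globalisation of the leafwise Stokes theorem -/

namespace Leafwise

theorem wedgeAlt_add_right {V : Type*} [AddCommGroup V] [Module ℝ V] {k l m : ℕ} (h : k + l = m)
    (a : V [⋀^Fin k]→ₗ[ℝ] ℝ) (b c : V [⋀^Fin l]→ₗ[ℝ] ℝ) :
    wedgeAlt h a (b + c) = wedgeAlt h a b + wedgeAlt h a c := by
  ext v
  simp only [wedgeAlt_apply, AlternatingMap.add_apply, mul_add, Finset.sum_add_distrib]

theorem wedgeAlt_smul_right {V : Type*} [AddCommGroup V] [Module ℝ V] {k l m : ℕ} (h : k + l = m)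
    (r : ℝ) (a : V [⋀^Fin k]→ₗ[ℝ] ℝ) (b : V [⋀^Fin l]→ₗ[ℝ] ℝ) :
    wedgeAlt h a (r • b) = r • wedgeAlt h a b := by
  ext v
  simp only [wedgeAlt_apply, AlternatingMap.smul_apply, smul_eq_mul, Finset.mul_sum]
  exact Finset.sum_congr rfl fun s _ => by ring

variable {n p k l : ℕ} {M : Type*} [TopologicalSpace M] [ChartedSpace (Model n) M]
  [IsManifold (𝓡 n) ∞ M]
  [RiemannianBundle (fun x : M => TangentSpace (𝓡 n) x)]
  [IsContMDiffRiemannianBundle (𝓡 n) ∞ (Model n) (fun x : M => TangentSpace (𝓡 n) x)]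
  {F : Foliation n M p} (o : ∀ x : M, Orientation ℝ (F.tangent x) (Fin p))

theorem IsSmooth.differentiableAt_chartForm {α : LeafForm F k} (hα : IsSmooth α) (x : M) :
    DifferentiableAt ℝ (chartForm α (chartAt (Model n) x)) (chartAt (Model n) x x) :=
  ((hα _ (chart_mem_atlas _ x)).contDiffAt ((chartAt (Model n) x).open_target.mem_nhds
    (mem_chart_target _ x))).differentiableAt (by simp)

theorem leafD_add {α β : LeafForm F k} (hα : IsSmooth α) (hβ : IsSmooth β) :
    leafD (α + β) = leafD α + leafD β := by
  funext x
  have h : chartForm (α + β) (chartAt (Model n) x) =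
    chartForm α (chartAt (Model n) x) + chartForm β (chartAt (Model n) x) := rfl
  rw [Pi.add_apply, leafD, h, extDeriv_add (hα.differentiableAt_chartForm x)
    (hβ.differentiableAt_chartForm x)]
  rfl

theorem leafD_smul (c : ℝ) (α : LeafForm F k) :
    leafD (c • α) = c • leafD α := by
  funext x
  have h : chartForm (c • α) (chartAt (Model n) x) = c • chartForm α (chartAt (Model n) x) := rfl
  rw [Pi.smul_apply, leafD, h, extDeriv_smul c]
  rfl

theorem twistedD_add (η : LeafForm F 1) {α β : LeafForm F k} (hα : IsSmooth α) (hβ : IsSmooth β) :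
    twistedD η (α + β) = twistedD η α + twistedD η β := by
  have h : wedge (Nat.add_comm 1 k) η (α + β) =
      wedge (Nat.add_comm 1 k) η α + wedge (Nat.add_comm 1 k) η β :=
    funext fun x => wedgeAlt_add_right _ (η x) (α x) (β x)
  rw [twistedD, leafD_add hα hβ, h, add_add_add_comm]
  rfl

theorem twistedD_smul (η : LeafForm F 1) (c : ℝ) (α : LeafForm F k) :
    twistedD η (c • α) = c • twistedD η α := by
  have h : wedge (Nat.add_comm 1 k) η (c • α) = c • wedge (Nat.add_comm 1 k) η α :=
    funext fun x => wedgeAlt_smul_right _ c (η x) (α x)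
  rw [twistedD, leafD_smul c α, h, ← smul_add]
  rfl

theorem stokesIntegrand_add (η : LeafForm F 1) (h₁ : (k + 1) + l = p) (h₂ : k + (l + 1) = p)
    {α β : LeafForm F k} (hα : IsSmooth α) (hβ : IsSmooth β) (σ : LeafForm F l) (x : M) :
    stokesIntegrand o η h₁ h₂ (α + β) σ x =
      stokesIntegrand o η h₁ h₂ α σ x + stokesIntegrand o η h₁ h₂ β σ x := by
  simp only [stokesIntegrand, twistedD_add η hα hβ, Pi.add_apply, innerAlt_add_left]
  ring

variable [MeasurableSpace M] [BorelSpace M] [CompactSpace M] [T2Space M]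

/-- Stokes' theorem for leafwise forms on a closed manifold with a bundle-like metric. -/
theorem integral_stokesIntegrand (hF : IsBundleLike F) (ho : IsLeafOrientation o)
    {η : LeafForm F 1} (hη : IsSmooth η) (h₁ : (k + 1) + l = p) (h₂ : k + (l + 1) = p)
    {α : LeafForm F k} (hα : IsSmooth α) {σ : LeafForm F l} (hσ : IsSmooth σ) :
    ∫ x, stokesIntegrand o η h₁ h₂ α σ x ∂(riemannianVolume n M) = 0 := by
  classical
  choose φ hxφ hφ using F.exists_flatChart
  -- The integrand is additive in α, so it suffices to cut α by a partition of unity subordinate to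
  -- foliated charts; compactness leaves finitely many nonzero pieces.
  obtain ⟨ρ, hρ⟩ := SmoothPartitionOfUnity.exists_isSubordinate (𝓡 n) (isClosed_univ (X := M))
    (fun x : M => (φ x).source) (fun x => (φ x).open_source)
    (fun x _ => Set.mem_iUnion.2 ⟨x, hxφ x⟩)
  have hfin : {i | (Function.support (ρ i)).Nonempty}.Finite :=
    ρ.locallyFinite.finite_nonempty_of_compact
  have hsm : ∀ i, IsSmooth (fun x => ρ i x • α x : LeafForm F k) := fun i =>
    hα.smul (ρ i).contMDiff
  have hloc : ∀ i, ∫ x, stokesIntegrand o η h₁ h₂ (fun x => ρ i x • α x) σ x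
      ∂(riemannianVolume n M) = 0 := fun i =>
    integral_stokesIntegrand_of_support o hF ho hη h₁ h₂ (hsm i) hσ (hφ i)
      (isClosed_tsupport (ρ i)) (hρ i) fun x hx => by
        simp only [image_eq_zero_of_notMem_tsupport hx]
        ext v
        simp
  -- Smoothness of the partial sums is carried along, since splitting both the differential and the
  -- integral requires it.
  have hsum : ∀ t : Finset M, IsSmooth (∑ i ∈ t, fun x => ρ i x • α x : LeafForm F k) ∧
      ∫ x, stokesIntegrand o η h₁ h₂ (∑ i ∈ t, fun x => ρ i x • α x) σ x
        ∂(riemannianVolume n M) = 0 := by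
    intro t
    induction t using Finset.induction_on with
    | empty =>
      refine ⟨by simpa using isSmooth_zero, ?_⟩
      have h0 : ∀ x, stokesIntegrand o η h₁ h₂ 0 σ x = 0 := fun x => by
        rw [stokesIntegrand, twistedD_eq_zero_of_notMem (α := 0) η isClosed_empty (fun _ _ => rfl)
          (Set.notMem_empty x)]
        simp [innerAlt]
      simp [h0]
    | insert i t hi ih =>
      rw [Finset.sum_insert hi]
      refine ⟨(hsm i).add ih.1, ?_⟩
      simp only [stokesIntegrand_add o η h₁ h₂ (hsm i) ih.1]
      rw [integral_add (integrable_of_continuous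
        (continuous_stokesIntegrand o ho hη h₁ h₂ (hsm i) hσ))
        (integrable_of_continuous (continuous_stokesIntegrand o ho hη h₁ h₂ ih.1 hσ)),
        hloc i, ih.2, add_zero]
  have hα' : (∑ i ∈ hfin.toFinset, fun x => ρ i x • α x : LeafForm F k) = α := by
    funext x
    have h1 := ρ.sum_eq_one (Set.mem_univ x)
    rw [finsum_eq_sum_of_support_subset (s := hfin.toFinset)] at h1
    · rw [Finset.sum_apply, ← Finset.sum_smul, h1, one_smul]
    · intro i hi
      simp only [Set.Finite.coe_toFinset, Set.mem_ofPred_eq]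
      exact ⟨x, hi⟩
  rw [← hα']
  exact (hsum _).2

/-- Integration by parts for the twisted leafwise differential. -/
theorem l2Inner_twistedD_starInv (hF : IsBundleLike F) (ho : IsLeafOrientation o)
    {η : LeafForm F 1} (hη : IsSmooth η) (h₁ : (k + 1) + l = p) (h₂ : k + (l + 1) = p)
    {α : LeafForm F k} (hα : IsSmooth α) {σ : LeafForm F l} (hσ : IsSmooth σ) :
    l2Inner (twistedD η α) (starInv o h₁ σ) =
      (-1) ^ (k + 1) * l2Inner α (starInv o h₂ (twistedD (-η) σ)) := by
  have h := integral_stokesIntegrand o hF ho hη h₁ h₂ hα hσ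
  simp only [stokesIntegrand] at h
  rw [integral_add
    (integrable_of_continuous (continuous_innerAlt (hη.twistedD hα) (hσ.starInv o ho h₁)))
    ((integrable_of_continuous
      (continuous_innerAlt hα ((hη.neg.twistedD hσ).starInv o ho h₂))).const_mul _),
    integral_const_mul] at h
  rw [l2Inner, l2Inner, pow_succ]
  linarith

end Leafwise

/-! ### Adjoints, their duality under the star, and the Laplacian -/

namespace Leafwise

variable {n p k l : ℕ} {M : Type*} [TopologicalSpace M] [ChartedSpace (Model n) M]
  [IsManifold (𝓡 n) ∞ M]
  [RiemannianBundle (fun x : M => TangentSpace (𝓡 n) x)]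
  [IsContMDiffRiemannianBundle (𝓡 n) ∞ (Model n) (fun x : M => TangentSpace (𝓡 n) x)]
  {F : Foliation n M p} (o : ∀ x : M, Orientation ℝ (F.tangent x) (Fin p))

theorem starInv_hodgeStar (h : k + l = p) (β : LeafForm F k) :
    starInv o h (hodgeStar o h β) = β := by
  funext x
  rw [starInv, hodgeStar_apply o h _ x (leafBasis F x), starT_starS]

theorem volForm_ne_zero (x : M) : volForm o x ≠ 0 :=
  volumeForm_ne_zero_of_basis (o x) (leafBasis F x)

/-- Both sides are the coefficient of α ∧ γ with respect to the volume form. -/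
theorem innerAlt_starInv (h : k + l = p) (α : LeafForm F k) (γ : LeafForm F l) (x : M) :
    innerAlt (α x) (starInv o h γ x) = innerAlt (hodgeStar o h α x) (γ x) := by
  have h1 := (wedge_eq_innerAlt_starInv o h α γ x).symm.trans
    (wedge_eq_innerAlt_hodgeStar o h α γ x)
  by_contra hne
  obtain ⟨v, hv⟩ : ∃ v, volForm o x v ≠ 0 := by
    by_contra! hv
    exact volForm_ne_zero o x (by ext v; exact hv v)
  have h2 := DFunLike.congr_fun h1 v
  simp only [AlternatingMap.smul_apply, smul_eq_mul] at h2
  exact hne (mul_right_cancel₀ hv h2)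

/-- More than p leaf vectors are dependent. This settles the degrees above p, where no complementary
degree exists for the star. -/
theorem subsingleton_leafForm (h : p < k) : Subsingleton (LeafForm F k) := by
  refine ⟨fun α β => funext fun x => ?_⟩
  have hz : ∀ γ : (F.tangent x) [⋀^Fin k]→ₗ[ℝ] ℝ, γ = 0 := by
    intro γ
    ext v
    refine γ.map_linearDependent v fun hv => ?_
    have := hv.fintype_card_le_finrank
    rw [Fintype.card_fin, F.finrank_tangent x] at this
    omega
  rw [hz (α x), hz (β x)]

variable [MeasurableSpace M]

theorem l2Inner_comm (α β : LeafForm F k) : l2Inner α β = l2Inner β α := by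
  simp only [l2Inner, innerAlt_comm]

theorem l2Inner_smul_right (c : ℝ) (α β : LeafForm F k) :
    l2Inner α (c • β) = c * l2Inner α β := by
  simp only [l2Inner, Pi.smul_apply, innerAlt_smul_right, integral_const_mul]

variable [BorelSpace M] [CompactSpace M] [T2Space M]

theorem l2Inner_sub_right {α β γ : LeafForm F k} (hα : IsSmooth α) (hβ : IsSmooth β)
    (hγ : IsSmooth γ) : l2Inner α (β - γ) = l2Inner α β - l2Inner α γ := by
  simp only [l2Inner, Pi.sub_apply, innerAlt_sub_right]
  exact integral_sub (integrable_of_continuous (continuous_innerAlt hα hβ))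
    (integrable_of_continuous (continuous_innerAlt hα hγ))

theorem eq_zero_of_l2Inner_self {α : LeafForm F k} (hα : IsSmooth α) (h : l2Inner α α = 0) :
    α = 0 := by
  have hc := continuous_innerAlt hα hα
  rw [l2Inner, integral_eq_zero_iff_of_nonneg (fun x => innerAlt_self_nonneg (α x))
    (integrable_of_continuous hc)] at h
  have h1 := Continuous.ae_eq_iff_eq (riemannianVolume n M) hc continuous_const |>.1 h
  funext x
  exact innerAlt_self_eq_zero (congrFun h1 x)

/-- The difference of two candidates is itself an admissible test form, so its norm is zero. -/
theorem IsAdjointValue.unique {η : LeafForm F 1} {β : LeafForm F (k + 1)} {γ γ' : LeafForm F k}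
    (h : IsAdjointValue η β γ) (h' : IsAdjointValue η β γ') : γ = γ' := by
  have hs := h.1.sub h'.1
  refine sub_eq_zero.1 (eq_zero_of_l2Inner_self hs ?_)
  rw [l2Inner_sub_right hs h.1 h'.1, ← h.2 _ hs, ← h'.2 _ hs, sub_self]

theorem IsAdjointValue.twistedDelta_eq {η : LeafForm F 1} {β : LeafForm F (k + 1)}
    {γ : LeafForm F k} (h : IsAdjointValue η β γ) : twistedDelta η β = γ := by
  have hex : ∃ γ, IsAdjointValue η β γ := ⟨γ, h⟩
  rw [twistedDelta, dif_pos hex]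
  exact hex.choose_spec.unique h

theorem isAdjointValue_zero (η : LeafForm F 1) :
    IsAdjointValue η (0 : LeafForm F (k + 1)) (0 : LeafForm F k) := by
  refine ⟨isSmooth_zero, fun α _ => ?_⟩
  simp [l2Inner, innerAlt]

/-- Integration by parts with σ = *β, for which *⁻¹σ is β again. -/
theorem isAdjointValue_starInv (hF : IsBundleLike F) (ho : IsLeafOrientation o)
    {η : LeafForm F 1} (hη : IsSmooth η) (h₁ : (k + 1) + l = p) (h₂ : k + (l + 1) = p)
    {β : LeafForm F (k + 1)} (hβ : IsSmooth β) :
    IsAdjointValue η β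
      ((-1 : ℝ) ^ (k + 1) • starInv o h₂ (twistedD (-η) (hodgeStar o h₁ β))) := by
  have hs := hβ.hodgeStar o ho h₁
  refine ⟨((hη.neg.twistedD hs).starInv o ho h₂).const_smul _, fun α hα => ?_⟩
  have h := l2Inner_twistedD_starInv o hF ho hη h₁ h₂ hα hs
  rwa [starInv_hodgeStar, ← l2Inner_smul_right] at h

/-- The same integration by parts with the roles reversed: β is fixed, σ is the test form, and *⁻¹
is moved across the inner product as *. -/
theorem isAdjointValue_hodgeStar (hF : IsBundleLike F) (ho : IsLeafOrientation o)
    {η : LeafForm F 1} (hη : IsSmooth η) (h₁ : (k + 1) + l = p) (h₂ : k + (l + 1) = p)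
    {β : LeafForm F k} (hβ : IsSmooth β) :
    IsAdjointValue (-η) (hodgeStar o h₂ β)
      ((-1 : ℝ) ^ (k + 1) • hodgeStar o h₁ (twistedD η β)) := by
  refine ⟨((hη.twistedD hβ).hodgeStar o ho h₁).const_smul _, fun σ hσ => ?_⟩
  have h := l2Inner_twistedD_starInv o hF ho hη h₁ h₂ hβ hσ
  simp only [l2Inner, innerAlt_starInv] at h
  rw [l2Inner_smul_right, l2Inner_comm, l2Inner_comm σ]
  simp only [l2Inner]
  rw [h, ← mul_assoc, ← mul_pow]
  simp

theorem exists_isAdjointValue (hF : IsBundleLike F) (ho : IsLeafOrientation o)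
    {η : LeafForm F 1} (hη : IsSmooth η) {β : LeafForm F (k + 1)} (hβ : IsSmooth β) :
    ∃ γ, IsAdjointValue η β γ := by
  rcases le_or_gt (k + 1) p with hk | hk
  · obtain ⟨l, h₁⟩ := Nat.exists_eq_add_of_le hk
    exact ⟨_, isAdjointValue_starInv o hF ho hη h₁.symm (by omega : k + (l + 1) = p) hβ⟩
  · have := subsingleton_leafForm (F := F) hk
    rw [Subsingleton.elim β 0]
    exact ⟨0, isAdjointValue_zero η⟩

theorem isAdjointValue_twistedDelta (hF : IsBundleLike F) (ho : IsLeafOrientation o)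
    {η : LeafForm F 1} (hη : IsSmooth η) {β : LeafForm F (k + 1)} (hβ : IsSmooth β) :
    IsAdjointValue η β (twistedDelta η β) := by
  obtain ⟨γ, hγ⟩ := exists_isAdjointValue o hF ho hη hβ
  rwa [hγ.twistedDelta_eq]

theorem twistedDelta_eq_zero (hk : p < k + 1) (η : LeafForm F 1) (β : LeafForm F (k + 1)) :
    twistedDelta η β = 0 := by
  have := subsingleton_leafForm (F := F) hk
  rw [Subsingleton.elim β 0]
  exact (isAdjointValue_zero η).twistedDelta_eq

/-- The Hodge star exchanges the adjoint of `d + η ∧` with `d - η ∧`. -/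
theorem hodgeStar_twistedDelta (hF : IsBundleLike F) (ho : IsLeafOrientation o)
    {η : LeafForm F 1} (hη : IsSmooth η) (h₁ : (k + 1) + l = p) (h₂ : k + (l + 1) = p)
    {β : LeafForm F (k + 1)} (hβ : IsSmooth β) :
    hodgeStar o h₂ (twistedDelta η β) =
      (-1 : ℝ) ^ (k + 1) • twistedD (-η) (hodgeStar o h₁ β) := by
  rw [(isAdjointValue_starInv o hF ho hη h₁ h₂ hβ).twistedDelta_eq, hodgeStar_smul,
    hodgeStar_starInv]

/-- The Hodge star exchanges `d + η ∧` with the adjoint of `d - η ∧`. -/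
theorem twistedDelta_hodgeStar (hF : IsBundleLike F) (ho : IsLeafOrientation o)
    {η : LeafForm F 1} (hη : IsSmooth η) (h₁ : (k + 1) + l = p) (h₂ : k + (l + 1) = p)
    {β : LeafForm F k} (hβ : IsSmooth β) :
    twistedDelta (-η) (hodgeStar o h₂ β) =
      (-1 : ℝ) ^ (k + 1) • hodgeStar o h₁ (twistedD η β) :=
  (isAdjointValue_hodgeStar o hF ho hη h₁ h₂ hβ).twistedDelta_eq

theorem smul_smul_neg_one_pow (j : ℕ) (α : LeafForm F k) :
    (-1 : ℝ) ^ j • (-1 : ℝ) ^ j • α = α := by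
  rw [smul_smul, ← mul_pow]
  simp

/-- Since the adjoint is chosen, homogeneity follows only from its existence and uniqueness. -/
theorem twistedDelta_smul (hF : IsBundleLike F) (ho : IsLeafOrientation o)
    {η : LeafForm F 1} (hη : IsSmooth η) (c : ℝ) {β : LeafForm F (k + 1)} (hβ : IsSmooth β) :
    twistedDelta η (c • β) = c • twistedDelta η β := by
  have h := isAdjointValue_twistedDelta o hF ho hη hβ
  refine IsAdjointValue.twistedDelta_eq ⟨h.1.const_smul c, fun α hα => ?_⟩
  rw [l2Inner_smul_right, l2Inner_smul_right, h.2 α hα]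

/-- The exact parts of the Laplacians correspond to the coexact parts under the Hodge star. -/
theorem hodgeStar_twistedD_twistedDelta (hF : IsBundleLike F) (ho : IsLeafOrientation o)
    {η : LeafForm F 1} (hη : IsSmooth η) (h : (k + 1) + l = p)
    {β : LeafForm F (k + 1)} (hβ : IsSmooth β) :
    hodgeStar o h (twistedD η (twistedDelta η β)) =
      twistedDelta (-η) (twistedD (-η) (hodgeStar o h β)) := by
  have h₂ : k + (l + 1) = p := by omega
  have hδ := (isAdjointValue_twistedDelta o hF ho hη hβ).1
  have h1 := twistedDelta_hodgeStar o hF ho hη h h₂ hδ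
  rw [hodgeStar_twistedDelta o hF ho hη h h₂ hβ, twistedDelta_smul o hF ho hη.neg _
    -- The second duality, applied to δβ, now has *δβ replaced by means of the first; both sides
    -- carry (-1)^{k+1}, removed by multiplying with it once more.
    (hη.neg.twistedD (hβ.hodgeStar o ho h))] at h1
  have h2 := congrArg (fun γ => (-1 : ℝ) ^ (k + 1) • γ) h1
  simpa only [smul_smul_neg_one_pow] using h2.symm

/-- The coexact parts of the Laplacians correspond to the exact parts under the Hodge star. -/
theorem hodgeStar_twistedDelta_twistedD (hF : IsBundleLike F) (ho : IsLeafOrientation o)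
    {η : LeafForm F 1} (hη : IsSmooth η) (h : k + (l + 1) = p)
    {β : LeafForm F k} (hβ : IsSmooth β) :
    hodgeStar o h (twistedDelta η (twistedD η β)) =
      twistedD (-η) (twistedDelta (-η) (hodgeStar o h β)) := by
  have h₁ : (k + 1) + l = p := by omega
  rw [hodgeStar_twistedDelta o hF ho hη h₁ h (hη.twistedD hβ),
    twistedDelta_hodgeStar o hF ho hη h₁ h hβ, twistedD_smul]

theorem hodgeStar_zero (h : k + l = p) : hodgeStar o h (0 : LeafForm F k) = 0 := by
  have := hodgeStar_smul o h 0 (0 : LeafForm F k)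
  rwa [zero_smul, zero_smul] at this

/-- The star swaps the two summands of the Laplacian. At the ends of the degree range one summand is
missing: dδ on functions by definition, and its partner δd on p-forms because d lands in degree p +
1. The cases on k and l match these. -/
theorem hodgeStar_twistedLaplacian (hF : IsBundleLike F) (ho : IsLeafOrientation o)
    {η : LeafForm F 1} (hη : IsSmooth η) (h : k + l = p) {β : LeafForm F k} (hβ : IsSmooth β) :
    hodgeStar o h (twistedLaplacian η β) = twistedLaplacian (-η) (hodgeStar o h β) := by
  have hk : l = 0 → hodgeStar o h (twistedDelta η (twistedD η β)) = 0 := fun hl => by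
    rw [twistedDelta_eq_zero (by omega), hodgeStar_zero]
  have hl : k = 0 → twistedDelta (-η) (twistedD (-η) (hodgeStar o h β)) = 0 := fun hk =>
    twistedDelta_eq_zero (by omega) _ _
  rcases k with _ | k <;> rcases l with _ | l
  · simp only [twistedLaplacian, hk rfl, hl rfl]
  · simp only [twistedLaplacian, hl rfl, add_zero]
    exact hodgeStar_twistedDelta_twistedD o hF ho hη h hβ
  · simp only [twistedLaplacian, hodgeStar_add, hk rfl, add_zero]
    exact hodgeStar_twistedD_twistedDelta o hF ho hη h hβ
  · simp only [twistedLaplacian, hodgeStar_add]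
    rw [hodgeStar_twistedD_twistedDelta o hF ho hη h hβ,
      hodgeStar_twistedDelta_twistedD o hF ho hη h hβ]
    exact add_comm _ _

end Leafwise

end

/-! ### The theorem -/

theorem mainTheorem7 {n p : ℕ} {M : Type*} [TopologicalSpace M]
    [ChartedSpace (EuclideanSpace ℝ (Fin n)) M] [IsManifold (𝓡 n) ∞ M]
    [T2Space M] [CompactSpace M] [MeasurableSpace M] [BorelSpace M]
    [RiemannianBundle (fun x : M => TangentSpace (𝓡 n) x)]
    [IsContMDiffRiemannianBundle (𝓡 n) ∞ (EuclideanSpace ℝ (Fin n))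
      (fun x : M => TangentSpace (𝓡 n) x)]
    (F : Leafwise.Foliation n M p) (hF : Leafwise.IsBundleLike F)
    (o : ∀ x : M, Orientation ℝ (F.tangent x) (Fin p)) (ho : Leafwise.IsLeafOrientation o)
    (η : Leafwise.LeafForm F 1) (hη : Leafwise.IsSmooth η) (hdη : Leafwise.leafD η = 0) :
    -- the operators are well defined on smooth leafwise forms
    ((∀ (k : ℕ) (β : Leafwise.LeafForm F k), Leafwise.IsSmooth β →
        Leafwise.IsSmooth (Leafwise.twistedD η β)) ∧
      (∀ (k : ℕ) (β : Leafwise.LeafForm F (k + 1)), Leafwise.IsSmooth β →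
        ∃! γ : Leafwise.LeafForm F k, Leafwise.IsAdjointValue η β γ) ∧
      (∀ (k l : ℕ) (h : k + l = p) (β : Leafwise.LeafForm F k), Leafwise.IsSmooth β →
        Leafwise.IsSmooth (Leafwise.hodgeStar o h β) ∧
          ∀ x, ∃! c, Leafwise.IsStarAlt (o x) h (β x) c)) ∧
    -- the star operator intertwines the Laplacians
    (∀ (k l : ℕ) (h : k + l = p) (β : Leafwise.LeafForm F k), Leafwise.IsSmooth β →
      Leafwise.hodgeStar o h (Leafwise.twistedLaplacian η β) =
        Leafwise.twistedLaplacian (-η) (Leafwise.hodgeStar o h β)) ∧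
    -- and maps harmonic forms to harmonic forms
    (∀ (k l : ℕ) (h : k + l = p) (β : Leafwise.LeafForm F k), Leafwise.IsHarmonic η β →
      Leafwise.IsHarmonic (-η) (Leafwise.hodgeStar o h β)) := by
  have hstar : ∀ (k l : ℕ) (h : k + l = p) (β : Leafwise.LeafForm F k), Leafwise.IsSmooth β →
      Leafwise.hodgeStar o h (Leafwise.twistedLaplacian η β) =
        Leafwise.twistedLaplacian (-η) (Leafwise.hodgeStar o h β) :=
    fun k l h β hβ => Leafwise.hodgeStar_twistedLaplacian o hF ho hη h hβ
  refine ⟨⟨fun k β hβ => hη.twistedD hβ, fun k β hβ => ?_, fun k l h β hβ =>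
    ⟨hβ.hodgeStar o ho h, fun x =>
      Leafwise.existsUnique_isStarAlt (o x) (Leafwise.leafBasis F x) h (β x)⟩⟩, hstar,
    fun k l h β hβ => ⟨hβ.1.hodgeStar o ho h, ?_⟩⟩
  · exact existsUnique_of_exists_of_unique (Leafwise.exists_isAdjointValue o hF ho hη hβ)
      fun _ _ h₁ h₂ => h₁.unique h₂
  · rw [← hstar k l h β hβ.1, hβ.2, Leafwise.hodgeStar_zero]
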